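/- Let $d\in\{1,2,3,7,11\}$, let $K=\mathbb{Q}(\sqrt{-d})\subset\mathbb{C}$, with discriminant $d_K$ and ring of integers $\mathcal{O}_d$, let $k\ge 1$ be an odd integer, and let $\Delta$ be a positive integer which is not of the form $|b|^2$ with $b\in\mathcal{O}_d$. For $z\in\mathbb{C}$ put $$H_{k,\Delta}(z)=\sum_{\substack{a,c\in\mathbb{Z},\ b\in\mathcal{O}_d\\ |b|^2-ac=\Delta,\ a<0}}\max\bigl(0,(a|z|^2+bz+\bar b\bar z+c)^k\bigr).$$ For integers $D$ and $n\ge1$ let $r(D,n)$ be the number of $\beta\in\mathcal{O}_d/n\mathcal{O}_d$ with $\beta\bar\beta+D\equiv 0\pmod n$, and put $Z(D,s)=\sum_{n\ge1} r(D,n)\,n^{-s-1}$. Then the series defining $H_{k,\Delta}(z)$ converges for every $z\in\mathbb{C}$; $H_{k,\Delta}$ is integrable on $\mathcal P$ for every fundamental parallelogram $\mathcal{P}$ of the lattice $\mathcal{O}_d$ (spanned by a $\mathbb{Z}$-basis); the series $Z(-\Delta,k+1)$ converges absolutely; and the average $\langle H_{k,\Delta}\rangle_{av}=\frac{1}{|\mathcal{P}|}\int_{\mathcal{P}}H_{k,\Delta}(x+iy)\,dx\,dy$,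 where $|\mathcal P|$ is the area of $\mathcal P$, satisfies $$\langle H_{k,\Delta}\rangle_{av}=\frac{2\pi\Delta^{k+1}}{(k+1)\sqrt{|d_K|}}\,Z(-\Delta,k+1)=\frac{2\pi\Delta^{k+1}}{(k+1)\sqrt{|d_K|}}\,\theta(-\Delta,k+1)\,\zeta(k+1)\,L(\chi_{d_K},k+2)^{-1}.$$ Here $\zeta$ is the Riemann zeta function, $L(\chi_{d_K},s)=\sum_{n\ge1}\left(\frac{d_K}{n}\right)n^{-s}$ with the Kronecker symbol $\left(\frac{\cdot}{\cdot}\right)$, and for a nonzero integer $D$ $$\theta(D,s)=\prod_{p\mid d_KD}R_p(D,p^{-1-s}),$$ the product being over primes, where, with $p^t\,\|\,D$ and $D_0=p^{-t}D$, $$R_p(D,X)=\begin{cases} \dfrac{1-\left(\left(\frac{d_K}{p}\right)pX\right)^{t+1}}{1-\left(\frac{d_K}{p}\right)pX}&\text{if } p\nmid d_K,\\[2mm] 1+\left(\frac{-|d_K/p|^t\,D_0}{p}\right)(pX)^{t+1}&\text{if } p\mid d_K,\ p\ne2,\\[1mm] 1+\left(\frac{8}{D_0\delta^t}\right)(2X)^{t+3}&\text{if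 } p=2,\ 4\mid d_K,\ d_K/4\equiv2\pmod 8,\\[1mm] 1-\left(\frac{-8}{D_0\delta^t}\right)(2X)^{t+3}&\text{if } p=2,\ 4\mid d_K,\ d_K/4\equiv6\pmod 8,\\[1mm] 1-\left(\frac{-4}{D_0\delta^t}\right)(2X)^{t+2}&\text{if } p=2,\ 4\mid d_K,\ d_K/4\equiv3,7\pmod 8, \end{cases}$$ with $\delta=-\frac{d_K}{8}$ if $d_K/4\equiv2\pmod4$ and $\delta=\frac{1-d_K/4}{2}$ if $d_K/4\equiv3\pmod 4$. -/

import Mathlib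

open MeasureTheory NumberField

noncomputable section

/-- The imaginary quadratic field `K = ℚ(√-d)`, as a subfield of `ℂ`. -/
abbrev imagQuadField (d : ℕ) : IntermediateField ℚ ℂ :=
  IntermediateField.adjoin ℚ {(Real.sqrt d : ℂ) * Complex.I}

instance imagQuadField_numberField (d : ℕ) : NumberField (imagQuadField d) where
  to_charZero := inferInstance
  to_finiteDimensional := by
    apply IntermediateField.adjoin.finiteDimensional
    refine ⟨Polynomial.X ^ 2 + Polynomial.C (d : ℚ),
      Polynomial.monic_X_pow_add_C _ two_ne_zero, ?_⟩
    have h : ((Real.sqrt d : ℝ) : ℂ) ^ 2 = (d : ℂ) := by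
      rw [← Complex.ofReal_pow, Real.sq_sqrt (Nat.cast_nonneg d)]
      simp
    simp [Polynomial.eval₂_add, mul_pow, h]

/-- The inclusion of the ring of integers `𝒪_d` of `ℚ(√-d)` in `ℂ`. -/
def intToComplex {d : ℕ} (b : 𝓞 (imagQuadField d)) : ℂ :=
  ((b : imagQuadField d) : ℂ)

/-- A binary Hermitian form `a|z|² + b z w̄ + b̄ z̄ w + c|w|²` with coefficients in `𝒪_d`, that is a
Hermitian matrix with rows `(a, b)` and `(b̄, c)`, where `a, c ∈ 𝒪_d ∩ ℝ = ℤ` and `b ∈ 𝒪_d`. -/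
structure BinHermForm (d : ℕ) where
  a : ℤ
  b : 𝓞 (imagQuadField d)
  c : ℤ

/-- The discriminant of a binary Hermitian form: the determinant `ac - |b|²` of its matrix. -/
def BinHermForm.disc {d : ℕ} (h : BinHermForm d) : ℝ :=
  (h.a : ℝ) * (h.c : ℝ) - Complex.normSq (intToComplex h.b)

/-- The value `h(z, 1) = a|z|² + bz + b̄z̄ + c`, where `bz + b̄z̄ = 2 Re (bz)`. -/
def BinHermForm.eval {d : ℕ} (h : BinHermForm d) (z : ℂ) : ℝ :=
  (h.a : ℝ) * Complex.normSq z + 2 * (intToComplex h.b * z).re + (h.c : ℝ)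

/-- The forms of discriminant `-Δ` with negative first coefficient. -/
def negForms (d Δ : ℕ) : Set (BinHermForm d) :=
  {h | h.disc = -(Δ : ℝ) ∧ h.a < 0}

/-- The function `H_{k,Δ}`. -/
def hermSum (d k Δ : ℕ) (z : ℂ) : ℝ :=
  ∑' h : negForms d Δ, max 0 (h.1.eval z ^ k)

/-- The fundamental parallelogram of the lattice `𝒪_d ⊆ ℂ` spanned by a `ℤ`-basis of `𝒪_d`. -/
def fundParallelogram {d : ℕ} (B : Module.Basis (Fin 2) ℤ (𝓞 (imagQuadField d))) : Set ℂ :=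
  {z | ∃ s ∈ Set.Icc (0 : ℝ) 1, ∃ t ∈ Set.Icc (0 : ℝ) 1,
    z = (s : ℂ) * intToComplex (B 0) + (t : ℂ) * intToComplex (B 1)}

/-- `r(Δ, n)`: the number of `β ∈ 𝒪_d / n𝒪_d` with `ββ̄ + Δ ≡ 0 (mod n)`, that is
with `ββ̄ + Δ ∈ n𝒪_d` for a (equivalently, for every) representative `β`. -/
def repCount (d : ℕ) (Δ : ℤ) (n : ℕ) : ℕ :=
  Nat.card {x : 𝓞 (imagQuadField d) ⧸ Ideal.span {(n : 𝓞 (imagQuadField d))} //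
    ∃ β γ : 𝓞 (imagQuadField d), Ideal.Quotient.mk _ β = x ∧
      intToComplex β * (starRingEnd ℂ) (intToComplex β) + (Δ : ℂ) = (n : ℂ) * intToComplex γ}

/-- `Z(Δ, s) = ∑_{n ≥ 1} r(Δ, n) / n^{s+1}`. -/
def hermZeta (d : ℕ) (Δ : ℤ) (s : ℂ) : ℂ :=
  LSeries (fun n => (repCount d Δ n : ℂ)) (s + 1)

/-- The Kronecker symbol `(a / n)` for integers `a` and `n`. With `n = ± 2^e m`, `m > 0` odd, it is
`(a / ±1) (a / 2)^e (a / m)`: here `(a / -1)` is the sign of `a` (and `1` at `a = 0`), `(a / 2)` is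
`0` for even `a`, `1` for `a ≡ ±1` and `-1` for `a ≡ ±3` modulo `8`, and `(a / m)` is the Jacobi
symbol. -/
def kroneckerSymbol (a n : ℤ) : ℤ :=
  if n = 0 then (if a.natAbs = 1 then 1 else 0)
  else (if a < 0 ∧ n < 0 then -1 else 1) * ZMod.χ₈ (a : ZMod 8) ^ padicValInt 2 n *
    jacobiSym a (n.natAbs / 2 ^ padicValInt 2 n)

/-- The value at `s` of `L(χ_D, s) = ∑_{n ≥ 1} (D / n) n^{-s}`. -/
def quadL (D : ℤ) (s : ℂ) : ℂ :=
  LSeries (fun n => (kroneckerSymbol D n : ℂ)) s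

/-- The number `D₂` attached to a fundamental discriminant `D = 4 D₁`. -/
def dyadicPart (D : ℤ) : ℤ :=
  if D / 4 % 4 = 2 then -(D / 4 / 2) else (1 - D / 4) / 2

/-- The factor `R_p(Δ, X)` for the fundamental discriminant `D` and `Δ ≠ 0`. Here `t` is the
exponent of `p` in `Δ` and `Δ₀ = p^{-t} Δ`; the last line covers `p = 2`, `4 ∣ D` and
`D/4 ≡ 3, 7 (mod 8)`. -/
def localFactor (D : ℤ) (p : ℕ) (Δ : ℤ) (X : ℂ) : ℂ :=
  let t : ℕ := padicValInt p Δ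
  let Δ₀ : ℤ := Δ / (p : ℤ) ^ t
  if ¬ (p : ℤ) ∣ D then
    (1 - ((kroneckerSymbol D p : ℂ) * (p * X)) ^ (t + 1)) / (1 - (kroneckerSymbol D p : ℂ) * (p * X))
  else if p ≠ 2 then
    1 + (kroneckerSymbol (-(|D / (p : ℤ)| ^ t * Δ₀)) p : ℂ) * (p * X) ^ (t + 1)
  else if D / 4 % 8 = 2 then
    1 + (kroneckerSymbol 8 (Δ₀ * dyadicPart D ^ t) : ℂ) * (2 * X) ^ (t + 3)
  else if D / 4 % 8 = 6 then
    1 - (kroneckerSymbol (-8) (Δ₀ * dyadicPart D ^ t) : ℂ) * (2 * X) ^ (t + 3)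
  else
    1 - (kroneckerSymbol (-4) (Δ₀ * dyadicPart D ^ t) : ℂ) * (2 * X) ^ (t + 2)

/-- The finite Euler product `θ(Δ, s) = ∏_{p ∣ DΔ} R_p(Δ, p^{-1-s})`. -/
def eulerTheta (D Δ : ℤ) (s : ℂ) : ℂ :=
  ∏ p ∈ (D * Δ).natAbs.primeFactors, localFactor D p Δ ((p : ℂ) ^ (-1 - s))

end

/-! The argument has three parts.

Boundedness. Let F(z) be the sum defining H(z), with values in [0, ∞]. Translation by an integer of
K permutes the forms and fixes a, so F is periodic under the lattice of integers. Exchanging a and c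
corresponds to z ↦ 1/z̄ with weight |z|². Forms with a, c < 0 are exchanged among themselves. The
value c = 0 would make Δ a norm. Forms with a < 0 < c satisfy |b|² + |a|c = Δ and are finite in
number. Hence F(z) ≤ C + |z|^{2k} F(1/z̄) on the unit disc (`formSum_le_inv`). For the five values
of d, every point of ℂ lies within squared distance 15/16 of the lattice. The Euclidean algorithm
therefore bounds F by 16C at the points of K (`formSum_div_le`), and density of K extends the bound
to all z (`formSum_le`). Convergence and integrability follow, and so does the convergence of Z: its
terms are, up to a constant factor, the terms of a finite integral.

Average. With a = -n and β = b̄, the value of the form is Δ/n - n|z - β/n|², where n divides ββ̄ -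
Δ. For fixed n the centres β/n fall into r(-Δ, n) classes modulo the lattice. Each class unfolds the
integral over the parallelogram to one over ℂ, equal to πΔ^{k+1}/((k+1)n^{k+2})
(`tsum_congruence_setLIntegral`, `integral_discBump`). Dividing by the area √|d_K|/2 gives the
formula with Z.

Euler product. r(-Δ, n) counts the solutions modulo n of x² + εxy + cy² ≡ Δ, the left side being the
norm form. It is multiplicative, and at each prime the series ∑ r(-Δ, p^e)X^e equals R_p(-Δ, X)(1 -
χ(p)X)/(1 - pX), with χ the character of K (`hasSum_localFactor`). At unramified p, solutions not
divisible by p lift by Hensel's lemma, and the others divide by p², which lowers t by 2. At ramified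
p, the prime above p is principal; dividing by its generator lowers t by 1, down to t = 0, where
Hensel lifting starts from a count modulo p or 8. With X = p^{-k-2} the product over p is θ
ζ(k+1)/L(χ, k+2) (`LSeries_congCount_eq`). -/

/-! ### Sums of periodic functions over residues -/

section PeriodSums

/-- The sum of `f` over a set of representatives modulo `n`. -/
def periodSum (n : ℕ) (f : ℤ → ℕ) : ℕ := ∑ x ∈ Finset.range n, f x

/-- The sum of `f` over a set of representatives of `ℤ²` modulo `n`. -/
def boxSum (n : ℕ) (f : ℤ → ℤ → ℕ) : ℕ := periodSum n fun x => periodSum n (f x)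

/-- Periodicity modulo `n`, phrased through congruences. -/
def PeriodicMod (n : ℕ) (f : ℤ → ℕ) : Prop := ∀ x y : ℤ, (n : ℤ) ∣ x - y → f x = f y

/-- Periodicity modulo `n` in both variables. -/
def PeriodicMod₂ (n : ℕ) (f : ℤ → ℤ → ℕ) : Prop :=
  ∀ x y x' y' : ℤ, (n : ℤ) ∣ x - x' → (n : ℤ) ∣ y - y' → f x y = f x' y'

theorem periodSum_congr {n : ℕ} {f g : ℤ → ℕ} (h : ∀ x, f x = g x) :
    periodSum n f = periodSum n g := by
  rw [show f = g from funext h]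

theorem boxSum_congr {n : ℕ} {f g : ℤ → ℤ → ℕ} (h : ∀ x y, f x y = g x y) :
    boxSum n f = boxSum n g := by
  rw [show f = g from funext fun x => funext fun y => h x y]

theorem periodSum_const_mul (n a : ℕ) (f : ℤ → ℕ) :
    periodSum n (fun x => a * f x) = a * periodSum n f := by
  simp [periodSum, Finset.mul_sum]

theorem boxSum_const_mul (n a : ℕ) (f : ℤ → ℤ → ℕ) :
    boxSum n (fun x y => a * f x y) = a * boxSum n f := by
  simp [boxSum, periodSum_const_mul]

theorem boxSum_add (n : ℕ) (f g : ℤ → ℤ → ℕ) :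
    boxSum n (fun x y => f x y + g x y) = boxSum n f + boxSum n g := by
  simp [boxSum, periodSum, Finset.sum_add_distrib]

theorem boxSum_sum {ι : Type*} (s : Finset ι) (n : ℕ) (f : ι → ℤ → ℤ → ℕ) :
    boxSum n (fun x y => ∑ i ∈ s, f i x y) = ∑ i ∈ s, boxSum n (f i) := by
  simp only [boxSum, periodSum]
  calc _ = ∑ x ∈ Finset.range n, ∑ i ∈ s, ∑ y ∈ Finset.range n, f i x y :=
        Finset.sum_congr rfl fun x _ => Finset.sum_comm
    _ = _ := Finset.sum_comm

theorem boxSum_comm (n : ℕ) (f : ℤ → ℤ → ℕ) :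
    boxSum n f = boxSum n fun x y => f y x := by
  simp only [boxSum, periodSum]
  rw [Finset.sum_comm]

theorem boxSum_one (f : ℤ → ℤ → ℕ) : boxSum 1 f = f 0 0 := by
  simp [boxSum, periodSum]

/-- Since `A` is invertible modulo `n`, the affine map permutes the residues. -/
theorem periodSum_affine {n : ℕ} {f : ℤ → ℕ} (hf : PeriodicMod n f) {A : ℤ}
    (hA : IsCoprime A n) (i : ℤ) :
    periodSum n (fun x => f (A * x + i)) = periodSum n f := by
  rcases Nat.eq_zero_or_pos n with rfl | hn
  · simp [periodSum]
  have hn' : (0 : ℤ) < n := by exact_mod_cast hn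
  have hmaps : ∀ x : ℕ, (((A * x + i) % n).toNat : ℤ) = (A * x + i) % n := fun x =>
    Int.toNat_of_nonneg (Int.emod_nonneg _ hn'.ne')
  have hmt : Set.MapsTo (fun x : ℕ => ((A * x + i) % n).toNat) (Finset.range n)
      (Finset.range n) := by
    intro x _
    simp only [Finset.coe_range, Set.mem_Iio]
    have := Int.emod_lt_of_pos (A * x + i) hn'
    have := hmaps x
    omega
  have hinj : Set.InjOn (fun x : ℕ => ((A * x + i) % n).toNat) (Finset.range n) := by
    intro x hx y hy hxy
    simp only [Finset.coe_range, Set.mem_Iio] at hx hy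
    have h1 : (A * x + i) % n = (A * y + i) % n := by
      rw [← hmaps x, ← hmaps y]; exact_mod_cast hxy
    have h2 : (n : ℤ) ∣ A * (y - x) := by
      have h3 := Int.dvd_of_emod_eq_zero (Int.emod_eq_emod_iff_emod_sub_eq_zero.1 h1.symm)
      convert h3 using 1; ring
    have h3 : (n : ℤ) ∣ y - x := hA.symm.dvd_of_dvd_mul_left h2
    have h4 := Int.eq_zero_of_abs_lt_dvd h3 (by rw [abs_lt]; omega)
    omega
  refine Finset.sum_nbij (fun x : ℕ => ((A * x + i) % n).toNat) (fun x hx => hmt hx) hinj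
    (Finset.surjOn_of_injOn_of_card_le _ hmt hinj le_rfl) ?_
  intro x _
  rw [hmaps]
  apply hf
  exact Int.dvd_self_sub_emod

theorem periodSum_shift {n : ℕ} {f : ℤ → ℕ} (hf : PeriodicMod n f) (a : ℤ) :
    periodSum n (fun x => f (x + a)) = periodSum n f := by
  simpa using periodSum_affine hf (A := 1) isCoprime_one_left a

theorem periodSum_blocks (n k : ℕ) (f : ℤ → ℕ) :
    periodSum (n * k) f = ∑ j ∈ Finset.range k, periodSum n fun x => f (x + n * j) := by
  induction k with
  | zero => simp [periodSum]
  | succ k ih =>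
    rw [Finset.sum_range_succ, ← ih, Nat.mul_succ]
    unfold periodSum
    rw [Finset.sum_range_add]
    congr 1
    refine Finset.sum_congr rfl fun x _ => ?_
    push_cast
    rw [add_comm]

theorem periodSum_mul {n : ℕ} {f : ℤ → ℕ} (hf : PeriodicMod n f) (k : ℕ) :
    periodSum (n * k) f = k * periodSum n f := by
  rw [periodSum_blocks]
  rw [Finset.sum_congr rfl fun (j : ℕ) _ => periodSum_shift hf ((n : ℤ) * j)]
  simp

theorem periodSum_dvd {p : ℕ} (hp : 0 < p) (n : ℕ) (f : ℤ → ℕ) :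
    periodSum (p * n) (fun x => if (p : ℤ) ∣ x then f x else 0) =
      periodSum n fun x => f (p * x) := by
  rw [periodSum_blocks]
  refine Finset.sum_congr rfl fun j _ => ?_
  unfold periodSum
  rw [Finset.sum_eq_single 0]
  · simp
  · intro b hb hb0
    refine if_neg ?_
    rw [dvd_add_left (dvd_mul_right _ _)]
    intro h
    have := Nat.le_of_dvd (Nat.pos_of_ne_zero hb0) (Int.natCast_dvd_natCast.1 h)
    have := Finset.mem_range.1 hb
    omega
  · simp only [Finset.mem_range]
    omega

/-- Write a residue modulo ab as x + aj: `f` sees only x, while j ↦ x + aj permutes the residues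
modulo b. -/
theorem periodSum_crt {a b : ℕ} (hab : a.Coprime b) {f g : ℤ → ℕ} (hf : PeriodicMod a f)
    (hg : PeriodicMod b g) :
    periodSum (a * b) (fun x => f x * g x) = periodSum a f * periodSum b g := by
  rw [periodSum_blocks]
  have h1 : ∀ x : ℤ, ∀ j : ℕ, f (x + a * j) = f x := fun x j => hf _ _ ⟨j, by ring⟩
  simp only [h1]
  unfold periodSum
  rw [Finset.sum_comm, Finset.sum_mul]
  refine Finset.sum_congr rfl fun x _ => ?_
  rw [← Finset.mul_sum]
  congr 1
  have := periodSum_affine hg (A := a) (by exact_mod_cast Nat.isCoprime_iff_coprime.2 hab) x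
  rw [periodSum] at this
  simp only [add_comm] at this ⊢
  exact this

theorem PeriodicMod₂.left {n : ℕ} {f : ℤ → ℤ → ℕ} (hf : PeriodicMod₂ n f) (x : ℤ) :
    PeriodicMod n (f x) := fun y y' h => hf x y x y' (by simp) h

theorem PeriodicMod₂.periodSum {n : ℕ} {f : ℤ → ℤ → ℕ} (hf : PeriodicMod₂ n f) (m : ℕ) :
    PeriodicMod n fun x => periodSum m (f x) :=
  fun x x' h => periodSum_congr fun y => hf x y x' y h (by simp)

theorem boxSum_shift {n : ℕ} {f : ℤ → ℤ → ℕ} (hf : PeriodicMod₂ n f) (a b : ℤ) :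
    boxSum n (fun x y => f (x + a) (y + b)) = boxSum n f := by
  unfold boxSum
  rw [periodSum_congr fun x => periodSum_shift (hf.left (x + a)) b]
  exact periodSum_shift (hf.periodSum n) a

theorem boxSum_shear {n : ℕ} {f : ℤ → ℤ → ℕ} (hf : PeriodicMod₂ n f) (s : ℤ) :
    boxSum n (fun x y => f x (y + s * x)) = boxSum n f := by
  unfold boxSum
  exact periodSum_congr fun x => periodSum_shift (hf.left x) _

theorem PeriodicMod₂.swap {n : ℕ} {f : ℤ → ℤ → ℕ} (hf : PeriodicMod₂ n f) :
    PeriodicMod₂ n fun x y => f y x := fun x y x' y' h h' => hf y x y' x' h' h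

theorem boxSum_shear' {n : ℕ} {f : ℤ → ℤ → ℕ} (hf : PeriodicMod₂ n f) (s : ℤ) :
    boxSum n (fun x y => f (x + s * y) y) = boxSum n f := by
  rw [boxSum_comm, boxSum_shear hf.swap, boxSum_comm]

theorem boxSum_mul {n : ℕ} {f : ℤ → ℤ → ℕ} (hf : PeriodicMod₂ n f) (k : ℕ) :
    boxSum (n * k) f = k ^ 2 * boxSum n f := by
  unfold boxSum
  rw [periodSum_congr fun x => periodSum_mul (hf.left x) k, periodSum_const_mul,
    periodSum_mul (hf.periodSum n)]
  ring

theorem boxSum_crt {a b : ℕ} (hab : a.Coprime b) {f g : ℤ → ℤ → ℕ} (hf : PeriodicMod₂ a f)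
    (hg : PeriodicMod₂ b g) :
    boxSum (a * b) (fun x y => f x y * g x y) = boxSum a f * boxSum b g := by
  unfold boxSum
  rw [periodSum_congr fun x => periodSum_crt hab (hf.left x) (hg.left x)]
  exact periodSum_crt hab (hf.periodSum a) (hg.periodSum b)

/-- The number of solutions modulo a prime of a nontrivial linear congruence in two variables. -/
theorem boxSum_linear {p : ℕ} (hp : p.Prime) {A B : ℤ} (hAB : ¬((p : ℤ) ∣ A ∧ (p : ℤ) ∣ B))
    (t : ℤ) : boxSum p (fun u v => if (p : ℤ) ∣ t + A * u + B * v then 1 else 0) = p := by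
  have key : ∀ {A : ℤ}, ¬(p : ℤ) ∣ A → ∀ t : ℤ,
      periodSum p (fun u => if (p : ℤ) ∣ A * u + t then 1 else 0) = 1 := by
    intro A hA t
    have hper : PeriodicMod p fun x => if (p : ℤ) ∣ x then 1 else 0 := by
      intro x y h
      simp only [(dvd_iff_dvd_of_dvd_sub h)]
    rw [periodSum_affine hper
      ((Nat.prime_iff_prime_int.1 hp).coprime_iff_not_dvd.2 hA).symm t]
    have := periodSum_dvd hp.pos 1 (fun _ => 1)
    rw [mul_one] at this
    rw [this]
    simp [periodSum]
  rcases not_and_or.1 hAB with h | h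
  · rw [boxSum_comm]
    simp only [boxSum, show ∀ u v, t + A * u + B * v = A * u + (t + B * v) by intros; ring, key h]
    simp [periodSum]
  · simp only [boxSum, show ∀ u v, t + A * u + B * v = B * v + (t + A * u) by intros; ring, key h]
    simp [periodSum]

end PeriodSums

/-! ### Solutions of a binary quadratic congruence and Hensel lifting -/

section FormCounts

/-- The binary quadratic form `x² + εxy + cy²`. -/
def binForm (ε c x y : ℤ) : ℤ := x ^ 2 + ε * x * y + c * y ^ 2

/-- The number of solutions modulo `n` of `x² + εxy + cy² ≡ m`. -/
def congCount (ε c m : ℤ) (n : ℕ) : ℕ :=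
  boxSum n fun x y => if (n : ℤ) ∣ binForm ε c x y - m then 1 else 0

theorem binForm_sub_dvd {n : ℤ} (ε c : ℤ) {x y x' y' : ℤ} (hx : n ∣ x - x') (hy : n ∣ y - y') :
    n ∣ binForm ε c x y - binForm ε c x' y' := by
  obtain ⟨a, ha⟩ := hx
  obtain ⟨b, hb⟩ := hy
  obtain rfl : x = x' + n * a := by linarith
  obtain rfl : y = y' + n * b := by linarith
  refine ⟨2 * x' * a + n * a ^ 2 + ε * (x' * b + y' * a + n * a * b) +
    c * (2 * y' * b + n * b ^ 2), ?_⟩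
  simp only [binForm]
  ring

theorem periodicMod₂_of_iff {n : ℕ} {P : ℤ → ℤ → Prop} [∀ x y, Decidable (P x y)]
    (h : ∀ x y x' y' : ℤ, (n : ℤ) ∣ x - x' → (n : ℤ) ∣ y - y' → (P x y ↔ P x' y')) :
    PeriodicMod₂ n fun x y => if P x y then 1 else 0 := by
  intro x y x' y' hx hy
  simp only [h x y x' y' hx hy]

theorem dvd_binForm_sub_iff {n : ℤ} (ε c m : ℤ) {x y x' y' : ℤ} (hx : n ∣ x - x')
    (hy : n ∣ y - y') : n ∣ binForm ε c x y - m ↔ n ∣ binForm ε c x' y' - m := by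
  have := binForm_sub_dvd ε c hx hy
  rw [show binForm ε c x y - m = (binForm ε c x y - binForm ε c x' y') + (binForm ε c x' y' - m) by
    ring]
  exact dvd_add_right this

theorem periodicMod₂_congCount (ε c m : ℤ) (n : ℕ) :
    PeriodicMod₂ n fun x y => if (n : ℤ) ∣ binForm ε c x y - m then 1 else 0 :=
  periodicMod₂_of_iff fun _ _ _ _ hx hy => dvd_binForm_sub_iff ε c m hx hy

theorem congCount_one (ε c m : ℤ) : congCount ε c m 1 = 1 := by
  simp [congCount, boxSum_one]

theorem congCount_mul (ε c m : ℤ) {a b : ℕ} (hab : a.Coprime b) :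
    congCount ε c m (a * b) = congCount ε c m a * congCount ε c m b := by
  unfold congCount
  rw [← boxSum_crt hab (periodicMod₂_congCount ε c m a) (periodicMod₂_congCount ε c m b)]
  refine boxSum_congr fun x y => ?_
  have : ((a * b : ℕ) : ℤ) ∣ binForm ε c x y - m ↔
      (a : ℤ) ∣ binForm ε c x y - m ∧ (b : ℤ) ∣ binForm ε c x y - m := by
    push_cast
    exact ⟨fun h => ⟨(dvd_mul_right _ _).trans h, (dvd_mul_left _ _).trans h⟩,
      fun h => (Nat.isCoprime_iff_coprime.2 hab).mul_dvd h.1 h.2⟩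
  by_cases h1 : (a : ℤ) ∣ binForm ε c x y - m <;> by_cases h2 : (b : ℤ) ∣ binForm ε c x y - m <;>
    simp only [this, h1, h2, and_self, and_true, true_and, if_true, if_false, mul_one, mul_zero]

/-- Hensel lifting for weighted counts of solutions, when the gradient of the form at a solution is
exactly divisible by `p ^ s`. -/
theorem boxSum_lift {p : ℕ} (hp : p.Prime) {e s : ℕ} (hs : 2 * s + 1 ≤ e) {ε c m : ℤ}
    (h2 : (p : ℤ) ^ s ∣ 2) (hε : (p : ℤ) ^ s ∣ ε) {g : ℤ → ℤ → ℕ} (hg : PeriodicMod₂ p g)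
    (hgrad : ∀ x y, g x y ≠ 0 → ((p ^ e : ℕ) : ℤ) ∣ binForm ε c x y - m → ∃ A B : ℤ,
      2 * x + ε * y = p ^ s * A ∧ ε * x + 2 * c * y = p ^ s * B ∧ ¬((p : ℤ) ∣ A ∧ (p : ℤ) ∣ B)) :
    boxSum (p ^ (e + 1)) (fun x y =>
        if ((p ^ (e + 1) : ℕ) : ℤ) ∣ binForm ε c x y - m then g x y else 0) =
      p * boxSum (p ^ e) fun x y =>
        if ((p ^ e : ℕ) : ℤ) ∣ binForm ε c x y - m then g x y else 0 := by
  have hgN : ∀ {j : ℕ}, 1 ≤ j → PeriodicMod₂ (p ^ j) g := fun {j} hj x y x' y' hx hy =>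
    have : (p : ℤ) ∣ ((p ^ j : ℕ) : ℤ) := by exact_mod_cast dvd_pow_self p (by omega)
    hg x y x' y' (this.trans hx) (this.trans hy)
  have hper : ∀ {j : ℕ}, 1 ≤ j → PeriodicMod₂ (p ^ j) fun x y =>
      if ((p ^ j : ℕ) : ℤ) ∣ binForm ε c x y - m then g x y else 0 := by
    intro j hj x y x' y' hx hy
    simp only [dvd_binForm_sub_iff ε c m hx hy, hgN hj x y x' y' hx hy]
  have hp0 : (p : ℤ) ≠ 0 := by exact_mod_cast hp.ne_zero
  set F : ℤ → ℤ → ℕ := fun x y =>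
    if ((p ^ (e + 1) : ℕ) : ℤ) ∣ binForm ε c x y - m then g x y else 0 with hF
  set E : ℤ → ℤ → ℕ := fun x y =>
    if ((p ^ e : ℕ) : ℤ) ∣ binForm ε c x y - m then g x y else 0 with hE
  -- Among the p² translates of (x, y) by p^(e-s)(u, v), exactly p solve the congruence modulo
  -- p^(e+1) if (x, y) solves it modulo p^e, and none otherwise. This is Taylor expansion: the
  -- condition on (u, v) is one nontrivial linear congruence modulo p.
  have hinner : ∀ x y : ℤ, boxSum p (fun u v => F (x + p ^ (e - s) * u) (y + p ^ (e - s) * v)) =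
      p * E x y := by
    intro x y
    have hge : ∀ u v : ℤ, g (x + p ^ (e - s) * u) (y + p ^ (e - s) * v) = g x y := fun u v =>
      hg _ _ _ _ (by
        rw [add_sub_cancel_left]
        exact (dvd_pow_self _ (by omega)).mul_right _) (by
        rw [add_sub_cancel_left]
        exact (dvd_pow_self _ (by omega)).mul_right _)
    by_cases hgx : g x y = 0
    · have h1 : ∀ u v : ℤ, F (x + p ^ (e - s) * u) (y + p ^ (e - s) * v) = 0 := by
        intro u v
        simp only [hF, hge, hgx, ite_self]
      simp only [h1, hE, hgx, ite_self, mul_zero]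
      simp [boxSum, periodSum]
    have hexp : ∀ u v : ℤ, binForm ε c (x + p ^ (e - s) * u) (y + p ^ (e - s) * v) =
        binForm ε c x y + p ^ (e - s) * ((2 * x + ε * y) * u + (ε * x + 2 * c * y) * v) +
          p ^ (2 * (e - s)) * binForm ε c u v := by
      intro u v
      simp only [binForm]
      ring
    by_cases hEx : ((p ^ e : ℕ) : ℤ) ∣ binForm ε c x y - m
    · obtain ⟨A, B, hA, hB, hAB⟩ := hgrad x y hgx hEx
      obtain ⟨t, ht⟩ := hEx
      have h1 : ∀ u v : ℤ, F (x + p ^ (e - s) * u) (y + p ^ (e - s) * v) =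
          g x y * if (p : ℤ) ∣ t + A * u + B * v then 1 else 0 := by
        intro u v
        have h2 : ((p ^ (e + 1) : ℕ) : ℤ) ∣
            binForm ε c (x + p ^ (e - s) * u) (y + p ^ (e - s) * v) - m ↔
            (p : ℤ) ∣ t + A * u + B * v := by
          have h3 : binForm ε c (x + p ^ (e - s) * u) (y + p ^ (e - s) * v) - m =
              p ^ e * (t + A * u + B * v) + p ^ (2 * (e - s)) * binForm ε c u v := by
            rw [hexp, hA, hB]
            have h4 : (p : ℤ) ^ e = p ^ (e - s) * p ^ s := by
              rw [← pow_add]; congr 1; omega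
            have : binForm ε c x y = p ^ e * t + m := by push_cast at ht; linarith
            rw [this, h4]
            ring
          -- The quadratic term vanishes modulo p^(e+1) because 2(e - s) ≥ e + 1.
          have h5 : (p : ℤ) ^ (e + 1) ∣ p ^ (2 * (e - s)) * binForm ε c u v :=
            (pow_dvd_pow _ (by omega)).mul_right _
          rw [h3]
          push_cast
          rw [dvd_add_left h5, pow_succ]
          exact mul_dvd_mul_iff_left (pow_ne_zero _ hp0)
        simp only [hF, h2, hge]
        split_ifs <;> simp
      simp only [h1, boxSum_const_mul, boxSum_linear hp hAB]
      simp only [hE]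
      rw [if_pos ⟨t, ht⟩, mul_comm]
    · have h1 : ∀ u v : ℤ, F (x + p ^ (e - s) * u) (y + p ^ (e - s) * v) = 0 := by
        intro u v
        simp only [hF]
        rw [if_neg]
        intro h
        have h0 : ((p ^ e : ℕ) : ℤ) ∣ ((p ^ (e + 1) : ℕ) : ℤ) := by
          exact_mod_cast pow_dvd_pow _ (by omega)
        have h2' := h0.trans h
        apply hEx
        rw [hexp] at h2'
        push_cast at h2' ⊢
        have h4 : (p : ℤ) ^ e = p ^ (e - s) * p ^ s := by
          rw [← pow_add]; congr 1; omega
        -- As p^s divides 2 and ε, it divides the gradient at every point, so these translations do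
        -- not change the form modulo p^e.
        have h5 : (p : ℤ) ^ e ∣ p ^ (e - s) * ((2 * x + ε * y) * u + (ε * x + 2 * c * y) * v) := by
          rw [h4]
          refine mul_dvd_mul_left _ (dvd_add (Dvd.dvd.mul_right (dvd_add (h2.mul_right _)
            (hε.mul_right _)) _) (Dvd.dvd.mul_right (dvd_add (hε.mul_right _) ?_) _))
          exact (h2.mul_right _).mul_right _
        have h6 : (p : ℤ) ^ e ∣ p ^ (2 * (e - s)) * binForm ε c u v :=
          (pow_dvd_pow _ (by omega)).mul_right _
        have h7 := dvd_sub h2' (dvd_add h5 h6)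
        rwa [add_assoc, add_sub_right_comm, add_sub_cancel_right] at h7
      simp only [h1, hE]
      rw [if_neg hEx]
      simp [boxSum, periodSum]
  have hpos : 0 < p ^ 2 := pow_pos hp.pos 2
  apply Nat.eq_of_mul_eq_mul_left hpos
  -- Averaging over the p² translations leaves the full sum unchanged, and turns it into a sum of
  -- `E` over residues modulo p^(e+1), which repeats the residues modulo p^e p² times.
  have h1 : p ^ 2 * boxSum (p ^ (e + 1)) F = boxSum (p ^ (e + 1)) fun x y => p * E x y := by
    rw [boxSum_congr fun x y => (hinner x y).symm]
    have h8 : ∀ x y : ℤ, boxSum p (fun u v => F (x + p ^ (e - s) * u) (y + p ^ (e - s) * v)) =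
        ∑ w ∈ Finset.range p ×ˢ Finset.range p,
          F (x + p ^ (e - s) * (w.1 : ℕ)) (y + p ^ (e - s) * (w.2 : ℕ)) := fun x y => by
      rw [Finset.sum_product]
      rfl
    simp only [h8]
    rw [boxSum_sum, Finset.sum_congr rfl fun w _ => boxSum_shift (hper (by omega)) _ _]
    simp only [Finset.sum_const, Finset.card_product, Finset.card_range, smul_eq_mul, pow_two]
    rfl
  rw [h1, boxSum_const_mul, pow_succ p e, boxSum_mul (hper (by omega))]
  ring

end FormCounts

/-! ### Counts modulo prime powers: reduction steps and lifting -/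

section LocalCounts

theorem congCount_congr (ε c : ℤ) {m m' : ℤ} {n : ℕ} (h : (n : ℤ) ∣ m - m') :
    congCount ε c m n = congCount ε c m' n := by
  refine boxSum_congr fun x y => ?_
  have : (n : ℤ) ∣ binForm ε c x y - m ↔ (n : ℤ) ∣ binForm ε c x y - m' :=
    dvd_iff_dvd_of_dvd_sub (by rw [sub_sub_sub_cancel_left]; rwa [← dvd_neg, neg_sub])
  simp only [this]

/-- Reduction of the count for `pm` modulo `pn` to a count for `m` modulo `n`, at a prime `p` at
which the form is a square. -/
theorem congCount_ramified_step {p : ℕ} (hp : p.Prime) {ε c s b c' : ℤ}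
    (hQ : ∀ u y : ℤ, binForm ε c (u + s * y) y = u ^ 2 + p * b * u * y + p * c' * y ^ 2)
    (m : ℤ) (n : ℕ) :
    congCount ε c (p * m) (p * n) = p * boxSum n fun u y =>
      if (n : ℤ) ∣ p * u ^ 2 + p * b * u * y + c' * y ^ 2 - m then 1 else 0 := by
  have hp0 : (p : ℤ) ≠ 0 := by exact_mod_cast hp.ne_zero
  unfold congCount
  rw [← boxSum_shear' (periodicMod₂_congCount ε c (p * m) (p * n)) s]
  set G : ℤ → ℕ := fun u => periodSum (p * n) fun y =>
    if ((p * n : ℕ) : ℤ) ∣ binForm ε c (u + s * y) y - p * m then 1 else 0 with hG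
  -- The form is u² modulo p, so a solution forces p ∣ u.
  have h1 : ∀ u, G u = if (p : ℤ) ∣ u then G u else 0 := by
    intro u
    split_ifs with hu
    · rfl
    · simp only [hG, periodSum]
      refine Finset.sum_eq_zero fun y _ => if_neg fun h => hu ?_
      have h2 : (p : ℤ) ∣ binForm ε c (u + s * y) y - p * m :=
        Dvd.dvd.trans (by push_cast; exact dvd_mul_right _ _) h
      rw [hQ] at h2
      have h3 : (p : ℤ) ∣ u ^ 2 := by
        have h4 : (p : ℤ) ∣ p * (b * u * y + c' * y ^ 2 - m) := dvd_mul_right _ _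
        have := dvd_sub h2 h4
        rwa [show u ^ 2 + p * b * u * y + p * c' * y ^ 2 - p * m - p * (b * u * y + c' * y ^ 2 - m) =
          u ^ 2 by ring] at this
      exact Int.Prime.dvd_pow' hp h3
  change periodSum (p * n) G = _
  rw [periodSum_congr h1, periodSum_dvd hp.pos]
  unfold boxSum
  rw [← periodSum_const_mul]
  refine periodSum_congr fun u => ?_
  -- After division by p the congruence has period n in y, but y still runs modulo pn: this is the
  -- factor p.
  rw [← periodSum_mul (n := n) ?_ p, mul_comm n p]
  · refine periodSum_congr fun y => ?_
    have h2 : ((p * n : ℕ) : ℤ) ∣ binForm ε c (p * u + s * y) y - p * m ↔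
        (n : ℤ) ∣ p * u ^ 2 + p * b * u * y + c' * y ^ 2 - m := by
      rw [hQ, show ((p : ℤ) * u) ^ 2 + p * b * (p * u) * y + p * c' * y ^ 2 - p * m =
        p * (p * u ^ 2 + p * b * u * y + c' * y ^ 2 - m) by ring]
      push_cast
      exact mul_dvd_mul_iff_left hp0
    simp only [h2]
  · intro y y' h
    have h2 : (n : ℤ) ∣ p * u ^ 2 + p * b * u * y + c' * y ^ 2 - m ↔
        (n : ℤ) ∣ p * u ^ 2 + p * b * u * y' + c' * y' ^ 2 - m := by
      refine dvd_iff_dvd_of_dvd_sub ?_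
      obtain ⟨k, hk⟩ := h
      exact ⟨k * (p * b * u + c' * (y + y')), by linear_combination (p * b * u + c' * (y + y')) * hk⟩
    simp only [h2]

/-- The number of solutions modulo `n` of `x² + εxy + cy² ≡ m` that are not divisible by `p`. -/
def primCount (ε c m : ℤ) (p n : ℕ) : ℕ :=
  boxSum n fun x y => if (n : ℤ) ∣ binForm ε c x y - m then
    (if (p : ℤ) ∣ x ∧ (p : ℤ) ∣ y then 0 else 1) else 0

/-- The number of solutions modulo `n` of `x² + εxy + cy² ≡ m` that are divisible by `p`. -/
def imprimCount (ε c m : ℤ) (p n : ℕ) : ℕ :=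
  boxSum n fun x y => if (p : ℤ) ∣ x ∧ (p : ℤ) ∣ y then
    (if (n : ℤ) ∣ binForm ε c x y - m then 1 else 0) else 0

theorem primCount_add_imprimCount (ε c m : ℤ) (p n : ℕ) :
    primCount ε c m p n + imprimCount ε c m p n = congCount ε c m n := by
  unfold primCount imprimCount
  rw [← boxSum_add]
  refine boxSum_congr fun x y => ?_
  split_ifs <;> rfl

theorem dvd_sq_binForm {p : ℤ} (ε c : ℤ) {x y : ℤ} (hx : p ∣ x) (hy : p ∣ y) :
    p ^ 2 ∣ binForm ε c x y := by
  obtain ⟨a, rfl⟩ := hx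
  obtain ⟨b, rfl⟩ := hy
  exact ⟨binForm ε c a b, by simp only [binForm]; ring⟩

theorem imprimCount_eq_zero {ε c m : ℤ} {p n : ℕ} {q : ℤ} (hq : q ∣ p ^ 2) (hn : q ∣ n)
    (hm : ¬q ∣ m) : imprimCount ε c m p n = 0 := by
  rw [imprimCount, boxSum_congr (g := fun _ _ => 0 * 0), boxSum_const_mul, zero_mul]
  intro x y
  split_ifs with h h'
  · exfalso
    apply hm
    have := (hq.trans (dvd_sq_binForm ε c h.1 h.2)).sub (hn.trans h')
    rwa [sub_sub_cancel] at this
  · rfl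
  · rfl

theorem boxSum_dvd {p : ℕ} (hp : 0 < p) (n : ℕ) (f : ℤ → ℤ → ℕ) :
    boxSum (p * n) (fun x y => if (p : ℤ) ∣ x ∧ (p : ℤ) ∣ y then f x y else 0) =
      boxSum n fun x y => f (p * x) (p * y) := by
  unfold boxSum
  rw [← periodSum_congr fun x => periodSum_dvd hp n (f (p * x)),
    ← periodSum_dvd hp n fun x => periodSum (p * n) fun y => if (p : ℤ) ∣ y then f x y else 0]
  refine periodSum_congr fun x => ?_
  by_cases hx : (p : ℤ) ∣ x
  · simp [hx]
  · simp [hx, periodSum]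

/-- A solution divisible by p is p(x, y) with x, y modulo pn, and division by p² leaves a congruence
modulo n; each residue pair modulo n occurs p² times. -/
theorem imprimCount_sq_mul {p : ℕ} (hp : 0 < p) (ε c m : ℤ) (n : ℕ) :
    imprimCount ε c (p ^ 2 * m) p (p ^ 2 * n) = p ^ 2 * congCount ε c m n := by
  have hp0 : (p : ℤ) ≠ 0 := by exact_mod_cast hp.ne'
  unfold imprimCount
  rw [show p ^ 2 * n = p * (p * n) by ring, boxSum_dvd hp, congCount,
    ← boxSum_mul (periodicMod₂_congCount ε c m n) p, mul_comm n p]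
  refine boxSum_congr fun x y => ?_
  have : ((p * (p * n) : ℕ) : ℤ) ∣ binForm ε c (p * x) (p * y) - p ^ 2 * m ↔
      (n : ℤ) ∣ binForm ε c x y - m := by
    rw [show binForm ε c (p * x) (p * y) - p ^ 2 * m = p * (p * (binForm ε c x y - m)) by
      simp only [binForm]; ring]
    push_cast
    rw [mul_dvd_mul_iff_left hp0, mul_dvd_mul_iff_left hp0]
  simp only [this]

theorem imprimCount_prime {p : ℕ} (hp : 0 < p) {ε c m : ℤ} (hm : (p : ℤ) ∣ m) :
    imprimCount ε c m p p = 1 := by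
  unfold imprimCount
  have := boxSum_dvd hp 1 fun x y => if (p : ℤ) ∣ binForm ε c x y - m then 1 else 0
  rw [mul_one] at this
  rw [this, boxSum_one]
  simpa [binForm] using hm

theorem primCount_congr (ε c : ℤ) {m m' : ℤ} {p n : ℕ} (h : (n : ℤ) ∣ m - m') :
    primCount ε c m p n = primCount ε c m' p n := by
  refine boxSum_congr fun x y => ?_
  have : (n : ℤ) ∣ binForm ε c x y - m ↔ (n : ℤ) ∣ binForm ε c x y - m' :=
    dvd_iff_dvd_of_dvd_sub (by rw [sub_sub_sub_cancel_left]; rwa [← dvd_neg, neg_sub])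
  simp only [this]

/-- Hensel lifting with s = 0: the gradient is a linear map of (x, y) of determinant -(ε² - 4c),
hence invertible modulo p, and vanishes modulo p only where p divides both x and y. This includes p
= 2. -/
theorem primCount_pow {p : ℕ} (hp : p.Prime) {ε c : ℤ} (hD : ¬(p : ℤ) ∣ ε ^ 2 - 4 * c) (m : ℤ)
    (e : ℕ) : primCount ε c m p (p ^ (e + 1)) = p ^ e * primCount ε c m p p := by
  induction e with
  | zero => simp
  | succ e ih =>
    have hp' := Nat.prime_iff_prime_int.1 hp
    rw [pow_succ' p e, mul_assoc, ← ih]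
    refine boxSum_lift hp (s := 0) (by omega) (by simp) (by simp) ?_ ?_
    · intro x y x' y' hx hy
      simp only [dvd_iff_dvd_of_dvd_sub hx, dvd_iff_dvd_of_dvd_sub hy]
    · intro x y hg _
      refine ⟨2 * x + ε * y, ε * x + 2 * c * y, by simp, by simp, fun h => hg (if_pos ?_)⟩
      have h1 := dvd_sub (h.1.mul_left (2 * c)) (h.2.mul_left ε)
      have h2 := dvd_sub (h.2.mul_left 2) (h.1.mul_left ε)
      have hD' : ∀ z : ℤ, (p : ℤ) ∣ -(ε ^ 2 - 4 * c) * z → (p : ℤ) ∣ z := fun z hz =>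
        (hp'.dvd_or_dvd hz).resolve_left fun h => hD (dvd_neg.1 h)
      exact ⟨hD' x (by rwa [show -(ε ^ 2 - 4 * c) * x = 2 * c * (2 * x + ε * y) -
          ε * (ε * x + 2 * c * y) by ring]),
        hD' y (by rwa [show -(ε ^ 2 - 4 * c) * y = 2 * (ε * x + 2 * c * y) -
          ε * (2 * x + ε * y) by ring])⟩

/-- By Euler's identity, twice the form is x and y times its partial derivatives. A gradient
vanishing modulo p at a solution would give p ∣ 2m. Ramification plays no role. -/
theorem congCount_lift_odd {p : ℕ} (hp : p.Prime) (h2 : p ≠ 2) (ε c : ℤ) {m : ℤ}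
    (hm : ¬(p : ℤ) ∣ m) (e : ℕ) : congCount ε c m (p ^ (e + 1)) = p ^ e * congCount ε c m p := by
  induction e with
  | zero => simp
  | succ e ih =>
    have hp' := Nat.prime_iff_prime_int.1 hp
    rw [pow_succ' p e, mul_assoc, ← ih]
    refine boxSum_lift hp (s := 0) (g := fun _ _ => 1) (by omega) (by simp) (by simp) ?_ ?_
    · intro x y x' y' hx hy
      rfl
    · intro x y _ hxy
      refine ⟨2 * x + ε * y, ε * x + 2 * c * y, by simp, by simp, fun h => hm ?_⟩
      have h1 := dvd_add (h.1.mul_left x) (h.2.mul_left y)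
      have h3 : (p : ℤ) ∣ 2 * binForm ε c x y := by
        rwa [show 2 * binForm ε c x y = x * (2 * x + ε * y) + y * (ε * x + 2 * c * y) by
          simp only [binForm]; ring]
      have h4 := (hp'.dvd_or_dvd h3).resolve_left fun h => h2
        ((Nat.prime_dvd_prime_iff_eq hp Nat.prime_two).1 (by exact_mod_cast h))
      have h5 : (p : ℤ) ∣ binForm ε c x y - m :=
        Dvd.dvd.trans (by push_cast; exact dvd_pow_self _ (by omega)) hxy
      have := h4.sub h5
      rwa [sub_sub_cancel] at this

/-- The gradient is 2(x, cy), and x, cy cannot both be even when m is odd. So s = 1 in the lifting,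
which may start only at the exponent 2s + 1 = 3. -/
theorem congCount_lift_two {c m : ℤ} (hm : ¬(2 : ℤ) ∣ m) (e : ℕ) :
    congCount 0 c m (2 ^ (e + 3)) = 2 ^ e * congCount 0 c m 8 := by
  induction e with
  | zero => simp
  | succ e ih =>
    rw [pow_succ' 2 e, mul_assoc, ← ih]
    refine boxSum_lift Nat.prime_two (s := 1) (g := fun _ _ => 1) (by omega) (by simp) (by simp)
      ?_ ?_
    · intro x y x' y' hx hy
      rfl
    · intro x y _ hxy
      refine ⟨x, c * y, by ring, by ring, fun h => hm ?_⟩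
      have h5 : (2 : ℤ) ∣ binForm 0 c x y - m :=
        Dvd.dvd.trans (by push_cast; exact dvd_pow_self _ (by omega)) hxy
      have h6 : (2 : ℤ) ∣ binForm 0 c x y := by
        have : binForm 0 c x y = x * x + y * (c * y) := by simp only [binForm]; ring
        rw [this]
        exact dvd_add (h.1.mul_left _) (h.2.mul_left _)
      have := h6.sub h5
      rwa [sub_sub_cancel] at this

end LocalCounts

/-! ### Quadratic character sums over a finite field -/

section CharacterSums

variable {F : Type*} [Field F] [Fintype F] [DecidableEq F]

theorem sum_comp_sq_eq (hF : ringChar F ≠ 2) (g : F → ℤ) :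
    ∑ y : F, g (y ^ 2) = ∑ t : F, (quadraticChar F t + 1) * g t := by
  rw [← Finset.sum_fiberwise Finset.univ (fun y : F => y ^ 2)]
  refine Finset.sum_congr rfl fun t _ => ?_
  rw [Finset.sum_congr rfl (g := fun _ => g t) fun y hy => by rw [(Finset.mem_filter.1 hy).2]]
  rw [Finset.sum_const, ← quadraticChar_card_sqrts hF t, nsmul_eq_mul]
  congr 3
  ext y
  simp

/-- Replace y² by t with weight 1 + χ(t). The sum of χ(at + b) is zero. For t ≠ 0, χ(t)χ(at + b) =
χ(a + b/t), and as 1/t runs over the nonzero elements this is a complete character sum lacking its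
term χ(a). -/
theorem sum_quadraticChar_quadratic (hF : ringChar F ≠ 2) {a b : F} (hb : b ≠ 0) (ha : a ≠ 0) :
    ∑ y : F, quadraticChar F (a * y ^ 2 + b) = -quadraticChar F a := by
  have hsum := quadraticChar_sum_zero (F := F) hF
  rw [sum_comp_sq_eq hF fun t => quadraticChar F (a * t + b)]
  simp only [add_mul, one_mul, Finset.sum_add_distrib]
  have h1 : ∑ t : F, quadraticChar F (a * t + b) = 0 := by
    rw [← hsum]
    exact Fintype.sum_bijective (fun t => a * t + b)
      ((Equiv.mulLeft₀ a ha).trans (Equiv.addRight b)).bijective _ _ fun _ => rfl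
  have h2 : ∑ t : F, quadraticChar F (a + b * t) = 0 := by
    rw [← hsum]
    refine Fintype.sum_bijective (fun t => a + b * t)
      ((Equiv.mulLeft₀ b hb).trans (Equiv.addLeft a)).bijective _ _ fun _ => rfl
  rw [h1, add_zero, ← Finset.add_sum_erase _ _ (Finset.mem_univ (0 : F))]
  rw [← Finset.add_sum_erase _ _ (Finset.mem_univ (0 : F))] at h2
  simp only [MulChar.map_zero, zero_mul, zero_add, mul_zero, add_zero] at h2 ⊢
  rw [← eq_neg_iff_add_eq_zero.2 ((add_comm _ _).trans h2)]
  refine Finset.sum_nbij' (fun t => t⁻¹) (fun t => t⁻¹) ?_ ?_ ?_ ?_ ?_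
  · intro t ht; simpa using ht
  · intro t ht; simpa using ht
  · intro t _; simp
  · intro t _; simp
  · intro t ht
    have ht : t ≠ 0 := by simpa using ht
    have : a * t + b = t * (a + b * t⁻¹) := by field_simp
    rw [this, map_mul, ← mul_assoc, ← pow_two, quadraticChar_sq_one ht, one_mul]

theorem sum_quadraticChar_const_mul_sq (a : F) :
    ∑ y : F, quadraticChar F (a * y ^ 2) = (Fintype.card F - 1) * quadraticChar F a := by
  rw [← Finset.add_sum_erase _ _ (Finset.mem_univ (0 : F))]
  rw [Finset.sum_congr rfl (g := fun _ => quadraticChar F a)]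
  · rw [Finset.sum_const, Finset.card_erase_of_mem (Finset.mem_univ _), Finset.card_univ, nsmul_eq_mul,
      Nat.cast_sub Fintype.card_pos]
    simp
  · intro y hy
    have hy : y ≠ 0 := by simpa using hy
    rw [map_mul, quadraticChar_sq_one' hy, mul_one]

end CharacterSums

/-! ### Counts modulo an odd prime -/

section OddPrimes

theorem sum_range_eq_sum_zmod {M : Type*} [AddCommMonoid M] (n : ℕ) [NeZero n] (g : ZMod n → M) :
    ∑ x ∈ Finset.range n, g (x : ZMod n) = ∑ z : ZMod n, g z := by
  refine Finset.sum_nbij' (fun x => (x : ZMod n)) ZMod.val ?_ ?_ ?_ ?_ ?_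
  · simp
  · intro z _; simpa using ZMod.val_lt z
  · intro x hx; exact ZMod.val_cast_of_lt (by simpa using hx)
  · intro z _; simp
  · simp

variable {p : ℕ} [Fact p.Prime]

theorem periodSum_sq_sub (hp : p ≠ 2) (a : ℤ) :
    (periodSum p (fun x => if (p : ℤ) ∣ x ^ 2 - a then 1 else 0) : ℤ) = legendreSym p a + 1 := by
  rw [← legendreSym.card_sqrts p hp a]
  unfold periodSum
  rw [Finset.sum_congr rfl (g := fun x : ℕ => if (x : ZMod p) ^ 2 = a then 1 else 0)
    fun x _ => ?_]
  · rw [sum_range_eq_sum_zmod p (fun z : ZMod p => if z ^ 2 = a then 1 else 0), Finset.sum_boole]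
    push_cast
    congr 2
    ext y
    simp
  · have : (p : ℤ) ∣ (x : ℤ) ^ 2 - a ↔ (x : ZMod p) ^ 2 = a := by
      rw [← ZMod.intCast_zmod_eq_zero_iff_dvd]
      push_cast
      exact sub_eq_zero
    simp only [this]

/-- Complete the square, 4Q = (2x + εy)² - (ε² - 4c)y², and for each y count the square roots of the
resulting value by 1 + the Legendre symbol. -/
theorem congCount_odd_prime (hp : p ≠ 2) (ε c m : ℤ) :
    (congCount ε c m p : ℤ) =
      p + ∑ y : ZMod p, quadraticChar (ZMod p) (((ε ^ 2 - 4 * c : ℤ) : ZMod p) * y ^ 2 +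
        ((4 * m : ℤ) : ZMod p)) := by
  have hpp : p.Prime := Fact.out
  have h2 : IsCoprime (2 : ℤ) p := by
    have := (Nat.coprime_primes Nat.prime_two hpp).2 hp.symm
    exact_mod_cast Nat.isCoprime_iff_coprime.2 this
  have h4 : IsCoprime (p : ℤ) 4 := by
    have := (h2.pow_left (m := 2)).symm
    norm_num at this
    exact this
  have hinner : ∀ y : ℤ, (periodSum p (fun x => if (p : ℤ) ∣ binForm ε c x y - m then 1 else 0) : ℤ) =
      legendreSym p ((ε ^ 2 - 4 * c) * y ^ 2 + 4 * m) + 1 := by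
    intro y
    rw [← periodSum_sq_sub hp, ← periodSum_affine (n := p) (f := fun x => if (p : ℤ) ∣ x ^ 2 -
      ((ε ^ 2 - 4 * c) * y ^ 2 + 4 * m) then 1 else 0) _ h2 (ε * y)]
    · congr 1
      refine periodSum_congr fun x => ?_
      have : (p : ℤ) ∣ binForm ε c x y - m ↔
          (p : ℤ) ∣ (2 * x + ε * y) ^ 2 - ((ε ^ 2 - 4 * c) * y ^ 2 + 4 * m) := by
        rw [show (2 * x + ε * y) ^ 2 - ((ε ^ 2 - 4 * c) * y ^ 2 + 4 * m) =
          4 * (binForm ε c x y - m) by simp only [binForm]; ring]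
        exact ⟨fun h => h.mul_left 4, h4.dvd_of_dvd_mul_left⟩
      simp only [this]
    · intro x x' h
      have : (p : ℤ) ∣ x ^ 2 - ((ε ^ 2 - 4 * c) * y ^ 2 + 4 * m) ↔
          (p : ℤ) ∣ x' ^ 2 - ((ε ^ 2 - 4 * c) * y ^ 2 + 4 * m) := by
        refine dvd_iff_dvd_of_dvd_sub ?_
        rw [sub_sub_sub_cancel_right, sq_sub_sq]
        exact h.mul_left _
      simp only [this]
  rw [congCount, boxSum_comm]
  unfold boxSum
  have h3 : ∀ f : ℤ → ℕ, (periodSum p f : ℤ) = ∑ y ∈ Finset.range p, (f y : ℤ) := fun f => by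
    simp [periodSum]
  rw [h3, Finset.sum_congr rfl fun (y : ℕ) _ => hinner y, Finset.sum_add_distrib, Finset.sum_const,
    Finset.card_range, nsmul_one, add_comm, ← sum_range_eq_sum_zmod p]
  congr 1
  refine Finset.sum_congr rfl fun y _ => ?_
  simp [legendreSym]

theorem ringChar_zmod_ne_two (hp : p ≠ 2) : ringChar (ZMod p) ≠ 2 := by
  rwa [ZMod.ringChar_zmod_n]

theorem four_mul_intCast_eq_zero_iff (hp : p ≠ 2) (m : ℤ) :
    ((4 * m : ℤ) : ZMod p) = 0 ↔ (p : ℤ) ∣ m := by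
  have hpp : p.Prime := Fact.out
  have h4 : IsCoprime (p : ℤ) 4 := by
    have := (Nat.coprime_primes hpp Nat.prime_two).2 hp
    have := (Nat.isCoprime_iff_coprime.2 this).pow_right (n := 2)
    norm_num at this
    exact this
  rw [ZMod.intCast_zmod_eq_zero_iff_dvd]
  exact ⟨h4.dvd_of_dvd_mul_left, fun h => h.mul_left 4⟩

theorem congCount_odd_unramified (hp : p ≠ 2) {ε c m : ℤ} (hD : ¬(p : ℤ) ∣ ε ^ 2 - 4 * c)
    (hm : ¬(p : ℤ) ∣ m) :
    (congCount ε c m p : ℤ) = p - legendreSym p (ε ^ 2 - 4 * c) := by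
  rw [congCount_odd_prime hp, sum_quadraticChar_quadratic (ringChar_zmod_ne_two hp)]
  · rfl
  · rwa [Ne, four_mul_intCast_eq_zero_iff hp]
  · rwa [Ne, ZMod.intCast_zmod_eq_zero_iff_dvd]

theorem congCount_odd_ramified (hp : p ≠ 2) {ε c : ℤ} (hD : (p : ℤ) ∣ ε ^ 2 - 4 * c) (m : ℤ) :
    (congCount ε c m p : ℤ) = p * (1 + legendreSym p m) := by
  rw [congCount_odd_prime hp, (ZMod.intCast_zmod_eq_zero_iff_dvd _ p).2 hD]
  simp only [zero_mul, zero_add, Finset.sum_const, Finset.card_univ, ZMod.card, nsmul_eq_mul]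
  have h2 : (2 : ZMod p) ≠ 0 := Ring.two_ne_zero (ringChar_zmod_ne_two hp)
  have : ((4 * m : ℤ) : ZMod p) = 2 ^ 2 * m := by push_cast; norm_num
  rw [this, map_mul, quadraticChar_sq_one' h2, one_mul, mul_add, mul_one]
  rfl

/-- For p ∣ m the character sum has no constant term; the zero solution, the only one divisible by
p, is then removed. -/
theorem primCount_odd_unramified (hp : p ≠ 2) {ε c m : ℤ} (hm : (p : ℤ) ∣ m) :
    (primCount ε c m p p : ℤ) = (p - 1) * (1 + legendreSym p (ε ^ 2 - 4 * c)) := by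
  have hpp : p.Prime := Fact.out
  have h1 := primCount_add_imprimCount ε c m p p
  rw [imprimCount_prime hpp.pos hm] at h1
  have h2 := congCount_odd_prime hp ε c m
  rw [(four_mul_intCast_eq_zero_iff hp m).2 hm] at h2
  simp only [add_zero] at h2
  rw [sum_quadraticChar_const_mul_sq, ZMod.card, ← h1] at h2
  push_cast at h2
  rw [show legendreSym p (ε ^ 2 - 4 * c) = quadraticChar (ZMod p) (((ε ^ 2 - 4 * c : ℤ) : ZMod p))
    from rfl]
  push_cast
  linear_combination h2

end OddPrimes

/-! ### Local generating series in X -/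

section LocalSeries

theorem PeriodicMod₂.shear {n : ℕ} {f : ℤ → ℤ → ℕ} (hf : PeriodicMod₂ n f) (s : ℤ) :
    PeriodicMod₂ n fun x y => f x (y + s * x) := fun x y x' y' hx hy => hf _ _ _ _ hx (by
  rw [show y + s * x - (y' + s * x') = (y - y') + s * (x - x') by ring]
  exact dvd_add hy (hx.mul_left s))

theorem PeriodicMod₂.shear' {n : ℕ} {f : ℤ → ℤ → ℕ} (hf : PeriodicMod₂ n f) (s : ℤ) :
    PeriodicMod₂ n fun x y => f (x + s * y) y := (hf.swap.shear s).swap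

/-- The form has discriminant 1 - 4c = -p and is the norm form of an order in which √-p has norm p.
Dividing by √-p is the idea: the form left by `congCount_ramified_step` is integrally equivalent to
the original one, by two shears. -/
theorem congCount_ramified_of_eq_four_mul_sub_one {p : ℕ} (hp : p.Prime) {c : ℤ}
    (hc : (p : ℤ) = 4 * c - 1) (m : ℤ) (n : ℕ) :
    congCount 1 c (p * m) (p * n) = p * congCount 1 c m n := by
  rw [congCount_ramified_step hp (s := 2 * c - 1) (b := 1) (c' := c)]
  · congr 1
    have hf := periodicMod₂_congCount 1 c m n
    have hf' := hf.shear' (-1)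
    rw [congCount, ← boxSum_shear' hf (-1), ← boxSum_shear hf' 2]
    refine boxSum_congr fun u y => ?_
    rw [show (p : ℤ) * u ^ 2 + p * 1 * u * y + c * y ^ 2 =
      binForm 1 c (u + -1 * (y + 2 * u)) (y + 2 * u) by simp only [binForm, hc]; ring]
  · intro u y
    simp only [binForm, hc]
    ring

/-- The counterpart with division by 1 + i: 2u² + 2uy + y² = u² + (u + y)². -/
theorem congCount_ramified_gaussian (m : ℤ) (n : ℕ) :
    congCount 0 1 ((2 : ℕ) * m) (2 * n) = 2 * congCount 0 1 m n := by
  rw [congCount_ramified_step Nat.prime_two (s := 1) (b := 1) (c' := 1)]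
  · congr 1
    have hf := periodicMod₂_congCount 0 1 m n
    rw [congCount, ← boxSum_shear hf 1]
    refine boxSum_congr fun u y => ?_
    rw [show ((2 : ℕ) : ℤ) * u ^ 2 + (2 : ℕ) * 1 * u * y + 1 * y ^ 2 =
      binForm 0 1 u (y + 1 * u) by simp only [binForm]; push_cast; ring]
  · intro u y
    simp only [binForm]
    push_cast
    ring

/-- The counterpart with division by √-2, which only interchanges the two variables. -/
theorem congCount_ramified_sqrt_two (m : ℤ) (n : ℕ) :
    congCount 0 2 ((2 : ℕ) * m) (2 * n) = 2 * congCount 0 2 m n := by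
  rw [congCount_ramified_step Nat.prime_two (s := 0) (b := 0) (c' := 1)]
  · congr 1
    rw [congCount, boxSum_comm]
    refine boxSum_congr fun u y => ?_
    rw [show ((2 : ℕ) : ℤ) * y ^ 2 + (2 : ℕ) * 0 * y * u + 1 * u ^ 2 =
      binForm 0 2 u y by simp only [binForm]; push_cast; ring]
  · intro u y
    simp only [binForm]
    push_cast
    ring

theorem congCount_emod {ε c : ℤ} (m : ℤ) {n : ℕ} (h : n ∣ 8) :
    congCount ε c m n = congCount ε c (m % 8) n :=
  congCount_congr ε c ((Int.natCast_dvd_natCast.2 h).trans (Int.dvd_self_sub_emod))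

/-- All quantities depend on m modulo 8 only, which leaves four odd residues to evaluate. -/
theorem congCount_gaussian {m : ℤ} (hm : ¬(2 : ℤ) ∣ m) :
    congCount 0 1 m 2 = 2 ∧ (congCount 0 1 m 4 : ℤ) = 4 * (1 + ZMod.χ₄ m) ∧
      (congCount 0 1 m 8 : ℤ) = 8 * (1 + ZMod.χ₄ m) := by
  have h4 : ZMod.χ₄ m = ZMod.χ₄ ((m % 8 : ℤ) : ZMod 4) := by
    congr 1
    rw [ZMod.intCast_eq_intCast_iff_dvd_sub]
    exact dvd_sub_comm.1 (Dvd.dvd.trans (by norm_num) (Int.dvd_self_sub_emod (x := m) (m := 8)))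
  rw [congCount_emod m (n := 2) (by norm_num), congCount_emod m (n := 4) (by norm_num),
    congCount_emod m (n := 8) (by norm_num), h4]
  have : m % 8 = 1 ∨ m % 8 = 3 ∨ m % 8 = 5 ∨ m % 8 = 7 := by omega
  rcases this with h | h | h | h <;> rw [h] <;> decide +kernel

theorem congCount_sqrt_two {m : ℤ} (hm : ¬(2 : ℤ) ∣ m) :
    congCount 0 2 m 2 = 2 ∧ congCount 0 2 m 4 = 4 ∧
      (congCount 0 2 m 8 : ℤ) = 8 * (1 + ZMod.χ₈' m) := by
  have h4 : ZMod.χ₈' m = ZMod.χ₈' ((m % 8 : ℤ) : ZMod 8) := by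
    congr 1
    rw [ZMod.intCast_eq_intCast_iff_dvd_sub]
    exact dvd_sub_comm.1 (Int.dvd_self_sub_emod (x := m) (m := 8))
  rw [congCount_emod m (n := 2) (by norm_num), congCount_emod m (n := 4) (by norm_num),
    congCount_emod m (n := 8) (by norm_num), h4]
  have : m % 8 = 1 ∨ m % 8 = 3 ∨ m % 8 = 5 ∨ m % 8 = 7 := by omega
  rcases this with h | h | h | h <;> rw [h] <;> decide +kernel

theorem congCount_two_unramified {c m : ℤ} (hc : c = 1 ∨ c = 2 ∨ c = 3) (hm : ¬(2 : ℤ) ∣ m) :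
    (congCount 1 c m 2 : ℤ) = 2 - ZMod.χ₈ ((1 - 4 * c : ℤ) : ZMod 8) := by
  rw [congCount_congr 1 c (m' := 1) (by push_cast; omega)]
  rcases hc with rfl | rfl | rfl <;> decide +kernel

theorem primCount_two_unramified {c m : ℤ} (hc : c = 1 ∨ c = 2 ∨ c = 3) (hm : (2 : ℤ) ∣ m) :
    (primCount 1 c m 2 2 : ℤ) = 1 + ZMod.χ₈ ((1 - 4 * c : ℤ) : ZMod 8) := by
  rw [primCount_congr 1 c (m' := 0) (by push_cast; omega)]
  rcases hc with rfl | rfl | rfl <;> decide +kernel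

theorem one_sub_ne_zero_of_norm_lt_one {Y : ℂ} (hY : ‖Y‖ < 1) : 1 - Y ≠ 0 := by
  intro h
  rw [← sub_eq_zero.1 h, norm_one] at hY
  exact lt_irrefl _ hY

theorem HasSum.of_eq {f g : ℕ → ℂ} {a : ℂ} (h : ∀ n, f n = g n) (hg : HasSum g a) : HasSum f a :=
  (funext h : f = g) ▸ hg

variable {p : ℕ} {ε c : ℤ} {X : ℂ}

theorem hasSum_of_eventually_geometric (hX : ‖(p : ℂ) * X‖ < 1) {a : ℕ → ℕ} {j b : ℕ}
    (ha : ∀ e, a (e + j) = p ^ e * b) :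
    HasSum (fun e => (a e : ℂ) * X ^ e)
      (b * X ^ j / (1 - p * X) + ∑ i ∈ Finset.range j, (a i : ℂ) * X ^ i) := by
  rw [← hasSum_nat_add_iff]
  refine HasSum.of_eq (fun e => ?_)
    ((hasSum_geometric_of_norm_lt_one hX).mul_left ((b : ℂ) * X ^ j))
  rw [ha, mul_pow]
  push_cast
  ring

/-- Solutions not divisible by p contribute a geometric series; those divisible by p contribute 1 +
X from e ≤ 1 when p ∣ m, and from e ≥ 2 on they are p² times the counts for m/p² if p² ∣ m, absent
otherwise. Hence an induction on t in steps of two. -/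
theorem hasSum_congCount_unramified (hp : p.Prime) (hD : ¬(p : ℤ) ∣ ε ^ 2 - 4 * c) {χ : ℤ}
    (hχ : χ ^ 2 = 1) (h1 : ∀ m : ℤ, ¬(p : ℤ) ∣ m → (congCount ε c m p : ℤ) = p - χ)
    (h2 : ∀ m : ℤ, (p : ℤ) ∣ m → (primCount ε c m p p : ℤ) = (p - 1) * (1 + χ))
    (hX : ‖(p : ℂ) * X‖ < 1) (t : ℕ) {m : ℤ} (hm : ¬(p : ℤ) ∣ m) :
    HasSum (fun e => (congCount ε c (p ^ t * m) (p ^ e) : ℂ) * X ^ e)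
      ((∑ i ∈ Finset.range (t + 1), ((χ : ℂ) * (p * X)) ^ i) * (1 - χ * X) / (1 - p * X)) := by
  have hY := one_sub_ne_zero_of_norm_lt_one hX
  have hχ' : (χ : ℂ) ^ 2 = 1 := by exact_mod_cast hχ
  have h1' : ∀ m : ℤ, ¬(p : ℤ) ∣ m → (congCount ε c m p : ℂ) = p - χ := fun m hm => by
    exact_mod_cast congrArg (Int.cast : ℤ → ℂ) (h1 m hm)
  have h2' : ∀ m : ℤ, (p : ℤ) ∣ m → (primCount ε c m p p : ℂ) = (p - 1) * (1 + χ) :=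
    fun m hm => by exact_mod_cast congrArg (Int.cast : ℤ → ℂ) (h2 m hm)
  -- the contribution of the solutions that are not divisible by `p`
  have hprim : ∀ m : ℤ, (p : ℤ) ∣ m → HasSum
      (fun e => (((if e = 0 then 0 else primCount ε c m p (p ^ e) : ℕ)) : ℂ) * X ^ e)
      ((p - 1) * (1 + χ) * X / (1 - p * X)) := by
    intro m hm
    have := hasSum_of_eventually_geometric hX (j := 1)
      (a := fun e => if e = 0 then 0 else primCount ε c m p (p ^ e)) (b := primCount ε c m p p)
      fun e => by simp [primCount_pow hp hD]
    simpa [h2' m hm] using this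
  have hsplit : ∀ (m : ℤ), (p : ℤ) ∣ m → ∀ {S : ℂ},
      HasSum (fun e => (imprimCount ε c m p (p ^ (e + 2)) : ℂ) * X ^ (e + 2)) S →
      HasSum (fun e => (congCount ε c m (p ^ e) : ℂ) * X ^ e)
        ((p - 1) * (1 + χ) * X / (1 - p * X) + (S + (1 + X))) := by
    intro m hm S hS
    have h3 : HasSum (fun e => ((if e = 0 then 1 else imprimCount ε c m p (p ^ e) : ℕ) : ℂ) * X ^ e)
        (S + (1 + X)) := by
      have := (hasSum_nat_add_iff (f := fun e =>
        ((if e = 0 then 1 else imprimCount ε c m p (p ^ e) : ℕ) : ℂ) * X ^ e) (g := S) 2).1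
        (by simpa using hS)
      simpa [Finset.sum_range_succ, imprimCount_prime hp.pos hm] using this
    refine HasSum.of_eq (fun e => ?_) ((hprim m hm).add h3)
    rw [← add_mul, ← Nat.cast_add]
    rcases eq_or_ne e 0 with rfl | he
    · simp [congCount_one]
    · simp only [he, if_false]
      rw [primCount_add_imprimCount]
  induction t using Nat.twoStepInduction with
  | zero =>
    have := hasSum_of_eventually_geometric hX (j := 1)
      (a := fun e => congCount ε c (p ^ 0 * m) (p ^ e)) (b := congCount ε c m p) fun e => by
        rw [pow_zero, one_mul, ← primCount_add_imprimCount ε c m p p,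
          ← primCount_add_imprimCount ε c m p (p ^ (e + 1)),
          imprimCount_eq_zero (q := p) (dvd_pow_self _ two_ne_zero) dvd_rfl hm,
          imprimCount_eq_zero (q := p) (dvd_pow_self _ two_ne_zero)
            (by push_cast; exact dvd_pow_self _ (by omega)) hm,
          add_zero, add_zero, primCount_pow hp hD]
    convert this using 1
    simp only [h1' m hm, zero_add, Finset.range_one, Finset.sum_singleton, pow_zero, one_mul,
      pow_one, congCount_one, Nat.cast_one, mul_one]
    rw [div_add' _ _ _ hY]
    congr 1
    ring
  | one =>
    have hpm : (p : ℤ) ∣ p ^ 1 * m := by simp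
    have h3 : ¬((p ^ 2 : ℕ) : ℤ) ∣ p ^ 1 * m := by
      push_cast
      rw [pow_one, pow_two]
      rw [mul_dvd_mul_iff_left (by exact_mod_cast hp.ne_zero)]
      exact hm
    -- Here p divides the value exactly once, while a solution divisible by p would make it
    -- divisible by p².
    have := hsplit _ hpm (S := 0) (by
      have : ∀ e, imprimCount ε c (p ^ 1 * m) p (p ^ (e + 2)) = 0 := fun e =>
        imprimCount_eq_zero (q := (p ^ 2 : ℕ)) (by push_cast; rfl)
          (by exact_mod_cast pow_dvd_pow _ (by omega)) h3
      simp only [this, Nat.cast_zero, zero_mul]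
      exact hasSum_zero)
    convert this using 1
    simp only [Finset.sum_range_succ, Finset.sum_range_zero]
    field_simp
    linear_combination (-(p : ℂ) * X ^ 2) * hχ'
  | more t ih _ =>
    have hpm : (p : ℤ) ∣ p ^ (t + 2) * m := (dvd_pow_self _ (by omega)).mul_right _
    have := hsplit _ hpm (S := p ^ 2 * X ^ 2 * _) (by
      refine HasSum.of_eq (fun e => ?_) (ih.mul_left ((p : ℂ) ^ 2 * X ^ 2))
      rw [show (p : ℤ) ^ (t + 2) * m = p ^ 2 * (p ^ t * m) by ring,
        show p ^ (e + 2) = p ^ 2 * p ^ e by ring, imprimCount_sq_mul hp.pos]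
      push_cast
      ring)
    convert this using 1
    -- Because χ² = 1, a shift by two indices multiplies a term by (pX)².
    have hsum : ∑ i ∈ Finset.range (t + 2 + 1), ((χ : ℂ) * (p * X)) ^ i =
        1 + χ * (p * X) + (p * X) ^ 2 * ∑ i ∈ Finset.range (t + 1), ((χ : ℂ) * (p * X)) ^ i := by
      rw [show t + 2 + 1 = (t + 1) + 2 by ring, Finset.sum_range_succ', Finset.sum_range_succ',
        Finset.mul_sum]
      have : ∀ i, ((χ : ℂ) * (p * X)) ^ (i + 1 + 1) = (p * X) ^ 2 * ((χ : ℂ) * (p * X)) ^ i := by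
        intro i
        linear_combination ((p : ℂ) * X) ^ 2 * ((χ : ℂ) * (p * X)) ^ i * hχ'
      simp only [this]
      ring
    rw [hsum]
    field_simp
    linear_combination (-(p : ℂ) * X ^ 2) * hχ'

/-- If S is the series for m, the series for pm is 1 + pX·S, and this recursion raises the exponent
of pX in the numerator by one. -/
theorem hasSum_congCount_ramified
    (hstep : ∀ (m : ℤ) (n : ℕ), congCount ε c (p * m) (p * n) = p * congCount ε c m n)
    (hX : ‖(p : ℂ) * X‖ < 1) {j : ℕ} {l : ℂ} {m : ℤ}
    (h : HasSum (fun e => (congCount ε c m (p ^ e) : ℂ) * X ^ e)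
      ((1 + l * (p * X) ^ j) / (1 - p * X))) (t : ℕ) :
    HasSum (fun e => (congCount ε c (p ^ t * m) (p ^ e) : ℂ) * X ^ e)
      ((1 + l * (p * X) ^ (t + j)) / (1 - p * X)) := by
  have hY := one_sub_ne_zero_of_norm_lt_one hX
  induction t with
  | zero => simpa using h
  | succ t ih =>
    have h1 := (hasSum_nat_add_iff (f := fun e =>
        (congCount ε c (p ^ (t + 1) * m) (p ^ e) : ℂ) * X ^ e)
        (g := p * X * ((1 + l * (p * X) ^ (t + j)) / (1 - p * X))) 1).1 (by
      refine HasSum.of_eq (fun e => ?_) (ih.mul_left ((p : ℂ) * X))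
      rw [pow_succ' (p : ℤ) t, mul_assoc, pow_succ' p e, hstep]
      push_cast
      ring)
    rw [Finset.sum_range_one, pow_zero, pow_zero, congCount_one, Nat.cast_one, mul_one] at h1
    have h2 : (1 + l * ((p : ℂ) * X) ^ (t + 1 + j)) / (1 - p * X) =
        p * X * ((1 + l * (p * X) ^ (t + j)) / (1 - p * X)) + 1 := by
      rw [← mul_div_assoc, div_add' _ _ _ hY]
      congr 1
      ring
    rw [h2]
    exact h1

theorem hasSum_congCount_ramified_odd (hp : p.Prime) (h2 : p ≠ 2) {l : ℤ} {m : ℤ}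
    (hm : ¬(p : ℤ) ∣ m) (h : (congCount ε c m p : ℤ) = p * (1 + l)) (hX : ‖(p : ℂ) * X‖ < 1) :
    HasSum (fun e => (congCount ε c m (p ^ e) : ℂ) * X ^ e)
      ((1 + l * (p * X) ^ 1) / (1 - p * X)) := by
  have hY := one_sub_ne_zero_of_norm_lt_one hX
  have h' : (congCount ε c m p : ℂ) = p * (1 + l) := by
    exact_mod_cast congrArg (Int.cast : ℤ → ℂ) h
  convert hasSum_of_eventually_geometric hX (j := 1) (a := fun e => congCount ε c m (p ^ e))
    (congCount_lift_odd hp h2 ε c hm) using 1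
  simp [congCount_one, h']
  field_simp
  ring

theorem hasSum_congCount_gaussian {m : ℤ} (hm : ¬(2 : ℤ) ∣ m) (hX : ‖((2 : ℕ) : ℂ) * X‖ < 1) :
    HasSum (fun e => (congCount 0 1 m (2 ^ e) : ℂ) * X ^ e)
      ((1 + (ZMod.χ₄ m : ℤ) * ((2 : ℕ) * X) ^ 2) / (1 - (2 : ℕ) * X)) := by
  have hY := one_sub_ne_zero_of_norm_lt_one hX
  obtain ⟨h1, h2, h3⟩ := congCount_gaussian hm
  have h2' : (congCount 0 1 m 4 : ℂ) = 4 * (1 + (ZMod.χ₄ m : ℤ)) := by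
    exact_mod_cast congrArg (Int.cast : ℤ → ℂ) h2
  have h3' : (congCount 0 1 m 8 : ℂ) = 8 * (1 + (ZMod.χ₄ m : ℤ)) := by
    exact_mod_cast congrArg (Int.cast : ℤ → ℂ) h3
  convert hasSum_of_eventually_geometric hX (j := 3) (a := fun e => congCount 0 1 m (2 ^ e))
    (congCount_lift_two hm) using 1
  simp only [Finset.sum_range_succ, Finset.sum_range_zero, pow_zero, congCount_one, pow_one, h1, h3',
    show 2 ^ 2 = 4 by norm_num, h2']
  push_cast at hY ⊢
  field_simp
  ring

theorem hasSum_congCount_sqrt_two {m : ℤ} (hm : ¬(2 : ℤ) ∣ m) (hX : ‖((2 : ℕ) : ℂ) * X‖ < 1) :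
    HasSum (fun e => (congCount 0 2 m (2 ^ e) : ℂ) * X ^ e)
      ((1 + (ZMod.χ₈' m : ℤ) * ((2 : ℕ) * X) ^ 3) / (1 - (2 : ℕ) * X)) := by
  have hY := one_sub_ne_zero_of_norm_lt_one hX
  obtain ⟨h1, h2, h3⟩ := congCount_sqrt_two hm
  have h3' : (congCount 0 2 m 8 : ℂ) = 8 * (1 + (ZMod.χ₈' m : ℤ)) := by
    exact_mod_cast congrArg (Int.cast : ℤ → ℂ) h3
  convert hasSum_of_eventually_geometric hX (j := 3) (a := fun e => congCount 0 2 m (2 ^ e))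
    (congCount_lift_two hm) using 1
  simp only [Finset.sum_range_succ, Finset.sum_range_zero, pow_zero, congCount_one, pow_one, h1, h3',
    show 2 ^ 2 = 4 by norm_num, h2]
  push_cast at hY ⊢
  field_simp
  ring

end LocalSeries

/-! ### The ring of integers in the basis 1, ω and its discriminant -/

noncomputable section RingOfIntegers

/-- The trace of the standard generator of the ring of integers of `ℚ(√-d)`. -/
def genTrace (d : ℕ) : ℤ := if d % 4 = 3 then 1 else 0

/-- The norm of the standard generator of the ring of integers of `ℚ(√-d)`. -/
def genNorm (d : ℕ) : ℤ := if d % 4 = 3 then (d + 1) / 4 else d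

/-- The standard generator of the ring of integers of `ℚ(√-d)`. -/
def quadGen (d : ℕ) : ℂ :=
  if d % 4 = 3 then (1 + Real.sqrt d * Complex.I) / 2 else Real.sqrt d * Complex.I

/-- The point `x + yω` of the lattice of integers of `ℚ(√-d)`. -/
def latticePoint (d : ℕ) (x y : ℤ) : ℂ := x + y * quadGen d

/-- The inclusion of the ring of integers of `ℚ(√-d)` in `ℂ` as a ring homomorphism. -/
def intHom (d : ℕ) : 𝓞 (imagQuadField d) →+* ℂ :=
  (imagQuadField d).val.toRingHom.comp (algebraMap (𝓞 (imagQuadField d)) (imagQuadField d))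

theorem intHom_apply {d : ℕ} (b : 𝓞 (imagQuadField d)) : intHom d b = intToComplex b := rfl

theorem intHom_injective (d : ℕ) : Function.Injective (intHom d) := fun x y h => by
  have : ((x : imagQuadField d) : ℂ) = ((y : imagQuadField d) : ℂ) := h
  exact RingOfIntegers.ext (Subtype.ext this)

theorem sqrt_mul_I_sq (d : ℕ) : ((Real.sqrt d : ℂ) * Complex.I) ^ 2 = -d := by
  rw [mul_pow, Complex.I_sq, ← Complex.ofReal_pow, Real.sq_sqrt (Nat.cast_nonneg d)]
  simp

theorem genTrace_sq (d : ℕ) : genTrace d ^ 2 = genTrace d := by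
  unfold genTrace
  split_ifs <;> norm_num

theorem quadGen_sq (d : ℕ) : quadGen d ^ 2 = genTrace d * quadGen d - genNorm d := by
  have h := sqrt_mul_I_sq d
  unfold quadGen genTrace genNorm
  split_ifs with h3
  · have : (((d : ℤ) + 1) / 4 : ℤ) * 4 = (d : ℤ) + 1 := Int.ediv_mul_cancel (by omega)
    have h4 : ((((d : ℤ) + 1) / 4 : ℤ) : ℂ) * 4 = d + 1 := by exact_mod_cast congrArg (Int.cast : ℤ → ℂ) this
    push_cast at h4 ⊢
    linear_combination h / 4 + h4 / 4
  · rw [h]; simp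

theorem quadGen_re (d : ℕ) : (quadGen d).re = genTrace d / 2 := by
  unfold quadGen genTrace
  split_ifs <;> simp

theorem quadGen_im_sq (d : ℕ) : (quadGen d).im ^ 2 = (4 * genNorm d - genTrace d ^ 2) / 4 := by
  have h := congrArg Complex.re (quadGen_sq d)
  rw [pow_two] at h
  simp only [Complex.mul_re, Complex.sub_re, Complex.intCast_re, Complex.intCast_im, zero_mul,
    sub_zero, quadGen_re] at h
  linear_combination -h

theorem quadGen_im_pos {d : ℕ} (hd : 0 < d) : 0 < (quadGen d).im := by
  have : 0 < Real.sqrt d := Real.sqrt_pos.2 (by exact_mod_cast hd)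
  unfold quadGen
  split_ifs
  · simpa using this
  · simpa using this

theorem normSq_latticePoint (d : ℕ) (x y : ℤ) :
    Complex.normSq (latticePoint d x y) = binForm (genTrace d) (genNorm d) x y := by
  have h1 := quadGen_re d
  have h2 := quadGen_im_sq d
  simp only [latticePoint, Complex.normSq_apply, Complex.add_re, Complex.intCast_re, Complex.mul_re,
    Complex.intCast_im, zero_mul, sub_zero, Complex.add_im, zero_add, Complex.mul_im, add_zero,
    h1, binForm]
  push_cast
  linear_combination (y : ℝ) ^ 2 * h2

theorem latticePoint_inj {d : ℕ} (hd : 0 < d) {x y x' y' : ℤ}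
    (h : latticePoint d x y = latticePoint d x' y') : x = x' ∧ y = y' := by
  have him := congrArg Complex.im h
  simp only [latticePoint, Complex.add_im, Complex.intCast_im, Complex.mul_im, Complex.intCast_re,
    zero_mul, add_zero, zero_add] at him
  have hy : y = y' := by exact_mod_cast mul_right_cancel₀ (quadGen_im_pos hd).ne' him
  subst hy
  simpa [latticePoint] using h

theorem exists_rat_of_mem_imagQuadField {d : ℕ} {z : ℂ} (hz : z ∈ imagQuadField d) :
    ∃ u v : ℚ, z = u + v * (Real.sqrt d * Complex.I) := by
  have hint : IsAlgebraic ℚ ((Real.sqrt d : ℂ) * Complex.I) := by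
    refine IsIntegral.isAlgebraic ⟨Polynomial.X ^ 2 + Polynomial.C (d : ℚ),
      Polynomial.monic_X_pow_add_C _ two_ne_zero, ?_⟩
    simp [sqrt_mul_I_sq]
  rw [← IntermediateField.mem_toSubalgebra,
    IntermediateField.adjoin_simple_toSubalgebra_of_isAlgebraic hint] at hz
  induction hz using Algebra.adjoin_induction with
  | mem x hx => exact ⟨0, 1, by rw [Set.mem_singleton_iff.1 hx]; simp⟩
  | algebraMap r => exact ⟨r, 0, by simp⟩
  | add x y _ _ hx hy =>
    obtain ⟨u, v, rfl⟩ := hx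
    obtain ⟨u', v', rfl⟩ := hy
    exact ⟨u + u', v + v', by push_cast; ring⟩
  | mul x y _ _ hx hy =>
    obtain ⟨u, v, rfl⟩ := hx
    obtain ⟨u', v', rfl⟩ := hy
    refine ⟨u * u' - d * v * v', u * v' + u' * v, ?_⟩
    push_cast
    linear_combination (v : ℂ) * v' * sqrt_mul_I_sq d

/-- The square of the denominator is prime to that of the numerator, so it divides the squarefree
`d`. -/
theorem exists_int_eq_of_squarefree_mul_sq {d : ℕ} (hd : Squarefree d) {q : ℚ} {n : ℤ}
    (h : (d : ℚ) * q ^ 2 = n) : ∃ b : ℤ, q = b := by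
  have h1 : (d : ℤ) * q.num ^ 2 = n * (q.den : ℤ) ^ 2 := by
    have h2 := q.num_div_den
    have h3 : (q.den : ℚ) ≠ 0 := by exact_mod_cast q.den_ne_zero
    rw [← h2, div_pow, ← mul_div_assoc, div_eq_iff (pow_ne_zero 2 h3)] at h
    exact_mod_cast h
  have h2 : (q.den : ℤ) ^ 2 ∣ d :=
    ((Rat.isCoprime_num_den q).symm.pow (m := 2) (n := 2)).dvd_of_dvd_mul_right ⟨n, by
      rw [h1, mul_comm]⟩
  have h3 : q.den * q.den ∣ d := by
    rw [← pow_two]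
    exact_mod_cast h2
  exact ⟨q.num, ((Rat.den_eq_one_iff q).1 (Nat.isUnit_iff.1 (hd _ h3))).symm⟩

theorem exists_int_eq_of_isIntegral {q : ℚ} (h : IsIntegral ℤ (q : ℂ)) : ∃ n : ℤ, q = n := by
  have h1 : IsIntegral ℤ q := by
    rw [show (q : ℂ) = algebraMap ℚ ℂ q by simp] at h
    exact (isIntegral_algebraMap_iff (algebraMap ℚ ℂ).injective).1 h
  obtain ⟨n, hn⟩ := IsIntegrallyClosed.isIntegral_iff.1 h1
  exact ⟨n, by rw [← hn]; simp⟩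

theorem isIntegral_intToComplex {d : ℕ} (b : 𝓞 (imagQuadField d)) :
    IsIntegral ℤ (intToComplex b) :=
  b.isIntegral_coe.map ((imagQuadField d).val.restrictScalars ℤ)

/-- Trace and norm of u + v√-d are integers, so a = 2u is an integer, then d(2v)² is, and
squarefreeness makes c = 2v one. Then a² + dc² = 4N, and parities modulo 4 decide which
half-integers occur. -/
theorem exists_latticePoint_eq {d : ℕ} (hd : Squarefree d) (b : 𝓞 (imagQuadField d)) :
    ∃ x y : ℤ, intToComplex b = latticePoint d x y := by
  obtain ⟨u, v, huv⟩ := exists_rat_of_mem_imagQuadField (b : imagQuadField d).2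
  have hz := isIntegral_intToComplex b
  have hz' : IsIntegral ℤ ((starRingEnd ℂ) (intToComplex b)) :=
    hz.map (starRingEnd ℂ).toIntAlgHom
  have hconj : (starRingEnd ℂ) (intToComplex b) = u - v * (Real.sqrt d * Complex.I) := by
    rw [intToComplex, huv]
    simp [sub_eq_add_neg]
  have huv' : intToComplex b = u + v * (Real.sqrt d * Complex.I) := huv
  have hs := sqrt_mul_I_sq d
  obtain ⟨a, ha⟩ := exists_int_eq_of_isIntegral (q := 2 * u) (by
    have := hz.add hz'
    rwa [hconj, huv', show (u : ℂ) + v * (Real.sqrt d * Complex.I) +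
      (u - v * (Real.sqrt d * Complex.I)) = (2 * u : ℚ) by push_cast; ring] at this)
  obtain ⟨N, hN⟩ := exists_int_eq_of_isIntegral (q := u ^ 2 + d * v ^ 2) (by
    have := hz.mul hz'
    rwa [hconj, huv', show ((u : ℂ) + v * (Real.sqrt d * Complex.I)) *
      (u - v * (Real.sqrt d * Complex.I)) = (u ^ 2 + d * v ^ 2 : ℚ) by
        push_cast; linear_combination -(v : ℂ) ^ 2 * hs] at this)
  obtain ⟨c, hc⟩ := exists_int_eq_of_squarefree_mul_sq hd (q := 2 * v) (n := 4 * N - a ^ 2) (by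
    push_cast
    rw [← hN, ← ha]; ring)
  have heq : a ^ 2 + d * c ^ 2 = 4 * N := by
    have : (a : ℚ) ^ 2 + d * c ^ 2 = 4 * N := by rw [← hN, ← ha, ← hc]; ring
    exact_mod_cast this
  have hu : (u : ℂ) = a / 2 := by
    have : u = a / 2 := by rw [← ha]; ring
    rw [this]; push_cast; ring
  have hv : (v : ℂ) = c / 2 := by
    have : v = c / 2 := by rw [← hc]; ring
    rw [this]; push_cast; ring
  have hd0 : d % 4 ≠ 0 := by
    intro h
    have := hd 2 (by omega)
    exact absurd (Nat.isUnit_iff.1 this) (by norm_num)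
  obtain ⟨k, r, hr, hk⟩ : ∃ k r : ℤ, r = (d % 4 : ℕ) ∧ (d : ℤ) = 4 * k + r :=
    ⟨d / 4, (d % 4 : ℕ), rfl, by push_cast; omega⟩
  obtain ⟨a', i, hi, ha'⟩ : ∃ a' i : ℤ, (i = 0 ∨ i = 1) ∧ a = 2 * a' + i :=
    ⟨a / 2, a % 2, by omega, by omega⟩
  obtain ⟨c', j, hj, hc'⟩ : ∃ c' j : ℤ, (j = 0 ∨ j = 1) ∧ c = 2 * c' + j :=
    ⟨c / 2, c % 2, by omega, by omega⟩
  -- With i, j the parities of a, c and r = d mod 4, this is a² + dc² ≡ 0 modulo 4. It forces i = j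
  -- when r = 3 and i = j = 0 when r is 1 or 2.
  have hmod : ∃ t : ℤ, 4 * t = i + r * j := by
    have hi2 : i ^ 2 = i := by rcases hi with rfl | rfl <;> norm_num
    have hj2 : j ^ 2 = j := by rcases hj with rfl | rfl <;> norm_num
    refine ⟨N - a' ^ 2 - a' * i - k * c ^ 2 - r * (c' ^ 2 + c' * j), ?_⟩
    rw [hk, hc', ha'] at heq
    rw [hc']
    linear_combination -heq + hi2 + r * hj2
  obtain ⟨t, ht⟩ := hmod
  have hr' : r = 1 ∨ r = 2 ∨ r = 3 := by omega
  by_cases h3 : d % 4 = 3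
  · have hij : i = j := by
      obtain rfl : r = 3 := by omega
      rcases hi with rfl | rfl <;> rcases hj with rfl | rfl <;> omega
    refine ⟨a' - c', c, ?_⟩
    rw [huv', hu, hv, latticePoint, quadGen, if_pos h3, ha', hc', hij]
    push_cast
    ring
  · have hij : i = 0 ∧ j = 0 := by
      rcases hr' with rfl | rfl | rfl <;> rcases hi with rfl | rfl <;> rcases hj with rfl | rfl <;>
        omega
    refine ⟨a', c', ?_⟩
    rw [huv', hu, hv, latticePoint, quadGen, if_neg h3, ha', hc', hij.1, hij.2]
    push_cast
    ring

theorem quadGen_mem (d : ℕ) : quadGen d ∈ imagQuadField d := by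
  have h : (Real.sqrt d : ℂ) * Complex.I ∈ imagQuadField d :=
    IntermediateField.mem_adjoin_simple_self _ _
  unfold quadGen
  split_ifs
  · exact div_mem (add_mem (one_mem _) h) (ofNat_mem _ 2)
  · exact h

/-- The standard generator as an element of the ring of integers. -/
def intGen (d : ℕ) : 𝓞 (imagQuadField d) :=
  ⟨⟨quadGen d, quadGen_mem d⟩, by
    refine ⟨Polynomial.X ^ 2 + (Polynomial.C (-genTrace d) * Polynomial.X +
      Polynomial.C (genNorm d)), Polynomial.monic_X_pow_add (by compute_degree!), ?_⟩
    apply Subtype.ext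
    simp only [Polynomial.eval₂_add, Polynomial.eval₂_mul, Polynomial.eval₂_X_pow,
      Polynomial.eval₂_C, Polynomial.eval₂_X]
    simp [quadGen_sq]⟩

theorem intToComplex_intGen (d : ℕ) : intToComplex (intGen d) = quadGen d := rfl

/-- The algebraic integer `x + yω`. -/
def intPoint (d : ℕ) (x y : ℤ) : 𝓞 (imagQuadField d) :=
  (x : 𝓞 (imagQuadField d)) + (y : 𝓞 (imagQuadField d)) * intGen d

theorem intToComplex_intPoint (d : ℕ) (x y : ℤ) :
    intToComplex (intPoint d x y) = latticePoint d x y := by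
  rw [intPoint, ← intHom_apply, map_add, map_mul, map_intCast, map_intCast, intHom_apply,
    intToComplex_intGen, latticePoint]

theorem intPoint_add (d : ℕ) (x y x' y' : ℤ) :
    intPoint d (x + x') (y + y') = intPoint d x y + intPoint d x' y' := by
  simp only [intPoint]
  push_cast
  ring

/-- Coordinates on the ring of integers with respect to `1, ω`. -/
def intEquiv {d : ℕ} (hd : Squarefree d) : (Fin 2 → ℤ) ≃+ 𝓞 (imagQuadField d) :=
  AddEquiv.ofBijective
    (AddMonoidHom.mk' (fun w : Fin 2 → ℤ => intPoint d (w 0) (w 1)) fun _ _ => intPoint_add d _ _ _ _)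
    ⟨fun v w h => by
      have h1 : intToComplex (intPoint d (v 0) (v 1)) = intToComplex (intPoint d (w 0) (w 1)) :=
        congrArg intToComplex h
      rw [intToComplex_intPoint, intToComplex_intPoint] at h1
      have := latticePoint_inj (Nat.pos_of_ne_zero hd.ne_zero) h1
      ext i
      fin_cases i
      · exact this.1
      · exact this.2, fun b => by
      obtain ⟨x, y, h⟩ := exists_latticePoint_eq hd b
      refine ⟨![x, y], intHom_injective d ?_⟩
      rw [intHom_apply, intHom_apply, h]
      exact intToComplex_intPoint d x y⟩

/-- The basis `1, ω` of the ring of integers. -/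
def intBasis {d : ℕ} (hd : Squarefree d) : Module.Basis (Fin 2) ℤ (𝓞 (imagQuadField d)) :=
  Module.Basis.ofEquivFun (intEquiv hd).symm.toIntLinearEquiv

theorem intBasis_repr {d : ℕ} (hd : Squarefree d) (x y : ℤ) (i : Fin 2) :
    (intBasis hd).repr (intPoint d x y) i = ![x, y] i := by
  have : intPoint d x y = intEquiv hd ![x, y] := rfl
  rw [this, intBasis, Module.Basis.ofEquivFun_repr_apply]
  simp

theorem intPoint_one_zero (d : ℕ) : intPoint d 1 0 = 1 := by simp [intPoint]

theorem intPoint_zero_one (d : ℕ) : intPoint d 0 1 = intGen d := by simp [intPoint]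

theorem intBasis_zero {d : ℕ} (hd : Squarefree d) : intBasis hd 0 = 1 := by
  rw [← intPoint_one_zero, ← (intBasis hd).repr.injective.eq_iff, Module.Basis.repr_self]
  ext i
  rw [intBasis_repr]
  fin_cases i <;> simp

theorem intBasis_one {d : ℕ} (hd : Squarefree d) : intBasis hd 1 = intGen d := by
  rw [← intPoint_zero_one, ← (intBasis hd).repr.injective.eq_iff, Module.Basis.repr_self]
  ext i
  rw [intBasis_repr]
  fin_cases i <;> simp

theorem intGen_sq (d : ℕ) : intGen d * intGen d = intPoint d (-genNorm d) (genTrace d) := by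
  apply intHom_injective
  rw [map_mul, intHom_apply, intHom_apply, intToComplex_intGen, intToComplex_intPoint, ← pow_two,
    quadGen_sq, latticePoint]
  push_cast
  ring

theorem intPoint_mul_intGen (d : ℕ) (x y : ℤ) :
    intPoint d x y * intGen d = intPoint d (-y * genNorm d) (x + y * genTrace d) := by
  have h := intGen_sq d
  simp only [intPoint] at h ⊢
  push_cast at h ⊢
  linear_combination (y : 𝓞 (imagQuadField d)) * h

theorem trace_intPoint {d : ℕ} (hd : Squarefree d) (x y : ℤ) :
    Algebra.trace ℤ (𝓞 (imagQuadField d)) (intPoint d x y) = 2 * x + genTrace d * y := by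
  rw [Algebra.trace_eq_matrix_trace (intBasis hd), Matrix.trace_fin_two]
  simp only [Algebra.leftMulMatrix_eq_repr_mul, intBasis_zero, intBasis_one]
  rw [mul_one, intPoint_mul_intGen, intBasis_repr, intBasis_repr]
  simp
  ring

theorem discr_imagQuadField {d : ℕ} (hd : Squarefree d) :
    discr (imagQuadField d) = genTrace d ^ 2 - 4 * genNorm d := by
  rw [← discr_eq_discr _ (intBasis hd), Algebra.discr_def, Matrix.det_fin_two]
  simp only [Algebra.traceMatrix_apply, Algebra.traceForm_apply, intBasis_zero, intBasis_one]
  rw [mul_one, one_mul, mul_one, intGen_sq, ← intPoint_one_zero, ← intPoint_zero_one,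
    trace_intPoint hd, trace_intPoint hd, trace_intPoint hd]
  ring

end RingOfIntegers

/-! ### The numbers r(D, n) as solution counts of a congruence -/

noncomputable section RepCount

theorem exists_intPoint_eq {d : ℕ} (hd : Squarefree d) (b : 𝓞 (imagQuadField d)) :
    ∃ x y : ℤ, b = intPoint d x y := by
  obtain ⟨w, rfl⟩ := (intEquiv hd).surjective b
  exact ⟨_, _, rfl⟩

theorem natCast_mul_intPoint (d n : ℕ) (x y : ℤ) :
    (n : 𝓞 (imagQuadField d)) * intPoint d x y = intPoint d (n * x) (n * y) := by
  simp only [intPoint]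
  push_cast
  ring

theorem intPoint_inj {d : ℕ} (hd : Squarefree d) {x y x' y' : ℤ} :
    intPoint d x y = intPoint d x' y' ↔ x = x' ∧ y = y' := by
  refine ⟨fun h => ?_, fun h => by rw [h.1, h.2]⟩
  have := congrArg intToComplex h
  rw [intToComplex_intPoint, intToComplex_intPoint] at this
  exact latticePoint_inj (Nat.pos_of_ne_zero hd.ne_zero) this

theorem mk_intPoint_eq_iff {d : ℕ} (hd : Squarefree d) (n : ℕ) {x y x' y' : ℤ} :
    Ideal.Quotient.mk (Ideal.span {(n : 𝓞 (imagQuadField d))}) (intPoint d x y) =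
      Ideal.Quotient.mk _ (intPoint d x' y') ↔ (n : ℤ) ∣ x - x' ∧ (n : ℤ) ∣ y - y' := by
  have hsub : intPoint d x y - intPoint d x' y' = intPoint d (x - x') (y - y') := by
    rw [sub_eq_iff_eq_add, ← intPoint_add]
    simp
  rw [Ideal.Quotient.eq, Ideal.mem_span_singleton, hsub]
  constructor
  · rintro ⟨b, hb⟩
    obtain ⟨u, v, rfl⟩ := exists_intPoint_eq hd b
    rw [natCast_mul_intPoint, intPoint_inj hd] at hb
    exact ⟨⟨u, hb.1⟩, ⟨v, hb.2⟩⟩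
  · rintro ⟨⟨u, hu⟩, ⟨v, hv⟩⟩
    exact ⟨intPoint d u v, by rw [natCast_mul_intPoint, hu, hv]⟩

theorem exists_norm_add_eq_iff {d : ℕ} (hd : Squarefree d) (D : ℤ) (n : ℕ) (x y : ℤ) :
    (∃ γ : 𝓞 (imagQuadField d), intToComplex (intPoint d x y) *
        (starRingEnd ℂ) (intToComplex (intPoint d x y)) + (D : ℂ) = (n : ℂ) * intToComplex γ) ↔
      (n : ℤ) ∣ binForm (genTrace d) (genNorm d) x y + D := by
  have h1 : intToComplex (intPoint d x y) * (starRingEnd ℂ) (intToComplex (intPoint d x y)) + (D : ℂ) =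
      latticePoint d (binForm (genTrace d) (genNorm d) x y + D) 0 := by
    rw [Complex.mul_conj, intToComplex_intPoint, normSq_latticePoint, latticePoint]
    push_cast
    ring
  have h2 : ∀ u v : ℤ, (n : ℂ) * intToComplex (intPoint d u v) = latticePoint d (n * u) (n * v) := by
    intro u v
    rw [intToComplex_intPoint, latticePoint, latticePoint]
    push_cast
    ring
  constructor
  · rintro ⟨γ, hγ⟩
    obtain ⟨u, v, rfl⟩ := exists_intPoint_eq hd γ
    rw [h1, h2] at hγ
    exact ⟨u, (latticePoint_inj (Nat.pos_of_ne_zero hd.ne_zero) hγ).1⟩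
  · rintro ⟨u, hu⟩
    exact ⟨intPoint d u 0, by rw [h1, h2, hu, mul_zero]⟩

theorem congCount_eq_card (ε c m : ℤ) (n : ℕ) :
    congCount ε c m n = ((Finset.range n ×ˢ Finset.range n).filter fun w : ℕ × ℕ =>
      (n : ℤ) ∣ binForm ε c w.1 w.2 - m).card := by
  rw [Finset.card_filter, Finset.sum_product]
  rfl

theorem repCount_eq_congCount {d : ℕ} (hd : Squarefree d) (D : ℤ) {n : ℕ} (hn : 0 < n) :
    repCount d D n = congCount (genTrace d) (genNorm d) (-D) n := by
  have hn' : (0 : ℤ) < n := by exact_mod_cast hn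
  rw [congCount_eq_card, repCount, ← Fintype.card_coe, ← Nat.card_eq_fintype_card]
  symm
  have hmem : ∀ w : ℕ × ℕ, w ∈ ((Finset.range n ×ˢ Finset.range n).filter fun w : ℕ × ℕ =>
      (n : ℤ) ∣ binForm (genTrace d) (genNorm d) w.1 w.2 - -D) ↔
      (w.1 < n ∧ w.2 < n) ∧ (n : ℤ) ∣ binForm (genTrace d) (genNorm d) w.1 w.2 + D := by
    intro w
    simp
  refine Nat.card_eq_of_bijective (fun w => ⟨Ideal.Quotient.mk _ (intPoint d w.1.1 w.1.2), ?_⟩)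
    ⟨?_, ?_⟩
  · obtain ⟨γ, hγ⟩ := (exists_norm_add_eq_iff hd D n w.1.1 w.1.2).2 ((hmem w.1).1 w.2).2
    exact ⟨_, γ, rfl, hγ⟩
  · intro w w' h
    have h1 := (mk_intPoint_eq_iff hd n).1 (Subtype.ext_iff.1 h)
    have h2 := ((hmem w.1).1 w.2).1
    have h3 := ((hmem w'.1).1 w'.2).1
    have h4 := Int.eq_zero_of_abs_lt_dvd h1.1 (by rw [abs_lt]; omega)
    have h5 := Int.eq_zero_of_abs_lt_dvd h1.2 (by rw [abs_lt]; omega)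
    exact Subtype.ext (Prod.ext (by omega) (by omega))
  · rintro ⟨_, β, γ, rfl, hγ⟩
    obtain ⟨x, y, rfl⟩ := exists_intPoint_eq hd β
    have h1 := (exists_norm_add_eq_iff hd D n x y).1 ⟨γ, hγ⟩
    have hx : ((x % n).toNat : ℤ) = x % n := Int.toNat_of_nonneg (Int.emod_nonneg _ hn'.ne')
    have hy : ((y % n).toNat : ℤ) = y % n := Int.toNat_of_nonneg (Int.emod_nonneg _ hn'.ne')
    have hx' := Int.emod_lt_of_pos x hn'
    have hy' := Int.emod_lt_of_pos y hn'
    have hxd : (n : ℤ) ∣ ((x % n).toNat : ℤ) - x := by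
      rw [hx, dvd_sub_comm]; exact Int.dvd_self_sub_emod
    have hyd : (n : ℤ) ∣ ((y % n).toNat : ℤ) - y := by
      rw [hy, dvd_sub_comm]; exact Int.dvd_self_sub_emod
    refine ⟨⟨((x % n).toNat, (y % n).toNat), (hmem _).2 ⟨⟨by omega, by omega⟩, ?_⟩⟩, ?_⟩
    · rw [← sub_neg_eq_add] at h1 ⊢
      exact (dvd_binForm_sub_iff _ _ _ hxd hyd).2 h1
    · exact Subtype.ext ((mk_intPoint_eq_iff hd n).2 ⟨hxd, hyd⟩)

end RepCount

open scoped ENNReal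

/-! ### Boundedness of H by the Euclidean algorithm -/

noncomputable section Boundedness

/-- The integral binary Hermitian forms of discriminant `-Δ`, in coordinates: `(a, x, y, c)` stands
for the form with `b` the conjugate of `x + yω`. -/
abbrev FormTuples (d Δ : ℕ) : Type :=
  {t : ℤ × ℤ × ℤ × ℤ // binForm (genTrace d) (genNorm d) t.2.1 t.2.2.1 - t.1 * t.2.2.2 = Δ}

/-- The value at `z` of the form with coordinates `(a, x, y, c)`. -/
def formVal (d : ℕ) (a x y c : ℤ) (z : ℂ) : ℝ :=
  a * Complex.normSq z + 2 * ((starRingEnd ℂ) (latticePoint d x y) * z).re + c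

/-- The contribution of a form to `H_{k,Δ}(z)`, as an extended nonnegative real. -/
def formTerm (d k Δ : ℕ) (z : ℂ) (t : FormTuples d Δ) : ℝ≥0∞ :=
  if t.1.1 < 0 then
    ENNReal.ofReal (max 0 (formVal d t.1.1 t.1.2.1 t.1.2.2.1 t.1.2.2.2 z ^ k))
  else 0

/-- The function `H_{k,Δ}` with extended nonnegative real values. -/
def formSum (d k Δ : ℕ) (z : ℂ) : ℝ≥0∞ := ∑' t, formTerm d k Δ z t

theorem continuous_formVal (d : ℕ) (a x y c : ℤ) : Continuous (formVal d a x y c) := by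
  unfold formVal
  have := Complex.continuous_normSq
  fun_prop

theorem continuous_formTerm (d k Δ : ℕ) (t : FormTuples d Δ) :
    Continuous fun z => formTerm d k Δ z t := by
  unfold formTerm
  split_ifs
  · exact ENNReal.continuous_ofReal.comp
      (continuous_const.max ((continuous_formVal d _ _ _ _).pow k))
  · exact continuous_const

theorem re_conj_latticePoint_mul (d : ℕ) (x y p q : ℤ) :
    2 * ((starRingEnd ℂ) (latticePoint d x y) * latticePoint d p q).re =
      (2 * x * p + genTrace d * (x * q + y * p) + 2 * genNorm d * y * q : ℤ) := by
  have h1 := quadGen_re d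
  have h2 := quadGen_im_sq d
  have h3 : (genTrace d : ℝ) ^ 2 = genTrace d := by exact_mod_cast genTrace_sq d
  simp only [latticePoint, map_add, map_mul, map_intCast, Complex.mul_re, Complex.add_re,
    Complex.intCast_re, Complex.conj_re, Complex.conj_im, Complex.intCast_im, Complex.add_im,
    Complex.mul_im, h1]
  push_cast
  linear_combination 2 * (y : ℝ) * q * h2

theorem formVal_add_latticePoint (d : ℕ) (a x y c p q : ℤ) (z : ℂ) :
    formVal d a x y c (z + latticePoint d p q) =
      formVal d a (x + a * p) (y + a * q) (c + a * binForm (genTrace d) (genNorm d) p q +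
        (2 * x * p + genTrace d * (x * q + y * p) + 2 * genNorm d * y * q)) z := by
  have h1 := re_conj_latticePoint_mul d x y p q
  have h2 := normSq_latticePoint d p q
  have h3 : latticePoint d (x + a * p) (y + a * q) = latticePoint d x y + a * latticePoint d p q := by
    simp only [latticePoint]; push_cast; ring
  simp only [formVal, h3]
  push_cast at h1 h2 ⊢
  rw [← h2, ← h1]
  simp only [Complex.normSq_apply, map_add, map_mul, Complex.add_re, Complex.add_im, Complex.mul_re,
    Complex.mul_im, Complex.conj_re, Complex.conj_im, map_intCast, Complex.intCast_re,
    Complex.intCast_im]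
  ring

/-- The action of a translation on forms. -/
def translateForm (d Δ : ℕ) (p q : ℤ) (t : FormTuples d Δ) : FormTuples d Δ :=
  ⟨(t.1.1, t.1.2.1 + t.1.1 * p, t.1.2.2.1 + t.1.1 * q,
    t.1.2.2.2 + t.1.1 * binForm (genTrace d) (genNorm d) p q +
      (2 * t.1.2.1 * p + genTrace d * (t.1.2.1 * q + t.1.2.2.1 * p) +
        2 * genNorm d * t.1.2.2.1 * q)), by
    have := t.2
    simp only [binForm] at this ⊢
    linear_combination this⟩

theorem translateForm_neg (d Δ : ℕ) (p q : ℤ) (t : FormTuples d Δ) :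
    translateForm d Δ (-p) (-q) (translateForm d Δ p q t) = t := by
  apply Subtype.ext
  simp only [translateForm, binForm]
  refine Prod.ext rfl (Prod.ext ?_ (Prod.ext ?_ ?_)) <;> dsimp only <;> ring

/-- Substituting z + λ permutes the forms of discriminant -Δ and keeps the first coefficient. -/
theorem formSum_add_latticePoint (d k Δ : ℕ) (p q : ℤ) (z : ℂ) :
    formSum d k Δ (z + latticePoint d p q) = formSum d k Δ z := by
  let e : FormTuples d Δ ≃ FormTuples d Δ :=
    ⟨translateForm d Δ p q, translateForm d Δ (-p) (-q), translateForm_neg d Δ p q, fun t => by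
      have := translateForm_neg d Δ (-p) (-q) t
      rwa [neg_neg, neg_neg] at this⟩
  unfold formSum
  refine (tsum_congr fun t => ?_).trans (e.tsum_eq (formTerm d k Δ z))
  simp only [formTerm, formVal_add_latticePoint]
  rfl

/-- Swapping the outer coefficients of a form. -/
def swapForm (d Δ : ℕ) : FormTuples d Δ ≃ FormTuples d Δ where
  toFun t := ⟨(t.1.2.2.2, t.1.2.1, t.1.2.2.1, t.1.1), by have := t.2; linear_combination this⟩
  invFun t := ⟨(t.1.2.2.2, t.1.2.1, t.1.2.2.1, t.1.1), by have := t.2; linear_combination this⟩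
  left_inv _ := rfl
  right_inv _ := rfl

theorem formVal_inv (d : ℕ) (a x y c : ℤ) {z : ℂ} (hz : z ≠ 0) :
    formVal d a x y c z = Complex.normSq z * formVal d c x y a ((starRingEnd ℂ) z)⁻¹ := by
  have h0 : Complex.normSq z ≠ 0 := (Complex.normSq_pos.2 hz).ne'
  have h1 : ((starRingEnd ℂ) z)⁻¹ = z * ((Complex.normSq z)⁻¹ : ℝ) := by
    rw [Complex.inv_def, Complex.conj_conj, Complex.normSq_conj]
  have h2 : ((starRingEnd ℂ) (latticePoint d x y) * (z * ((Complex.normSq z)⁻¹ : ℝ))).re =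
      ((starRingEnd ℂ) (latticePoint d x y) * z).re * (Complex.normSq z)⁻¹ := by
    rw [← mul_assoc, Complex.re_mul_ofReal]
  simp only [formVal]
  rw [h1, h2, Complex.normSq_mul, Complex.normSq_ofReal]
  field_simp
  ring

theorem binForm_nonneg (d : ℕ) (x y : ℤ) : 0 ≤ binForm (genTrace d) (genNorm d) x y := by
  have := Complex.normSq_nonneg (latticePoint d x y)
  rw [normSq_latticePoint] at this
  exact_mod_cast this

/-- A bound for the contribution to `H_{k,Δ}` of a form with negative value at `∞` and positive value
at `0`, on the unit disc. -/
def crossingBound (d k Δ : ℕ) (t : FormTuples d Δ) : ℝ≥0∞ :=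
  if t.1.1 < 0 ∧ 0 < t.1.2.2.2 then ENNReal.ofReal ((2 * Δ + 1) ^ k) else 0

/-- In |b|² + |a|c = Δ all terms are nonnegative and |a|, c ≥ 1. The coordinates of b are bounded
through 4Q = (2x + εy)² + |D|y² with |D| ≥ 1. -/
theorem finite_crossing {d : ℕ} (hd : 0 < d) (Δ : ℕ) :
    {t : FormTuples d Δ | t.1.1 < 0 ∧ 0 < t.1.2.2.2}.Finite := by
  have hfin : (Set.Icc (-(4 * Δ : ℤ)) (4 * Δ) ×ˢ (Set.Icc (-(4 * Δ : ℤ)) (4 * Δ) ×ˢ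
      (Set.Icc (-(4 * Δ : ℤ)) (4 * Δ) ×ˢ Set.Icc (-(4 * Δ : ℤ)) (4 * Δ)))).Finite :=
    (Set.finite_Icc _ _).prod ((Set.finite_Icc _ _).prod ((Set.finite_Icc _ _).prod
      (Set.finite_Icc _ _)))
  refine (hfin.preimage Subtype.val_injective.injOn).subset ?_
  rintro ⟨⟨a, x, y, c⟩, ht⟩ ⟨ha, hc⟩
  simp only at ht ha hc
  have h1 := binForm_nonneg d x y
  have hQ : binForm (genTrace d) (genNorm d) x y ≤ Δ := by nlinarith
  have hac : -a * c ≤ Δ := by nlinarith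
  have ha' : -a ≤ Δ := by nlinarith
  have hc' : c ≤ Δ := by nlinarith
  have hD : 1 ≤ 4 * genNorm d - genTrace d ^ 2 := by
    have h2 := quadGen_im_sq d
    have h3 := pow_pos (quadGen_im_pos hd) 2
    rw [h2] at h3
    have h4 : (0 : ℝ) < 4 * genNorm d - genTrace d ^ 2 := by linarith
    have : 0 < 4 * genNorm d - genTrace d ^ 2 := by exact_mod_cast h4
    omega
  have h4 : 4 * binForm (genTrace d) (genNorm d) x y =
      (2 * x + genTrace d * y) ^ 2 + (4 * genNorm d - genTrace d ^ 2) * y ^ 2 := by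
    simp only [binForm]; ring
  have hy : y ^ 2 ≤ 4 * Δ := by nlinarith [sq_nonneg (2 * x + genTrace d * y), sq_nonneg y]
  have hx : (2 * x + genTrace d * y) ^ 2 ≤ 4 * Δ := by nlinarith [sq_nonneg y]
  have hle : ∀ u : ℤ, u ^ 2 ≤ 4 * Δ → -(4 * Δ : ℤ) ≤ u ∧ u ≤ 4 * Δ := fun u hu => by
    constructor <;> nlinarith
  have hy' := hle y hy
  have hx' := hle _ hx
  have hx'' : -(4 * Δ : ℤ) ≤ x ∧ x ≤ 4 * Δ := by
    unfold genTrace at hx'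
    split_ifs at hx' <;> omega
  simp only [Set.mem_preimage, Set.mem_prod, Set.mem_Icc]
  omega

theorem tsum_crossingBound_ne_top {d : ℕ} (hd : 0 < d) (k Δ : ℕ) :
    ∑' t, crossingBound d k Δ t ≠ ∞ := by
  rw [tsum_eq_sum (s := (finite_crossing hd Δ).toFinset)]
  · refine ENNReal.sum_ne_top.2 fun t _ => ?_
    unfold crossingBound
    split_ifs
    · exact ENNReal.ofReal_ne_top
    · exact ENNReal.zero_ne_top
  · intro t ht
    exact if_neg fun h => ht ((finite_crossing hd Δ).mem_toFinset.2 h)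

/-- Compare term by term with the form having a and c exchanged: c < 0 gives equality by
`formVal_inv` (for z ≠ 0), c = 0 would make Δ a norm, and c > 0 is covered by the crossing bound. -/
theorem formSum_le_inv {d k Δ : ℕ} (hk : Odd k)
    (hnorm : ∀ x y : ℤ, binForm (genTrace d) (genNorm d) x y ≠ Δ) {z : ℂ}
    (hz : Complex.normSq z ≤ 1) :
    formSum d k Δ z ≤ ∑' t, crossingBound d k Δ t +
      ENNReal.ofReal (Complex.normSq z ^ k) * formSum d k Δ ((starRingEnd ℂ) z)⁻¹ := by
  unfold formSum
  rw [← (swapForm d Δ).tsum_eq (formTerm d k Δ ((starRingEnd ℂ) z)⁻¹), ← ENNReal.tsum_mul_left,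
    ← ENNReal.tsum_add]
  refine ENNReal.tsum_le_tsum ?_
  rintro ⟨⟨a, x, y, c⟩, ht⟩
  change (if a < 0 then ENNReal.ofReal (max 0 (formVal d a x y c z ^ k)) else 0) ≤
    (if a < 0 ∧ 0 < c then ENNReal.ofReal ((2 * Δ + 1) ^ k) else 0) +
      ENNReal.ofReal (Complex.normSq z ^ k) * if c < 0 then
        ENNReal.ofReal (max 0 (formVal d c x y a ((starRingEnd ℂ) z)⁻¹ ^ k)) else 0
  simp only at ht
  by_cases ha : a < 0
  swap
  · simp [ha]
  rw [if_pos ha]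
  rcases lt_trichotomy c 0 with hc | hc | hc
  · rw [if_pos hc, if_neg (by omega), zero_add,
      ← ENNReal.ofReal_mul (pow_nonneg (Complex.normSq_nonneg _) _)]
    refine ENNReal.ofReal_le_ofReal ?_
    -- At z = 0, where the inverse is 0 by convention, the value is c < 0 and the term vanishes.
    rcases eq_or_ne z 0 with rfl | hz0
    · have : formVal d a x y c 0 = c := by simp [formVal]
      rw [this]
      refine le_of_eq_of_le (max_eq_left (hk.pow_nonpos ?_)) ?_
      · exact_mod_cast hc.le
      · simp [hk.pos.ne']
    · rw [formVal_inv d a x y c hz0, mul_pow,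
        mul_max_of_nonneg _ _ (pow_nonneg (Complex.normSq_nonneg _) _), mul_zero]
  · subst hc
    exact absurd (by simpa using ht) (hnorm x y)
  · rw [if_pos ⟨ha, hc⟩]
    refine le_trans (ENNReal.ofReal_le_ofReal ?_) le_self_add
    have hpos : (0 : ℝ) ≤ 2 * Δ + 1 := by positivity
    refine max_le (pow_nonneg hpos k) ?_
    -- The bound collects a|z|² ≤ 0, 2 Re(bz) ≤ |b|² + |z|² ≤ Δ + 1 and c ≤ Δ.
    have hval : formVal d a x y c z ≤ 2 * Δ + 1 := by
      have h1 := normSq_latticePoint d x y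
      have h2 := binForm_nonneg d x y
      have hQ : (binForm (genTrace d) (genNorm d) x y : ℝ) ≤ Δ := by
        exact_mod_cast (by nlinarith : binForm (genTrace d) (genNorm d) x y ≤ Δ)
      have hcΔ : (c : ℝ) ≤ Δ := by exact_mod_cast (by nlinarith : c ≤ Δ)
      have hre : 2 * ((starRingEnd ℂ) (latticePoint d x y) * z).re ≤
          Complex.normSq (latticePoint d x y) + Complex.normSq z := by
        have := Complex.normSq_nonneg (latticePoint d x y - z)
        simp only [Complex.normSq_apply, Complex.mul_re, Complex.conj_re, Complex.conj_im,
          Complex.sub_re, Complex.sub_im] at this ⊢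
        nlinarith
      have haz : (a : ℝ) * Complex.normSq z ≤ 0 :=
        mul_nonpos_of_nonpos_of_nonneg (by exact_mod_cast ha.le) (Complex.normSq_nonneg _)
      unfold formVal
      rw [h1] at hre
      linarith
    rcases le_or_gt 0 (formVal d a x y c z) with h | h
    · exact pow_le_pow_left₀ h hval k
    · exact (hk.pow_nonpos h.le).trans (pow_nonneg hpos k)

/-- Round the coordinate along ω first, then the real part. The squared errors are at most |D|/16 ≤
11/16 and 1/4. -/
theorem exists_normSq_sub_latticePoint_le {d : ℕ} (hd : 0 < d)
    (h11 : 4 * genNorm d - genTrace d ^ 2 ≤ 11) (z : ℂ) :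
    ∃ x y : ℤ, Complex.normSq (z - latticePoint d x y) ≤ 15 / 16 := by
  have him := quadGen_im_pos hd
  have him2 := quadGen_im_sq d
  have h11' : (4 * genNorm d - genTrace d ^ 2 : ℝ) ≤ 11 := by exact_mod_cast h11
  set y := round (z.im / (quadGen d).im) with hy
  set x := round (z.re - y * (quadGen d).re) with hx
  refine ⟨x, y, ?_⟩
  have h1 := abs_sub_round (z.im / (quadGen d).im)
  have h2 := abs_sub_round (z.re - y * (quadGen d).re)
  rw [← hy] at h1
  rw [← hx] at h2
  have h3 : z.im - y * (quadGen d).im = (z.im / (quadGen d).im - y) * (quadGen d).im := by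
    field_simp
  have h4 : (z.im - y * (quadGen d).im) ^ 2 ≤ 11 / 16 := by
    rw [h3, mul_pow, him2]
    have : (z.im / (quadGen d).im - y) ^ 2 ≤ (1 / 2) ^ 2 := sq_le_sq' (abs_le.1 h1).1 (abs_le.1 h1).2
    have h0 := sq_nonneg (z.im / (quadGen d).im - y)
    have h5 : 0 ≤ (4 * genNorm d - genTrace d ^ 2 : ℝ) / 4 := by rw [← him2]; positivity
    calc _ ≤ (1 / 2) ^ 2 * ((4 * genNorm d - genTrace d ^ 2 : ℝ) / 4) := by gcongr
      _ ≤ _ := by linarith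
  have h5 : (z.re - y * (quadGen d).re - x) ^ 2 ≤ (1 / 2) ^ 2 :=
    sq_le_sq' (abs_le.1 h2).1 (abs_le.1 h2).2
  simp only [latticePoint, Complex.normSq_apply, Complex.sub_re, Complex.add_re, Complex.intCast_re,
    Complex.mul_re, Complex.intCast_im, zero_mul, sub_zero, Complex.sub_im, Complex.add_im,
    zero_add, Complex.mul_im, add_zero]
  nlinarith

theorem latticePoint_mul (d : ℕ) (x y x' y' : ℤ) :
    latticePoint d x y * latticePoint d x' y' = latticePoint d (x * x' - genNorm d * y * y')
      (x * y' + x' * y + genTrace d * y * y') := by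
  have := quadGen_sq d
  simp only [latticePoint]
  push_cast
  linear_combination (y : ℂ) * y' * this

theorem latticePoint_sub (d : ℕ) (x y x' y' : ℤ) :
    latticePoint d x y - latticePoint d x' y' = latticePoint d (x - x') (y - y') := by
  simp only [latticePoint]
  push_cast
  ring

theorem conj_latticePoint (d : ℕ) (x y : ℤ) :
    (starRingEnd ℂ) (latticePoint d x y) = latticePoint d (x + genTrace d * y) (-y) := by
  have h : (starRingEnd ℂ) (quadGen d) = genTrace d - quadGen d := by
    apply Complex.ext
    · simp [quadGen_re]
      ring
    · simp
  simp only [latticePoint, map_add, map_mul, map_intCast, h]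
  push_cast
  ring

/-- Divide with remainder ρ = α - λβ, so N(ρ) ≤ (15/16)N(β). By periodicity only ρ/β matters, and
inversion leads to β̄/ρ̄, whose denominator has smaller norm. The constant 16 is the fixed point of
x ↦ 1 + (15/16)x. Values in [0, ∞] make any prior convergence unnecessary. -/
theorem formSum_div_le {d k Δ : ℕ} (hd : 0 < d) (h11 : 4 * genNorm d - genTrace d ^ 2 ≤ 11)
    (hk : Odd k) (hnorm : ∀ x y : ℤ, binForm (genTrace d) (genNorm d) x y ≠ Δ) (N : ℕ) :
    ∀ x y x' y' : ℤ, latticePoint d x' y' ≠ 0 → binForm (genTrace d) (genNorm d) x' y' ≤ N →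
      formSum d k Δ (latticePoint d x y / latticePoint d x' y') ≤
        16 * ∑' t, crossingBound d k Δ t := by
  induction N with
  | zero =>
    intro x y x' y' h0 hN
    have := Complex.normSq_pos.2 h0
    rw [normSq_latticePoint] at this
    have : 0 < binForm (genTrace d) (genNorm d) x' y' := by exact_mod_cast this
    push_cast at hN
    omega
  | succ N ih =>
    intro x y x' y' h0 hN
    set α := latticePoint d x y with hα
    set β := latticePoint d x' y' with hβ
    set C := ∑' t, crossingBound d k Δ t with hC
    obtain ⟨p, q, hpq⟩ := exists_normSq_sub_latticePoint_le hd h11 (α / β)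
    obtain ⟨u, v, huv⟩ : ∃ u v : ℤ, α - latticePoint d p q * β = latticePoint d u v := by
      rw [hα, hβ, latticePoint_mul, latticePoint_sub]
      exact ⟨_, _, rfl⟩
    have hz : α / β = latticePoint d u v / β + latticePoint d p q := by
      rw [← huv]
      field_simp
      ring
    rw [hz, add_sub_cancel_right] at hpq
    rw [hz, formSum_add_latticePoint]
    refine (formSum_le_inv hk hnorm (hpq.trans (by norm_num))).trans ?_
    have hpow : Complex.normSq (latticePoint d u v / β) ^ k ≤ 15 / 16 :=
      (pow_le_of_le_one (Complex.normSq_nonneg _) (hpq.trans (by norm_num)) hk.pos.ne').trans hpq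
    -- A zero remainder ends the algorithm: the factor |z|^{2k} is then 0.
    rcases eq_or_ne (latticePoint d u v) 0 with h | h
    · rw [h]
      simp only [zero_div, map_zero, zero_pow hk.pos.ne', ENNReal.ofReal_zero, zero_mul, add_zero]
      exact le_mul_of_one_le_left zero_le (by norm_num)
    have hle : formSum d k Δ ((starRingEnd ℂ) (latticePoint d u v / β))⁻¹ ≤ 16 * C := by
      rw [map_div₀, inv_div, hβ, conj_latticePoint, conj_latticePoint]
      refine ih _ _ _ _ ?_ ?_
      · rw [← conj_latticePoint]
        simpa using h
      · have h1 : Complex.normSq (latticePoint d u v) ≤ 15 / 16 * Complex.normSq β := by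
          rwa [Complex.normSq_div, div_le_iff₀ (Complex.normSq_pos.2 h0)] at hpq
        have h2 : Complex.normSq (latticePoint d u v) < Complex.normSq β := by
          have := Complex.normSq_pos.2 h0
          linarith
        rw [hβ, ← Complex.normSq_conj, conj_latticePoint, normSq_latticePoint,
          normSq_latticePoint] at h2
        have h3 : binForm (genTrace d) (genNorm d) (u + genTrace d * v) (-v) <
            binForm (genTrace d) (genNorm d) x' y' := by exact_mod_cast h2
        push_cast at hN
        omega
    calc C + ENNReal.ofReal (Complex.normSq (latticePoint d u v / β) ^ k) *
          formSum d k Δ ((starRingEnd ℂ) (latticePoint d u v / β))⁻¹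
        ≤ C + ENNReal.ofReal (15 / 16) * (16 * C) := by gcongr
      _ = 16 * C := by
        have h16 : ENNReal.ofReal (15 / 16) * 16 = 15 := by
          rw [show (16 : ℝ≥0∞) = ENNReal.ofReal 16 by simp, ← ENNReal.ofReal_mul (by norm_num)]
          norm_num
        rw [← mul_assoc, h16]
        ring

theorem denseRange_latticePoint_div {d : ℕ} (hd : 0 < d) :
    DenseRange fun w : ℚ × ℚ => (w.1 : ℂ) + w.2 * quadGen d := by
  let f : ℝ × ℝ → ℂ := fun w => (w.1 : ℂ) + w.2 * quadGen d
  have hf : Continuous f := by fun_prop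
  have him := (quadGen_im_pos hd).ne'
  have hsurj : Function.Surjective f := by
    intro z
    refine ⟨(z.re - z.im / (quadGen d).im * (quadGen d).re, z.im / (quadGen d).im), ?_⟩
    apply Complex.ext
    · simp [f]
    · simp [f, him]
  have := hsurj.denseRange.comp (Rat.denseRange_cast (𝕜 := ℝ) |>.prodMap
    (Rat.denseRange_cast (𝕜 := ℝ))) hf
  convert this using 1
  ext w
  simp [f]

/-- The sum is a supremum of finite partial sums. Each of these is continuous, so its bound passes
from the dense set K to ℂ. -/
theorem formSum_le {d k Δ : ℕ} (hd : 0 < d) (h11 : 4 * genNorm d - genTrace d ^ 2 ≤ 11)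
    (hk : Odd k) (hnorm : ∀ x y : ℤ, binForm (genTrace d) (genNorm d) x y ≠ Δ) (z : ℂ) :
    formSum d k Δ z ≤ 16 * ∑' t, crossingBound d k Δ t := by
  rw [formSum, ENNReal.tsum_eq_iSup_sum]
  refine iSup_le fun s => ?_
  refine (denseRange_latticePoint_div hd).induction_on (p := fun z =>
    ∑ t ∈ s, formTerm d k Δ z t ≤ 16 * ∑' t, crossingBound d k Δ t) z ?_ ?_
  · exact isClosed_le (continuous_finsetSum _ fun t _ => continuous_formTerm d k Δ t)
      continuous_const
  · rintro ⟨u, v⟩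
    refine (ENNReal.sum_le_tsum s).trans ?_
    have hu : (u.den : ℂ) ≠ 0 := by exact_mod_cast u.den_ne_zero
    have hv : (v.den : ℂ) ≠ 0 := by exact_mod_cast v.den_ne_zero
    have h : (u : ℂ) + v * quadGen d =
        latticePoint d (u.num * v.den) (v.num * u.den) / latticePoint d (u.den * v.den) 0 := by
      rw [Rat.cast_def u, Rat.cast_def v]
      simp only [latticePoint]
      push_cast
      field_simp
      ring
    rw [h]
    refine formSum_div_le hd h11 hk hnorm (binForm (genTrace d) (genNorm d) _ _).toNat _ _ _ _ ?_
      (Int.self_le_toNat _)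
    simp only [latticePoint]
    push_cast
    simp

end Boundedness

/-! ### Forms with a < 0 as radial bumps, and their integrals -/

noncomputable section Reindexing

/-- The triples `(n, x, y)` parametrizing the forms with first coefficient `-(n + 1)` and
discriminant `-Δ`. -/
def FormIndex (d Δ : ℕ) : Set (ℕ × ℤ × ℤ) :=
  {q | ((q.1 + 1 : ℕ) : ℤ) ∣ binForm (genTrace d) (genNorm d) q.2.1 q.2.2 - Δ}

/-- The value `max(0, h(z)^k)` as a function of the distance of `z` to the centre `x + yω` over
`n + 1` of the disc on which the form is positive. -/
def discBump (k Δ n : ℕ) (z : ℂ) : ℝ :=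
  max 0 ((Δ / (n + 1) - (n + 1) * ‖z‖ ^ 2) ^ k)

theorem continuous_discBump (k Δ n : ℕ) : Continuous (discBump k Δ n) := by
  unfold discBump
  fun_prop

theorem discBump_nonneg (k Δ n : ℕ) (z : ℂ) : 0 ≤ discBump k Δ n z := le_max_left _ _

/-- The form with given index. -/
def indexForm (d Δ : ℕ) (q : FormIndex d Δ) : BinHermForm d where
  a := -(q.1.1 + 1 : ℕ)
  b := intPoint d (q.1.2.1 + genTrace d * q.1.2.2) (-q.1.2.2)
  c := (Δ - binForm (genTrace d) (genNorm d) q.1.2.1 q.1.2.2) / (q.1.1 + 1 : ℕ)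

theorem indexForm_c (d Δ : ℕ) (q : FormIndex d Δ) :
    (q.1.1 + 1 : ℕ) * (indexForm d Δ q).c =
      Δ - binForm (genTrace d) (genNorm d) q.1.2.1 q.1.2.2 :=
  Int.mul_ediv_cancel' (dvd_sub_comm.1 q.2)

theorem binForm_conj (d : ℕ) (x y : ℤ) :
    binForm (genTrace d) (genNorm d) (x + genTrace d * y) (-y) =
      binForm (genTrace d) (genNorm d) x y := by
  simp only [binForm]
  ring

theorem indexForm_mem (d Δ : ℕ) (q : FormIndex d Δ) : indexForm d Δ q ∈ negForms d Δ := by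
  constructor
  · rw [BinHermForm.disc]
    have h := indexForm_c d Δ q
    have h1 : Complex.normSq (intToComplex (indexForm d Δ q).b) =
        binForm (genTrace d) (genNorm d) q.1.2.1 q.1.2.2 := by
      rw [indexForm, intToComplex_intPoint, normSq_latticePoint, binForm_conj]
    rw [h1]
    have h2 : (indexForm d Δ q).a = -(q.1.1 + 1 : ℕ) := rfl
    rw [h2]
    have h3 : ((q.1.1 + 1 : ℕ) : ℝ) * ((indexForm d Δ q).c : ℝ) =
        Δ - binForm (genTrace d) (genNorm d) q.1.2.1 q.1.2.2 := by exact_mod_cast h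
    push_cast at h3 ⊢
    linarith
  · have h2 : (indexForm d Δ q).a = -(q.1.1 + 1 : ℕ) := rfl
    rw [h2]
    omega

theorem indexForm_bijective {d : ℕ} (hd : Squarefree d) (Δ : ℕ) :
    Function.Bijective fun q : FormIndex d Δ =>
      (⟨indexForm d Δ q, indexForm_mem d Δ q⟩ : negForms d Δ) := by
  constructor
  · intro q q' h
    have h0 : indexForm d Δ q = indexForm d Δ q' := congrArg Subtype.val h
    have ha : (-(q.1.1 + 1 : ℕ) : ℤ) = -(q'.1.1 + 1 : ℕ) := congrArg BinHermForm.a h0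
    have hb : intPoint d (q.1.2.1 + genTrace d * q.1.2.2) (-q.1.2.2) =
      intPoint d (q'.1.2.1 + genTrace d * q'.1.2.2) (-q'.1.2.2) := congrArg BinHermForm.b h0
    rw [intPoint_inj hd] at hb
    have hy : q.1.2.2 = q'.1.2.2 := by linarith [hb.2]
    have hx : q.1.2.1 = q'.1.2.1 := by
      have := hb.1
      rw [hy] at this
      linarith
    exact Subtype.ext (Prod.ext (by omega) (Prod.ext hx hy))
  · rintro ⟨⟨a, b, c⟩, hdisc, ha⟩
    obtain ⟨u, v, rfl⟩ := exists_intPoint_eq hd b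
    simp only at ha
    have h1 : a * c - binForm (genTrace d) (genNorm d) u v = -Δ := by
      rw [BinHermForm.disc, intToComplex_intPoint, normSq_latticePoint] at hdisc
      exact_mod_cast hdisc
    have h2 : binForm (genTrace d) (genNorm d) (u + genTrace d * v) (-v) =
      binForm (genTrace d) (genNorm d) u v := binForm_conj d u v
    obtain ⟨n, rfl⟩ : ∃ n : ℕ, a = -(n + 1 : ℕ) := ⟨(-a - 1).toNat, by omega⟩
    refine ⟨⟨(n, u + genTrace d * v, -v), ⟨-c, ?_⟩⟩, ?_⟩
    · dsimp only
      rw [h2]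
      linarith
    · apply Subtype.ext
      simp only [indexForm, h2]
      congr 1
      · ring_nf
      · refine Int.ediv_eq_of_eq_mul_right (by omega) ?_
        linarith

/-- The parametrization of the forms with negative first coefficient. -/
def formIndexEquiv {d : ℕ} (hd : Squarefree d) (Δ : ℕ) : FormIndex d Δ ≃ negForms d Δ :=
  Equiv.ofBijective _ (indexForm_bijective hd Δ)

theorem eval_indexForm (d Δ : ℕ) (q : FormIndex d Δ) (z : ℂ) :
    (indexForm d Δ q).eval z = formVal d (-(q.1.1 + 1 : ℕ)) q.1.2.1 q.1.2.2 (indexForm d Δ q).c z := by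
  rw [BinHermForm.eval, formVal, conj_latticePoint, ← intToComplex_intPoint]
  rfl

/-- Complete the square in z and eliminate c by the discriminant equation. -/
theorem eval_indexForm_eq (d Δ : ℕ) (q : FormIndex d Δ) (z : ℂ) :
    (indexForm d Δ q).eval z = Δ / (q.1.1 + 1) -
      (q.1.1 + 1) * ‖z - latticePoint d q.1.2.1 q.1.2.2 / (q.1.1 + 1)‖ ^ 2 := by
  have h := indexForm_c d Δ q
  have h3 : ((q.1.1 + 1 : ℕ) : ℝ) * ((indexForm d Δ q).c : ℝ) =
      Δ - Complex.normSq (latticePoint d q.1.2.1 q.1.2.2) := by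
    rw [normSq_latticePoint]; exact_mod_cast h
  have hn : ((q.1.1 : ℝ) + 1) ≠ 0 := by positivity
  rw [eval_indexForm, formVal, ← Complex.normSq_eq_norm_sq]
  have h4 : latticePoint d q.1.2.1 q.1.2.2 / (q.1.1 + 1) =
      latticePoint d q.1.2.1 q.1.2.2 * (((q.1.1 : ℝ) + 1)⁻¹ : ℝ) := by
    push_cast; rw [div_eq_mul_inv]
  have h5 : ((indexForm d Δ q).c : ℝ) =
      (Δ - Complex.normSq (latticePoint d q.1.2.1 q.1.2.2)) / (q.1.1 + 1) := by
    rw [eq_div_iff hn, ← h3]; push_cast; ring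
  rw [h4, h5]
  simp only [Complex.normSq_apply, Complex.sub_re, Complex.sub_im, Complex.re_mul_ofReal,
    Complex.im_mul_ofReal]
  simp only [Complex.mul_re, Complex.conj_re, Complex.conj_im]
  push_cast
  field_simp
  ring

/-- The function `H_{k,Δ}`, with extended nonnegative real values. -/
def hermSumE (d k Δ : ℕ) (z : ℂ) : ℝ≥0∞ :=
  ∑' h : negForms d Δ, ENNReal.ofReal (max 0 (h.1.eval z ^ k))

theorem hermSumE_eq_tsum_index {d : ℕ} (hd : Squarefree d) (k Δ : ℕ) (z : ℂ) :
    hermSumE d k Δ z = ∑' q : FormIndex d Δ, ENNReal.ofReal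
      (discBump k Δ q.1.1 (z - latticePoint d q.1.2.1 q.1.2.2 / (q.1.1 + 1))) := by
  rw [hermSumE, ← (formIndexEquiv hd Δ).tsum_eq]
  refine tsum_congr fun q => ?_
  rw [discBump, ← eval_indexForm_eq]
  rfl

theorem hermSumE_le_formSum {d : ℕ} (hd : Squarefree d) (k Δ : ℕ) (z : ℂ) :
    hermSumE d k Δ z ≤ formSum d k Δ z := by
  rw [hermSumE, ← (formIndexEquiv hd Δ).tsum_eq]
  let g : FormIndex d Δ → FormTuples d Δ := fun q =>
    ⟨(-(q.1.1 + 1 : ℕ), q.1.2.1, q.1.2.2, (indexForm d Δ q).c), by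
      have := indexForm_c d Δ q
      simp only
      linear_combination this⟩
  have hg : Function.Injective g := by
    intro q q' h
    have h0 : (g q).1 = (g q').1 := congrArg Subtype.val h
    have ha : (-(q.1.1 + 1 : ℕ) : ℤ) = -(q'.1.1 + 1 : ℕ) := congrArg Prod.fst h0
    have hx : q.1.2.1 = q'.1.2.1 := congrArg (fun t => t.2.1) h0
    have hy : q.1.2.2 = q'.1.2.2 := congrArg (fun t => t.2.2.1) h0
    exact Subtype.ext (Prod.ext (by omega) (Prod.ext hx hy))
  refine le_trans (ENNReal.tsum_le_tsum fun q => ?_)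
    (ENNReal.tsum_comp_le_tsum_of_injective hg (formTerm d k Δ z))
  rw [formTerm, if_pos (by simp only [g]; omega)]
  exact (congrArg (fun u : ℝ => ENNReal.ofReal (max 0 (u ^ k))) (eval_indexForm d Δ q z)).le

/-- Outside the disc the base is nonpositive, and so is its odd power. -/
theorem discBump_eq_zero {k Δ n : ℕ} (hk : Odd k) {z : ℂ} (hz : Real.sqrt Δ / (n + 1) ≤ ‖z‖) :
    discBump k Δ n z = 0 := by
  refine max_eq_left (hk.pow_nonpos ?_)
  have hn : (0 : ℝ) < n + 1 := by positivity
  have h1 : (Real.sqrt Δ / (n + 1)) ^ 2 ≤ ‖z‖ ^ 2 := by gcongr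
  rw [div_pow, Real.sq_sqrt (Nat.cast_nonneg Δ), div_le_iff₀ (by positivity)] at h1
  rw [sub_nonpos, div_le_iff₀ hn]
  linarith

theorem integrable_discBump {k Δ n : ℕ} (hk : Odd k) : Integrable (discBump k Δ n) := by
  refine (continuous_discBump k Δ n).integrable_of_hasCompactSupport ?_
  refine HasCompactSupport.intro (isCompact_closedBall (0 : ℂ) (Real.sqrt Δ / (n + 1))) ?_
  intro z hz
  refine discBump_eq_zero hk ?_
  rw [Metric.mem_closedBall, dist_zero_right, not_le] at hz
  exact hz.le

/-- In polar coordinates the integral is 2π∫ r(Δ/m - mr²)^k dr over 0 ≤ r ≤ √Δ/m with m = n + 1. The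
integrand is an exact derivative whose primitive vanishes at the upper end. -/
theorem integral_discBump {k Δ n : ℕ} (hk : Odd k) :
    ∫ z, discBump k Δ n z = Real.pi * Δ ^ (k + 1) / ((k + 1) * (n + 1) ^ (k + 2)) := by
  have hn : (0 : ℝ) < n + 1 := by positivity
  have hR : 0 ≤ Real.sqrt Δ / (n + 1) := by positivity
  have hR2 : (Real.sqrt Δ / (n + 1)) ^ 2 = Δ / (n + 1) ^ 2 := by
    rw [div_pow, Real.sq_sqrt (Nat.cast_nonneg Δ)]
  have h1 := integral_fun_norm_addHaar (volume : Measure ℂ)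
    (fun r : ℝ => max 0 (((Δ : ℝ) / (n + 1) - (n + 1) * r ^ 2) ^ k))
  have hball : (volume : Measure ℂ).real (Metric.ball 0 1) = Real.pi := by
    rw [Measure.real, Complex.volume_ball]
    simp
  rw [Complex.finrank_real_complex, hball] at h1
  have h2 : ∫ y in Set.Ioi (0 : ℝ), y ^ (2 - 1) •
      max 0 (((Δ : ℝ) / (n + 1) - (n + 1) * y ^ 2) ^ k) =
      ∫ y in (0 : ℝ)..(Real.sqrt Δ / (n + 1)), y * ((Δ : ℝ) / (n + 1) - (n + 1) * y ^ 2) ^ k := by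
    rw [intervalIntegral.integral_of_le hR]
    rw [setIntegral_eq_of_subset_of_forall_sdiff_eq_zero measurableSet_Ioi
      (Set.Ioc_subset_Ioi_self : Set.Ioc 0 (Real.sqrt Δ / (n + 1)) ⊆ Set.Ioi 0)]
    · refine setIntegral_congr_fun measurableSet_Ioc fun y hy => ?_
      have hy2 : y ^ 2 ≤ Δ / (n + 1) ^ 2 := by
        rw [← hR2]
        exact pow_le_pow_left₀ hy.1.le hy.2 2
      have : 0 ≤ (Δ : ℝ) / (n + 1) - (n + 1) * y ^ 2 := by
        rw [le_div_iff₀ (by positivity)] at hy2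
        rw [sub_nonneg, le_div_iff₀ hn]
        linarith
      simp only [pow_one, smul_eq_mul, Nat.add_one_sub_one]
      rw [max_eq_right (pow_nonneg this k)]
    · intro y hy
      have hy1 : Real.sqrt Δ / (n + 1) ≤ y := by
        have := hy.2
        simp only [Set.mem_Ioc, not_and, not_le] at this
        exact (this hy.1).le
      have := discBump_eq_zero (n := n) hk (z := (y : ℂ)) (Δ := Δ) (by
        rw [Complex.norm_real, Real.norm_of_nonneg (hR.trans hy1)]; exact hy1)
      rw [discBump, Complex.norm_real, Real.norm_of_nonneg (hR.trans hy1)] at this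
      rw [this, smul_zero]
  have h3 : ∫ y in (0 : ℝ)..(Real.sqrt Δ / (n + 1)),
      y * ((Δ : ℝ) / (n + 1) - (n + 1) * y ^ 2) ^ k =
      ((Δ : ℝ) / (n + 1)) ^ (k + 1) / (2 * (n + 1) * (k + 1)) := by
    have hk1 : ((k : ℝ) + 1) ≠ 0 := by positivity
    have hderiv : ∀ y ∈ Set.uIcc 0 (Real.sqrt Δ / (n + 1)), HasDerivAt
        (fun y : ℝ => -((Δ : ℝ) / (n + 1) - (n + 1) * y ^ 2) ^ (k + 1) / (2 * (n + 1) * (k + 1)))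
        (y * ((Δ : ℝ) / (n + 1) - (n + 1) * y ^ 2) ^ k) y := by
      intro y _
      have h4 : HasDerivAt (fun y : ℝ => (Δ : ℝ) / (n + 1) - (n + 1) * y ^ 2)
          (-((n + 1) * (2 * y))) y := by
        have := ((hasDerivAt_pow 2 y).const_mul ((n : ℝ) + 1)).const_sub ((Δ : ℝ) / (n + 1))
        simpa using this
      have h5 := ((h4.pow (k + 1)).neg).div_const (2 * ((n : ℝ) + 1) * (k + 1))
      refine HasDerivAt.congr_deriv h5 ?_
      push_cast
      field_simp
    rw [intervalIntegral.integral_eq_sub_of_hasDerivAt hderiv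
      (Continuous.intervalIntegrable (by fun_prop) _ _), hR2]
    have h6 : (Δ : ℝ) / (n + 1) - (n + 1) * (Δ / (n + 1) ^ 2) = 0 := by field_simp; ring
    rw [h6]
    simp
    ring
  rw [h2, h3] at h1
  unfold discBump
  rw [h1, div_pow]
  simp only [nsmul_eq_mul, smul_eq_mul]
  push_cast
  field_simp
  ring

theorem lintegral_discBump {k Δ n : ℕ} (hk : Odd k) :
    ∫⁻ z, ENNReal.ofReal (discBump k Δ n z) =
      ENNReal.ofReal (Real.pi * Δ ^ (k + 1) / ((k + 1) * (n + 1) ^ (k + 2))) := by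
  rw [← integral_discBump hk, ofReal_integral_eq_lintegral_ofReal (integrable_discBump hk)
    (Filter.Eventually.of_forall fun z => discBump_nonneg k Δ n z)]

end Reindexing

/-! ### Fundamental domains and unfolding -/

noncomputable section Unfolding

/-- The lattice `ℤ + ℤω`. -/
def intLattice (d : ℕ) : Submodule ℤ ℂ :=
  LinearMap.range ((intHom d).toAddMonoidHom.toIntLinearMap)

theorem mem_intLattice {d : ℕ} (hd : Squarefree d) {z : ℂ} :
    z ∈ intLattice d ↔ ∃ x y : ℤ, latticePoint d x y = z := by
  constructor
  · rintro ⟨b, rfl⟩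
    obtain ⟨x, y, rfl⟩ := exists_intPoint_eq hd b
    exact ⟨x, y, (intToComplex_intPoint d x y).symm⟩
  · rintro ⟨x, y, rfl⟩
    exact ⟨intPoint d x y, intToComplex_intPoint d x y⟩

theorem span_range_intToComplex {d : ℕ}
    (B : Module.Basis (Fin 2) ℤ (𝓞 (imagQuadField d))) :
    Submodule.span ℤ (Set.range fun i => intToComplex (B i)) = intLattice d := by
  have : (fun i => intToComplex (B i)) = (intHom d).toAddMonoidHom.toIntLinearMap ∘ B := rfl
  rw [this, Set.range_comp, ← Submodule.map_span, B.span_eq, Submodule.map_top]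
  rfl

/-- A `ℤ`-basis of the ring of integers as a real basis of `ℂ`. -/
def realBasis {d : ℕ} (hd : Squarefree d) (B : Module.Basis (Fin 2) ℤ (𝓞 (imagQuadField d))) :
    Module.Basis (Fin 2) ℝ ℂ :=
  basisOfTopLeSpanOfCardEqFinrank (fun i => intToComplex (B i)) (by
    intro z _
    have him := (quadGen_im_pos (Nat.pos_of_ne_zero hd.ne_zero)).ne'
    have hsub : (intLattice d : Set ℂ) ⊆
        Submodule.span ℝ (Set.range fun i => intToComplex (B i)) := by
      rw [← span_range_intToComplex B]
      exact Submodule.span_subset_span ℤ ℝ _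
    have h1 : (1 : ℂ) ∈ Submodule.span ℝ (Set.range fun i => intToComplex (B i)) :=
      hsub ((mem_intLattice hd).2 ⟨1, 0, by simp [latticePoint]⟩)
    have h2 : quadGen d ∈ Submodule.span ℝ (Set.range fun i => intToComplex (B i)) :=
      hsub ((mem_intLattice hd).2 ⟨0, 1, by simp [latticePoint]⟩)
    have hz : z = (z.re - z.im / (quadGen d).im * (quadGen d).re) • (1 : ℂ) +
        (z.im / (quadGen d).im) • quadGen d := by
      apply Complex.ext
      · simp
      · simp [him]
    rw [hz]
    exact add_mem (Submodule.smul_mem _ _ h1) (Submodule.smul_mem _ _ h2)) (by simp)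

theorem coe_realBasis {d : ℕ} (hd : Squarefree d)
    (B : Module.Basis (Fin 2) ℤ (𝓞 (imagQuadField d))) :
    ⇑(realBasis hd B) = fun i => intToComplex (B i) :=
  coe_basisOfTopLeSpanOfCardEqFinrank _ _ _

theorem fundParallelogram_eq {d : ℕ} (hd : Squarefree d)
    (B : Module.Basis (Fin 2) ℤ (𝓞 (imagQuadField d))) :
    fundParallelogram B = parallelepiped (realBasis hd B) := by
  ext z
  rw [mem_parallelepiped_iff, coe_realBasis]
  constructor
  · rintro ⟨s, hs, t, ht, rfl⟩
    refine ⟨![s, t], ⟨fun i => ?_, fun i => ?_⟩, ?_⟩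
    · fin_cases i
      · exact hs.1
      · exact ht.1
    · fin_cases i
      · exact hs.2
      · exact ht.2
    · simp
  · rintro ⟨t, ht, rfl⟩
    exact ⟨t 0, ⟨ht.1 0, ht.2 0⟩, t 1, ⟨ht.1 1, ht.2 1⟩, by simp⟩

/-- The closed parallelogram and the half-open fundamental domain differ by a null set. -/
theorem fundParallelogram_ae_eq {d : ℕ} (hd : Squarefree d)
    (B : Module.Basis (Fin 2) ℤ (𝓞 (imagQuadField d))) :
    (ZSpan.fundamentalDomain (realBasis hd B) : Set ℂ) =ᵐ[volume] fundParallelogram B := by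
  rw [fundParallelogram_eq hd B]
  exact ZSpan.fundamentalDomain_ae_parallelepiped _ _

theorem isAddFundamentalDomain_realBasis {d : ℕ} (hd : Squarefree d)
    (B : Module.Basis (Fin 2) ℤ (𝓞 (imagQuadField d))) :
    IsAddFundamentalDomain (intLattice d) (ZSpan.fundamentalDomain (realBasis hd B)) volume := by
  have h : Submodule.span ℤ (Set.range (realBasis hd B)) = intLattice d := by
    rw [coe_realBasis, span_range_intToComplex]
  rw [← h]
  exact ZSpan.isAddFundamentalDomain _ _

instance countable_intLattice (d : ℕ) : Countable (intLattice d) := by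
  have : Module.Finite ℤ (𝓞 (imagQuadField d)) := inferInstance
  have : Countable (𝓞 (imagQuadField d)) :=
    (Module.Free.chooseBasis ℤ (𝓞 (imagQuadField d))).equivFun.toEquiv.countable_iff.2 inferInstance
  refine Set.countable_coe_iff.2 ?_
  have h : (intLattice d : Set ℂ) = Set.range (intHom d) := rfl
  rw [h]
  exact Set.countable_range _

instance vaddInvariantMeasure_intLattice (d : ℕ) :
    VAddInvariantMeasure (intLattice d) ℂ volume :=
  inferInstanceAs <| VAddInvariantMeasure (intLattice d).toAddSubgroup ℂ volume

/-- All fundamental domains of the lattice have the same measure, so the basis 1, ω may be used; its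
determinant is Im ω. -/
theorem volume_fundParallelogram {d : ℕ} (hd : Squarefree d)
    (B : Module.Basis (Fin 2) ℤ (𝓞 (imagQuadField d))) :
    volume (fundParallelogram B) = ENNReal.ofReal (quadGen d).im := by
  rw [← measure_congr (fundParallelogram_ae_eq hd B),
    (isAddFundamentalDomain_realBasis hd B).measure_eq
      (isAddFundamentalDomain_realBasis hd (intBasis hd)),
    ZSpan.measure_fundamentalDomain _ _ Complex.basisOneI,
    measure_congr (ZSpan.fundamentalDomain_ae_parallelepiped Complex.basisOneI volume)]
  have h1 : volume (parallelepiped Complex.basisOneI) = 1 := by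
    rw [Complex.coe_basisOneI, ← Complex.coe_orthonormalBasisOneI]
    exact Complex.orthonormalBasisOneI.volume_parallelepiped
  have h2 : Complex.basisOneI.det (realBasis hd (intBasis hd)) = (quadGen d).im := by
    rw [Module.Basis.det_apply, Matrix.det_fin_two, coe_realBasis]
    have : intToComplex (1 : 𝓞 (imagQuadField d)) = 1 := map_one (intHom d)
    simp [Module.Basis.toMatrix_apply, intBasis_zero, intBasis_one, intToComplex_intGen, this]
  rw [h1, h2, mul_one, abs_of_pos (quadGen_im_pos (Nat.pos_of_ne_zero hd.ne_zero))]

/-- The unfolding identity over the lattice of integers. -/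
theorem tsum_setLIntegral_sub {d : ℕ} (hd : Squarefree d)
    (B : Module.Basis (Fin 2) ℤ (𝓞 (imagQuadField d))) (g : ℂ → ℝ≥0∞) (c : ℂ) :
    ∑' x : ℤ, ∑' y : ℤ, ∫⁻ z in fundParallelogram B, g (z - latticePoint d x y - c) =
      ∫⁻ z, g z := by
  have hinj : Function.Bijective fun w : ℤ × ℤ =>
      (⟨latticePoint d w.1 w.2, (mem_intLattice hd).2 ⟨_, _, rfl⟩⟩ : intLattice d) := by
    constructor
    · intro w w' h
      have := latticePoint_inj (Nat.pos_of_ne_zero hd.ne_zero) (congrArg Subtype.val h)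
      exact Prod.ext this.1 this.2
    · rintro ⟨z, hz⟩
      obtain ⟨x, y, rfl⟩ := (mem_intLattice hd).1 hz
      exact ⟨(x, y), rfl⟩
  have h1 := (isAddFundamentalDomain_realBasis hd B).lintegral_eq_tsum' fun z => g (z - c)
  rw [lintegral_sub_right_eq_self g c] at h1
  rw [h1, ← (Equiv.ofBijective _ hinj).tsum_eq, ENNReal.tsum_prod']
  refine tsum_congr fun x => tsum_congr fun y => ?_
  rw [← Measure.restrict_congr_set (fundParallelogram_ae_eq hd B)]
  refine lintegral_congr fun z => ?_
  congr 2
  change z - latticePoint d x y = -latticePoint d x y + z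
  ring

theorem tsum_int_eq_sum_tsum (n : ℕ) (hn : 0 < n) (f : ℤ → ℝ≥0∞) :
    ∑' x : ℤ, f x = ∑ r ∈ Finset.range n, ∑' a : ℤ, f (a * n + r) := by
  have : NeZero n := ⟨hn.ne'⟩
  rw [← (Int.divModEquiv n).symm.tsum_eq, ENNReal.tsum_prod', ENNReal.tsum_comm, tsum_fintype,
    ← Fin.sum_univ_eq_sum_range fun r => ∑' a : ℤ, f (a * n + r)]
  rfl

/-- Split β into a residue modulo n plus n times a lattice point. The congruence depends only on the
residue, and the lattice points unfold the integral to the whole plane. -/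
theorem tsum_congruence_setLIntegral {d : ℕ} (hd : Squarefree d)
    (B : Module.Basis (Fin 2) ℤ (𝓞 (imagQuadField d))) (g : ℂ → ℝ≥0∞) (m : ℤ) {n : ℕ} (hn : 0 < n) :
    ∑' x : ℤ, ∑' y : ℤ, (if (n : ℤ) ∣ binForm (genTrace d) (genNorm d) x y - m then
        ∫⁻ z in fundParallelogram B, g (z - latticePoint d x y / n) else 0) =
      congCount (genTrace d) (genNorm d) m n * ∫⁻ z, g z := by
  have hn0 : (n : ℂ) ≠ 0 := by exact_mod_cast hn.ne'
  have hpt : ∀ r s : ℕ, ∀ a b : ℤ, ∀ z : ℂ, z - latticePoint d (a * n + r) (b * n + s) / n =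
      z - latticePoint d a b - latticePoint d r s / n := by
    intro r s a b z
    simp only [latticePoint]
    push_cast
    field_simp
    ring
  have hdvd : ∀ r s : ℕ, ∀ a b : ℤ,
      (n : ℤ) ∣ binForm (genTrace d) (genNorm d) (a * n + r) (b * n + s) - m ↔
      (n : ℤ) ∣ binForm (genTrace d) (genNorm d) r s - m := fun r s a b =>
    dvd_binForm_sub_iff _ _ _ (by simp) (by simp)
  calc _ = ∑ r ∈ Finset.range n, ∑ s ∈ Finset.range n,
        (if (n : ℤ) ∣ binForm (genTrace d) (genNorm d) r s - m then ∫⁻ z, g z else 0) := by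
        rw [tsum_int_eq_sum_tsum n hn]
        refine Finset.sum_congr rfl fun r _ => ?_
        simp only [tsum_int_eq_sum_tsum n hn fun y => (if (n : ℤ) ∣ binForm _ _ _ y - m then
          ∫⁻ z in fundParallelogram B, g (z - latticePoint d _ y / n) else 0)]
        rw [Summable.tsum_finsetSum fun _ _ => ENNReal.summable]
        refine Finset.sum_congr rfl fun s _ => ?_
        simp only [hdvd, hpt]
        split_ifs
        · exact tsum_setLIntegral_sub hd B g _
        · simp
    _ = _ := by
        unfold congCount boxSum periodSum
        push_cast
        rw [Finset.sum_mul]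
        refine Finset.sum_congr rfl fun r _ => ?_
        rw [Finset.sum_mul]
        refine Finset.sum_congr rfl fun s _ => ?_
        split_ifs <;> simp

theorem measurable_hermSumE {d : ℕ} (hd : Squarefree d) (k Δ : ℕ) : Measurable (hermSumE d k Δ) := by
  rw [show hermSumE d k Δ = fun z => _ from funext fun z => hermSumE_eq_tsum_index hd k Δ z]
  refine Measurable.tsum fun q => ?_
  exact (ENNReal.continuous_ofReal.comp ((continuous_discBump k Δ _).comp
    (continuous_id.sub continuous_const))).measurable

/-- Tonelli's theorem permits termwise integration with no convergence assumption. -/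
theorem setLIntegral_hermSumE {d k : ℕ} (hd : Squarefree d) (hk : Odd k) (Δ : ℕ)
    (B : Module.Basis (Fin 2) ℤ (𝓞 (imagQuadField d))) :
    ∫⁻ z in fundParallelogram B, hermSumE d k Δ z =
      ∑' n : ℕ, ENNReal.ofReal (congCount (genTrace d) (genNorm d) Δ (n + 1) *
        (Real.pi * Δ ^ (k + 1) / ((k + 1) * (n + 1) ^ (k + 2)))) := by
  simp only [hermSumE_eq_tsum_index hd k Δ]
  have hmeas : ∀ q : FormIndex d Δ, AEMeasurable (fun z => ENNReal.ofReal
      (discBump k Δ q.1.1 (z - latticePoint d q.1.2.1 q.1.2.2 / (q.1.1 + 1))))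
      (volume.restrict (fundParallelogram B)) := fun q =>
    (ENNReal.continuous_ofReal.comp ((continuous_discBump k Δ _).comp
      (continuous_id.sub continuous_const))).measurable.aemeasurable
  rw [lintegral_tsum hmeas]
  rw [tsum_subtype (FormIndex d Δ) fun q : ℕ × ℤ × ℤ => ∫⁻ z in fundParallelogram B,
    ENNReal.ofReal (discBump k Δ q.1 (z - latticePoint d q.2.1 q.2.2 / (q.1 + 1))), ENNReal.tsum_prod']
  refine tsum_congr fun n => ?_
  rw [ENNReal.tsum_prod', ENNReal.ofReal_mul (Nat.cast_nonneg _), ENNReal.ofReal_natCast,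
    ← lintegral_discBump hk, ← tsum_congruence_setLIntegral hd B _ Δ n.succ_pos]
  refine tsum_congr fun x => tsum_congr fun y => ?_
  simp only [Set.indicator, FormIndex, Set.mem_ofPred_eq]
  push_cast
  rfl

end Unfolding

/-! ### Convergence, integrability and the average -/

noncomputable section Average

theorem hermSumE_ne_top {d k Δ : ℕ} (hd : Squarefree d) (h11 : 4 * genNorm d - genTrace d ^ 2 ≤ 11)
    (hk : Odd k) (hnorm : ∀ x y : ℤ, binForm (genTrace d) (genNorm d) x y ≠ Δ) :
    ∃ C : ℝ≥0∞, C ≠ ∞ ∧ ∀ z, hermSumE d k Δ z ≤ C :=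
  have hd0 := Nat.pos_of_ne_zero hd.ne_zero
  ⟨16 * ∑' t, crossingBound d k Δ t,
    ENNReal.mul_ne_top (by norm_num) (tsum_crossingBound_ne_top hd0 k Δ),
    fun z => (hermSumE_le_formSum hd k Δ z).trans (formSum_le hd0 h11 hk hnorm z)⟩

theorem toReal_hermSumE (d k Δ : ℕ) (z : ℂ) : (hermSumE d k Δ z).toReal = hermSum d k Δ z := by
  rw [hermSumE, ENNReal.tsum_toReal_eq fun _ => ENNReal.ofReal_ne_top, hermSum]
  exact tsum_congr fun h => ENNReal.toReal_ofReal (le_max_left _ _)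

theorem summable_of_hermSumE_ne_top {d k Δ : ℕ} {z : ℂ} (h : hermSumE d k Δ z ≠ ∞) :
    Summable fun h : negForms d Δ => max 0 (h.1.eval z ^ k) :=
  (ENNReal.summable_toReal h).congr fun _ => ENNReal.toReal_ofReal (le_max_left _ _)

theorem setLIntegral_hermSumE_ne_top {d k Δ : ℕ} (hd : Squarefree d)
    (h11 : 4 * genNorm d - genTrace d ^ 2 ≤ 11) (hk : Odd k)
    (hnorm : ∀ x y : ℤ, binForm (genTrace d) (genNorm d) x y ≠ Δ)
    (B : Module.Basis (Fin 2) ℤ (𝓞 (imagQuadField d))) :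
    ∫⁻ z in fundParallelogram B, hermSumE d k Δ z ≠ ∞ := by
  obtain ⟨C, hC, hle⟩ := hermSumE_ne_top hd h11 hk hnorm
  refine ne_top_of_le_ne_top ?_ (lintegral_mono hle)
  rw [lintegral_const, Measure.restrict_apply_univ, volume_fundParallelogram hd B]
  exact ENNReal.mul_ne_top hC ENNReal.ofReal_ne_top

theorem integrableOn_hermSum {d k Δ : ℕ} (hd : Squarefree d)
    (h11 : 4 * genNorm d - genTrace d ^ 2 ≤ 11) (hk : Odd k)
    (hnorm : ∀ x y : ℤ, binForm (genTrace d) (genNorm d) x y ≠ Δ)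
    (B : Module.Basis (Fin 2) ℤ (𝓞 (imagQuadField d))) :
    IntegrableOn (hermSum d k Δ) (fundParallelogram B) := by
  have := integrable_toReal_of_lintegral_ne_top (measurable_hermSumE hd k Δ).aemeasurable
    (setLIntegral_hermSumE_ne_top hd h11 hk hnorm B)
  exact this.congr (Filter.Eventually.of_forall fun z => toReal_hermSumE d k Δ z)

theorem hasSum_setIntegral_hermSum {d k Δ : ℕ} (hd : Squarefree d)
    (h11 : 4 * genNorm d - genTrace d ^ 2 ≤ 11) (hk : Odd k)
    (hnorm : ∀ x y : ℤ, binForm (genTrace d) (genNorm d) x y ≠ Δ)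
    (B : Module.Basis (Fin 2) ℤ (𝓞 (imagQuadField d))) :
   
    HasSum (fun n : ℕ => (congCount (genTrace d) (genNorm d) Δ (n + 1) : ℝ) *
      (Real.pi * Δ ^ (k + 1) / ((k + 1) * (n + 1) ^ (k + 2))))
      (∫ z in fundParallelogram B, hermSum d k Δ z) := by
  have hfin := setLIntegral_hermSumE_ne_top hd h11 hk hnorm B
  obtain ⟨C, hC, hle⟩ := hermSumE_ne_top hd h11 hk hnorm
  have h1 : ∫ z in fundParallelogram B, hermSum d k Δ z =
      (∫⁻ z in fundParallelogram B, hermSumE d k Δ z).toReal := by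
    rw [← integral_toReal (measurable_hermSumE hd k Δ).aemeasurable
      (Filter.Eventually.of_forall fun z => (hle z).trans_lt hC.lt_top)]
    exact integral_congr_ae (Filter.Eventually.of_forall fun z => (toReal_hermSumE d k Δ z).symm)
  rw [setLIntegral_hermSumE hd hk Δ B] at h1 hfin
  rw [h1]
  have h2 := (ENNReal.summable_toReal hfin).hasSum
  rw [← ENNReal.tsum_toReal_eq fun _ => ENNReal.ofReal_ne_top] at h2
  refine h2.congr_fun fun x => (ENNReal.toReal_ofReal (by positivity)).symm

/-- Convergence of the Dirichlet series is read off from the finite integral of the bounded function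
H; no estimate of r(-Δ, n) is needed. -/
theorem hasSum_term_repCount {d k Δ : ℕ} (hd : Squarefree d)
    (h11 : 4 * genNorm d - genTrace d ^ 2 ≤ 11) (hΔ : 0 < Δ) (hk : Odd k)
    (hnorm : ∀ x y : ℤ, binForm (genTrace d) (genNorm d) x y ≠ Δ)
    (B : Module.Basis (Fin 2) ℤ (𝓞 (imagQuadField d))) :
    HasSum (LSeries.term (fun n => (repCount d (-(Δ : ℤ)) n : ℂ)) ((k : ℂ) + 1 + 1))
      (((∫ z in fundParallelogram B, hermSum d k Δ z : ℝ) : ℂ) *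
        (((k : ℂ) + 1) / (Real.pi * Δ ^ (k + 1)))) := by
  rw [← hasSum_nat_add_iff' 1]
  have h := (Complex.hasSum_ofReal.mpr (hasSum_setIntegral_hermSum hd h11 hk hnorm B)).mul_right
    (((k : ℂ) + 1) / (Real.pi * Δ ^ (k + 1)))
  have hπ : (Real.pi : ℂ) ≠ 0 := by exact_mod_cast Real.pi_ne_zero
  have hΔ' : (Δ : ℂ) ≠ 0 := by exact_mod_cast hΔ.ne'
  have hk' : (k : ℂ) + 1 ≠ 0 := by exact_mod_cast k.succ_ne_zero
  have he : (k : ℂ) + 1 + 1 = ((k + 2 : ℕ) : ℂ) := by push_cast; ring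
  simp only [Finset.sum_range_one, LSeries.term_zero, sub_zero]
  refine h.congr_fun fun n => ?_
  have hn : (n : ℂ) + 1 ≠ 0 := by exact_mod_cast n.succ_ne_zero
  rw [LSeries.term_of_ne_zero n.succ_ne_zero, repCount_eq_congCount hd _ n.succ_pos, neg_neg, he,
    Complex.cpow_natCast]
  push_cast
  field_simp

theorem quadGen_im_eq_sqrt_discr {d : ℕ} (hd : Squarefree d) :
    (quadGen d).im = Real.sqrt |(discr (imagQuadField d) : ℝ)| / 2 := by
  have h0 := quadGen_im_pos (Nat.pos_of_ne_zero hd.ne_zero)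
  have h1 : |(discr (imagQuadField d) : ℝ)| = (2 * (quadGen d).im) ^ 2 := by
    rw [mul_pow, quadGen_im_sq, discr_imagQuadField hd, abs_of_nonpos]
    · push_cast; ring
    · have := quadGen_im_sq d
      push_cast
      nlinarith [sq_nonneg (quadGen d).im]
  rw [h1, Real.sqrt_sq (by positivity)]
  ring

/-- The area is Im ω = √|d_K|/2, which accounts for the factor 2 and the square root. -/
theorem setAverage_hermSum {d k Δ : ℕ} (hd : Squarefree d)
    (h11 : 4 * genNorm d - genTrace d ^ 2 ≤ 11) (hΔ : 0 < Δ) (hk : Odd k)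
    (hnorm : ∀ x y : ℤ, binForm (genTrace d) (genNorm d) x y ≠ Δ)
    (B : Module.Basis (Fin 2) ℤ (𝓞 (imagQuadField d))) :
    ((⨍ z in fundParallelogram B, hermSum d k Δ z : ℝ) : ℂ) =
      2 * (Real.pi : ℂ) * (Δ : ℂ) ^ (k + 1) /
          (((k : ℂ) + 1) * (Real.sqrt |(discr (imagQuadField d) : ℝ)| : ℂ)) *
        hermZeta d (-(Δ : ℤ)) ((k : ℂ) + 1) := by
  have h0 := quadGen_im_pos (Nat.pos_of_ne_zero hd.ne_zero)
  rw [hermZeta, LSeries, (hasSum_term_repCount hd h11 hΔ hk hnorm B).tsum_eq, setAverage_eq,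
    Measure.real, volume_fundParallelogram hd B, ENNReal.toReal_ofReal h0.le,
    quadGen_im_eq_sqrt_discr hd]
  rw [quadGen_im_eq_sqrt_discr hd] at h0
  have hs : (Real.sqrt |(discr (imagQuadField d) : ℝ)| : ℂ) ≠ 0 := by
    intro h
    rw [Complex.ofReal_eq_zero] at h
    simp [h] at h0
  have hπ : (Real.pi : ℂ) ≠ 0 := by exact_mod_cast Real.pi_ne_zero
  have hΔ' : (Δ : ℂ) ≠ 0 := by exact_mod_cast hΔ.ne'
  have hk' : (k : ℂ) + 1 ≠ 0 := by exact_mod_cast k.succ_ne_zero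
  rw [smul_eq_mul]
  push_cast
  field_simp

end Average

/-! ### The Kronecker symbol -/

section KroneckerSymbol

theorem kroneckerSymbol_natCast (a : ℤ) {n : ℕ} (hn : n ≠ 0) :
    kroneckerSymbol a n =
      ZMod.χ₈ (a : ZMod 8) ^ padicValNat 2 n * jacobiSym a (n / 2 ^ padicValNat 2 n) := by
  have h1 : ¬ (a < 0 ∧ (n : ℤ) < 0) := by omega
  rw [kroneckerSymbol, if_neg (by exact_mod_cast hn), if_neg h1, one_mul, padicValInt.of_nat,
    Int.natAbs_natCast]

theorem kroneckerSymbol_one_right (a : ℤ) : kroneckerSymbol a (1 : ℕ) = 1 := by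
  rw [kroneckerSymbol_natCast a one_ne_zero]
  simp

theorem kroneckerSymbol_mul_right (a : ℤ) {m n : ℕ} (hm : m ≠ 0) (hn : n ≠ 0) :
    kroneckerSymbol a (m * n : ℕ) = kroneckerSymbol a m * kroneckerSymbol a n := by
  have hm' : m / 2 ^ padicValNat 2 m ≠ 0 :=
    (Nat.div_pos (Nat.le_of_dvd (Nat.pos_of_ne_zero hm) pow_padicValNat_dvd) (by positivity)).ne'
  have hn' : n / 2 ^ padicValNat 2 n ≠ 0 :=
    (Nat.div_pos (Nat.le_of_dvd (Nat.pos_of_ne_zero hn) pow_padicValNat_dvd) (by positivity)).ne'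
  rw [kroneckerSymbol_natCast a hm, kroneckerSymbol_natCast a hn,
    kroneckerSymbol_natCast a (mul_ne_zero hm hn), padicValNat.mul hm hn, pow_add, pow_add,
    ← Nat.div_mul_div_comm pow_padicValNat_dvd pow_padicValNat_dvd, jacobiSym.mul_right' a hm' hn']
  ring

theorem abs_kroneckerSymbol_natCast_le_one (a : ℤ) {n : ℕ} (hn : n ≠ 0) :
    |kroneckerSymbol a n| ≤ 1 := by
  rw [kroneckerSymbol_natCast a hn, abs_mul, abs_pow]
  have h1 : |ZMod.χ₈ (a : ZMod 8)| ≤ 1 := by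
    generalize (a : ZMod 8) = b
    revert b
    decide
  have h2 : |jacobiSym a (n / 2 ^ padicValNat 2 n)| ≤ 1 := by
    rcases jacobiSym.trichotomy a (n / 2 ^ padicValNat 2 n) with h | h | h <;> simp [h]
  exact mul_le_one₀ (pow_le_one₀ (abs_nonneg _) h1) (abs_nonneg _) h2

theorem kroneckerSymbol_two (a : ℤ) : kroneckerSymbol a (2 : ℕ) = ZMod.χ₈ (a : ZMod 8) := by
  rw [kroneckerSymbol_natCast a two_ne_zero]
  simp

theorem kroneckerSymbol_of_odd (a : ℤ) {n : ℕ} (hn : ¬ 2 ∣ n) :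
    kroneckerSymbol a n = jacobiSym a n := by
  rw [kroneckerSymbol_natCast a (by rintro rfl; simp at hn),
    padicValNat.eq_zero_of_not_dvd hn]
  simp

theorem kroneckerSymbol_prime (a : ℤ) {p : ℕ} [Fact p.Prime] (hp : p ≠ 2) :
    kroneckerSymbol a p = legendreSym p a := by
  rw [jacobiSym.legendreSym.to_jacobiSym, kroneckerSymbol_of_odd]
  rwa [Nat.prime_dvd_prime_iff_eq Nat.prime_two Fact.out, eq_comm]

theorem kroneckerSymbol_sq_of_not_dvd {D : ℤ} {p : ℕ} (hp : p.Prime) (hD : ¬ (p : ℤ) ∣ D) :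
    kroneckerSymbol D p ^ 2 = 1 := by
  have := Fact.mk hp
  rcases eq_or_ne p 2 with rfl | h2
  · rw [kroneckerSymbol_two, ZMod.χ₈_int_eq_if_mod_eight]
    have : D % 2 ≠ 0 := by push_cast at hD; omega
    rw [if_neg this]
    split_ifs <;> norm_num
  · rw [kroneckerSymbol_prime D h2]
    exact legendreSym.sq_one p (by rwa [Ne, ZMod.intCast_zmod_eq_zero_iff_dvd])

theorem kroneckerSymbol_of_dvd {D : ℤ} {p : ℕ} (hp : p.Prime) (hD : (p : ℤ) ∣ D) :
    kroneckerSymbol D p = 0 := by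
  have := Fact.mk hp
  rcases eq_or_ne p 2 with rfl | h2
  · rw [kroneckerSymbol_two, ZMod.χ₈_int_eq_if_mod_eight, if_pos]
    push_cast at hD; omega
  · rw [kroneckerSymbol_prime D h2, legendreSym.eq_zero_iff]
    rwa [ZMod.intCast_zmod_eq_zero_iff_dvd]

theorem kroneckerSymbol_of_neg {a n : ℤ} (ha : a < 0) (hn : ¬ (2 : ℤ) ∣ n) :
    kroneckerSymbol a n = n.sign * jacobiSym a n.natAbs := by
  have h0 : n ≠ 0 := by rintro rfl; simp at hn
  rw [kroneckerSymbol, if_neg h0, padicValInt.eq_zero_of_not_dvd (by exact_mod_cast hn)]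
  rcases h0.lt_or_gt with h | h
  · simp [ha, h, Int.sign_eq_neg_one_of_neg h]
  · simp [h.not_gt, Int.sign_eq_one_of_pos h]

end KroneckerSymbol

/-! ### Euler products -/

section EulerProduct

/-- For nonvanishing: the product of the 1 - f(p) also converges, and multiplied by the Euler
product it gives 1, so the latter is not 0. -/
theorem hasProd_and_tsum_ne_zero {f : ℕ →*₀ ℂ} (hsum : Summable (‖f ·‖)) :
    HasProd (fun p : Nat.Primes => (1 - f p)⁻¹) (∑' n, f n) ∧ ∑' n, f n ≠ 0 := by
  have hprod := EulerProduct.eulerProduct_completely_multiplicative_hasProd hsum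
  refine ⟨hprod, fun h0 => ?_⟩
  rw [h0] at hprod
  have hs : Summable fun p : Nat.Primes => ‖-f p‖ := by
    simp only [norm_neg]
    exact hsum.comp_injective (i := fun p : Nat.Primes => (p : ℕ)) Subtype.val_injective
  have h1 := hprod.mul (multipliable_one_add_of_summable hs).hasProd
  rw [zero_mul] at h1
  have h2 : ∀ p : Nat.Primes, (1 - f p)⁻¹ * (1 + -f p) = 1 := fun p => by
    rw [← sub_eq_add_neg, inv_mul_cancel₀]
    exact one_sub_ne_zero_of_norm_lt_one (Summable.norm_lt_one (f := (f : ℕ →* ℂ)) hsum.of_norm p.2.one_lt)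
  simp only [h2] at h1
  exact zero_ne_one (h1.unique hasProd_one)

theorem hasProd_quadL (D : ℤ) {s : ℂ} (hs : 1 < s.re) :
    HasProd (fun p : Nat.Primes => (1 - (kroneckerSymbol D (p : ℕ) : ℂ) * (p : ℂ) ^ (-s))⁻¹)
      (quadL D s) ∧ quadL D s ≠ 0 := by
  have hs0 : s ≠ 0 := by rintro rfl; norm_num at hs
  let f : ℕ →*₀ ℂ :=
    { toFun := fun n => LSeries.term (fun n => (kroneckerSymbol D n : ℂ)) s n
      map_zero' := LSeries.term_zero _ _
      map_one' := by
        rw [LSeries.term_of_ne_zero one_ne_zero, kroneckerSymbol_one_right]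
        simp
      map_mul' := fun m n => by
        rcases eq_or_ne m 0 with rfl | hm
        · simp
        rcases eq_or_ne n 0 with rfl | hn
        · simp
        rw [LSeries.term_of_ne_zero hm, LSeries.term_of_ne_zero hn,
          LSeries.term_of_ne_zero (mul_ne_zero hm hn), kroneckerSymbol_mul_right D hm hn,
          Nat.cast_mul m n, Complex.natCast_mul_natCast_cpow]
        push_cast
        ring }
  have hf : ∀ n, f n = LSeries.term (fun n => (kroneckerSymbol D n : ℂ)) s n := fun _ => rfl
  have hsum : Summable (‖f ·‖) := by
    refine Summable.norm ((LSeriesSummable_of_bounded_of_one_lt_re (m := 1) ?_ hs))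
    intro n hn
    rw [Complex.norm_intCast]
    exact_mod_cast abs_kroneckerSymbol_natCast_le_one D hn
  have hp : ∀ p : Nat.Primes, f p = (kroneckerSymbol D (p : ℕ) : ℂ) * (p : ℂ) ^ (-s) := fun p => by
    rw [hf, LSeries.term_of_ne_zero p.2.ne_zero, Complex.cpow_neg, div_eq_mul_inv]
  have h := hasProd_and_tsum_ne_zero hsum
  simp only [hp] at h
  exact h

theorem localFactor_eq_one {D Δ : ℤ} {p : ℕ} (hp : p.Prime) (hD : ¬ (p : ℤ) ∣ D * Δ) {X : ℂ}
    (hX : ‖(p : ℂ) * X‖ < 1) : localFactor D p Δ X = 1 := by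
  have h1 : ¬ (p : ℤ) ∣ D := fun h => hD (h.mul_right _)
  have h2 : ¬ (p : ℤ) ∣ Δ := fun h => hD (h.mul_left _)
  rw [localFactor, if_pos h1, padicValInt.eq_zero_of_not_dvd h2, zero_add, pow_one, div_self]
  apply one_sub_ne_zero_of_norm_lt_one
  rw [norm_mul]
  refine lt_of_le_of_lt (mul_le_of_le_one_left (norm_nonneg _) ?_) hX
  rw [Complex.norm_intCast]
  exact_mod_cast abs_kroneckerSymbol_natCast_le_one D hp.ne_zero

/-- Cross-multiplied as Z·L = θ·ζ, both sides are products over the primes and agree factor by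
factor. The factor `localFactor` is 1 away from DΔ, so θ extends to all primes. -/
theorem LSeries_congCount_eq {ε c m D Δ : ℤ} (hD : D * Δ ≠ 0) {k : ℕ} (hk : 1 ≤ k)
    (hsum : LSeriesSummable (fun n => (congCount ε c m n : ℂ)) ((k : ℂ) + 1 + 1))
    (hloc : ∀ (p : ℕ), p.Prime → ∀ X : ℂ, ‖(p : ℂ) * X‖ < 1 →
      HasSum (fun e => (congCount ε c m (p ^ e) : ℂ) * X ^ e)
        (localFactor D p Δ X * (1 - (kroneckerSymbol D p : ℂ) * X) / (1 - p * X))) :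
    LSeries (fun n => (congCount ε c m n : ℂ)) ((k : ℂ) + 1 + 1) =
      eulerTheta D Δ ((k : ℂ) + 1) * riemannZeta ((k : ℂ) + 1) * (quadL D ((k : ℂ) + 2))⁻¹ := by
  have hk2 : (k : ℂ) + 1 + 1 = k + 2 := by ring
  obtain ⟨hL, hL0⟩ := hasProd_quadL D (s := (k : ℂ) + 2) (by
    simp only [Complex.add_re, Complex.natCast_re, Complex.re_ofNat]
    linarith [k.cast_nonneg (α := ℝ)])
  have hζ := riemannZeta_eulerProduct_hasProd (s := (k : ℂ) + 1) (by simp; omega)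
  have hmul := EulerProduct.eulerProduct_hasProd
    (f := LSeries.term (fun n => (congCount ε c m n : ℂ)) ((k : ℂ) + 1 + 1))
    (by rw [LSeries.term_of_ne_zero one_ne_zero, congCount_one]; simp)
    (fun {a b} hab => by
      rcases eq_or_ne a 0 with rfl | ha
      · simp at hab; simp [hab]
      rcases eq_or_ne b 0 with rfl | hb
      · simp at hab; simp [hab]
      rw [LSeries.term_of_ne_zero ha, LSeries.term_of_ne_zero hb,
        LSeries.term_of_ne_zero (mul_ne_zero ha hb), congCount_mul _ _ _ hab,
        Nat.cast_mul a b, Complex.natCast_mul_natCast_cpow]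
      push_cast
      ring)
    (Summable.norm hsum) (LSeries.term_zero _ _)
  -- The local variable is X = p^(-k-2), so pX = p^(-k-1) gives the factor of ζ(k+1) and X that of
  -- L(χ, k+2).
  have hX : ∀ p : Nat.Primes, ‖(p : ℂ) * (p : ℂ) ^ (-((k : ℂ) + 2))‖ < 1 := fun p => by
    have hp0 : (p : ℂ) ≠ 0 := by exact_mod_cast p.2.ne_zero
    have : (p : ℂ) * (p : ℂ) ^ (-((k : ℂ) + 2)) = ((p : ℂ) ^ (k + 1))⁻¹ := by
      rw [Complex.cpow_neg, show (k : ℂ) + 2 = ((k + 2 : ℕ) : ℂ) by push_cast; ring,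
        Complex.cpow_natCast]
      field_simp
      ring
    rw [this, norm_inv, norm_pow, Complex.norm_natCast]
    exact inv_lt_one_of_one_lt₀ (one_lt_pow₀ (by exact_mod_cast p.2.one_lt) (by omega))
  have hθ : HasProd (fun p : Nat.Primes => localFactor D p Δ ((p : ℂ) ^ (-((k : ℂ) + 2))))
      (eulerTheta D Δ ((k : ℂ) + 1)) := by
    have h := hasProd_prod_of_ne_finset_one (L := .unconditional Nat.Primes)
      (f := fun p : Nat.Primes => localFactor D p Δ ((p : ℂ) ^ (-((k : ℂ) + 2))))
      (s := (D * Δ).natAbs.primeFactors.subtype Nat.Prime) (fun p hp => by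
        refine localFactor_eq_one p.2 (fun h => hp ?_) (hX p)
        exact Finset.mem_subtype.mpr <| Nat.mem_primeFactors.mpr
          ⟨p.2, Int.natCast_dvd.mp h, Int.natAbs_ne_zero.mpr hD⟩)
    rw [eulerTheta, show (-1 - ((k : ℂ) + 1)) = -((k : ℂ) + 2) by ring]
    convert! h using 1
    exact (Finset.prod_subtype_of_mem
      (fun p : ℕ => localFactor D p Δ ((p : ℂ) ^ (-((k : ℂ) + 2))))
      fun p hp => Nat.prime_of_mem_primeFactors hp).symm
  rw [eq_mul_inv_iff_mul_eq₀ hL0]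
  refine HasProd.unique (hmul.mul hL) ((hθ.mul hζ).congr_fun fun p => ?_)
  have hp0 : (p : ℂ) ≠ 0 := by exact_mod_cast p.2.ne_zero
  have hpX : (p : ℂ) * (p : ℂ) ^ (-((k : ℂ) + 2)) = (p : ℂ) ^ (-((k : ℂ) + 1)) := by
    rw [show -((k : ℂ) + 1) = -((k : ℂ) + 2) + 1 by ring, Complex.cpow_add _ _ hp0,
      Complex.cpow_one, mul_comm]
  have hne : 1 - (kroneckerSymbol D (p : ℕ) : ℂ) * (p : ℂ) ^ (-((k : ℂ) + 2)) ≠ 0 := by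
    apply one_sub_ne_zero_of_norm_lt_one
    have h := hX p
    rw [norm_mul, Complex.norm_natCast] at h
    have h1 : ‖(kroneckerSymbol D (p : ℕ) : ℂ)‖ ≤ 1 := by
      rw [Complex.norm_intCast]
      exact_mod_cast abs_kroneckerSymbol_natCast_le_one D p.2.ne_zero
    have h2 : (1 : ℝ) ≤ (p : ℕ) := by exact_mod_cast p.2.one_lt.le
    rw [norm_mul]
    refine lt_of_le_of_lt ?_ h
    exact mul_le_mul_of_nonneg_right (h1.trans h2) (norm_nonneg _)
  have hterm : ∑' e, LSeries.term (fun n => (congCount ε c m n : ℂ)) ((k : ℂ) + 1 + 1) (p ^ e) =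
      localFactor D p Δ ((p : ℂ) ^ (-((k : ℂ) + 2))) *
        (1 - (kroneckerSymbol D (p : ℕ) : ℂ) * (p : ℂ) ^ (-((k : ℂ) + 2))) /
        (1 - p * (p : ℂ) ^ (-((k : ℂ) + 2))) := by
    rw [← (hloc p p.2 _ (hX p)).tsum_eq]
    refine tsum_congr fun e => ?_
    rw [LSeries.term_of_ne_zero (pow_ne_zero _ p.2.ne_zero), hk2, div_eq_mul_inv,
      ← Complex.cpow_neg, Nat.cast_pow, ← Complex.natCast_cpow_natCast_mul, Complex.cpow_nat_mul]
  rw [hterm, ← hpX, mul_div_right_comm, mul_assoc, mul_inv_cancel₀ hne, mul_one, div_eq_mul_inv]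

end EulerProduct

/-! ### Matching the local series with the factors R_p -/

section LocalFactor

theorem padicValInt_neg_pow_mul {p t : ℕ} (hp : p.Prime) {m : ℤ} (hm : ¬ (p : ℤ) ∣ m) :
    padicValInt p (-((p : ℤ) ^ t * m)) = t ∧
      -((p : ℤ) ^ t * m) / (p : ℤ) ^ padicValInt p (-((p : ℤ) ^ t * m)) = -m := by
  have := Fact.mk hp
  have hp0 : (p : ℤ) ^ t ≠ 0 := pow_ne_zero _ (by exact_mod_cast hp.ne_zero)
  have hm0 : m ≠ 0 := by rintro rfl; simp at hm
  have h1 : padicValInt p (-((p : ℤ) ^ t * m)) = t := by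
    rw [padicValInt, Int.natAbs_neg, Int.natAbs_mul, Int.natAbs_pow, Int.natAbs_natCast,
      padicValNat.mul (pow_ne_zero _ hp.ne_zero) (Int.natAbs_ne_zero.mpr hm0), padicValNat.prime_pow,
      padicValNat.eq_zero_of_not_dvd (by rwa [← Int.natCast_dvd]), add_zero]
  refine ⟨h1, ?_⟩
  rw [h1, ← mul_neg, Int.mul_ediv_cancel_left _ hp0]

theorem localFactor_unramified {D : ℤ} {p t : ℕ} (hp : p.Prime) (hD : ¬ (p : ℤ) ∣ D) {m : ℤ}
    (hm : ¬ (p : ℤ) ∣ m) {X : ℂ} (hX : ‖(p : ℂ) * X‖ < 1) :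
    localFactor D p (-((p : ℤ) ^ t * m)) X =
      ∑ i ∈ Finset.range (t + 1), ((kroneckerSymbol D p : ℂ) * (p * X)) ^ i := by
  have hne : (kroneckerSymbol D p : ℂ) * (p * X) ≠ 1 := by
    intro h
    have h1 : ‖(kroneckerSymbol D p : ℂ) * (p * X)‖ < 1 := by
      rw [norm_mul]
      refine lt_of_le_of_lt (mul_le_of_le_one_left (norm_nonneg _) ?_) hX
      rw [Complex.norm_intCast]
      exact_mod_cast abs_kroneckerSymbol_natCast_le_one D hp.ne_zero
    rw [h] at h1
    simp at h1
  rw [localFactor, if_pos hD, (padicValInt_neg_pow_mul hp hm).1, geom_sum_eq hne, ← neg_div_neg_eq,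
    neg_sub, neg_sub]

theorem hasSum_localFactor_unramified {ε c D : ℤ} (hεc : ε ^ 2 - 4 * c = D) {p t : ℕ}
    (hp : p.Prime) (hD : ¬ (p : ℤ) ∣ D) (h2 : p = 2 → ε = 1 ∧ (c = 1 ∨ c = 2 ∨ c = 3)) {m : ℤ}
    (hm : ¬ (p : ℤ) ∣ m) {X : ℂ} (hX : ‖(p : ℂ) * X‖ < 1) :
    HasSum (fun e => (congCount ε c (p ^ t * m) (p ^ e) : ℂ) * X ^ e)
      (localFactor D p (-((p : ℤ) ^ t * m)) X * (1 - (kroneckerSymbol D p : ℂ) * X) /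
        (1 - p * X)) := by
  have := Fact.mk hp
  subst hεc
  rw [localFactor_unramified hp hD hm hX]
  refine hasSum_congCount_unramified hp hD (kroneckerSymbol_sq_of_not_dvd hp hD) ?_ ?_ hX t hm
  · intro m hm
    rcases eq_or_ne p 2 with rfl | hp2
    · obtain ⟨rfl, hc⟩ := h2 rfl
      rw [kroneckerSymbol_two, one_pow]
      exact congCount_two_unramified hc (by exact_mod_cast hm)
    · rw [kroneckerSymbol_prime _ hp2]
      exact congCount_odd_unramified hp2 hD hm
  · intro m hm
    rcases eq_or_ne p 2 with rfl | hp2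
    · obtain ⟨rfl, hc⟩ := h2 rfl
      rw [kroneckerSymbol_two, one_pow]
      refine (primCount_two_unramified hc (by exact_mod_cast hm)).trans ?_
      push_cast
      ring
    · rw [kroneckerSymbol_prime _ hp2]
      exact primCount_odd_unramified hp2 hm

/-- The discriminant is -p, so |D/p| = 1; the argument -Δ has Δ₀ = -m, and the two signs cancel to
leave the Legendre symbol of m. -/
theorem hasSum_localFactor_odd_ramified {p t : ℕ} (hp : p.Prime) {c : ℤ} (hc : (p : ℤ) = 4 * c - 1)
    {m : ℤ} (hm : ¬ (p : ℤ) ∣ m) {X : ℂ} (hX : ‖(p : ℂ) * X‖ < 1) :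
    HasSum (fun e => (congCount 1 c (p ^ t * m) (p ^ e) : ℂ) * X ^ e)
      (localFactor (-p) p (-((p : ℤ) ^ t * m)) X * (1 - (kroneckerSymbol (-p) p : ℂ) * X) /
        (1 - p * X)) := by
  have := Fact.mk hp
  have hp0 : (p : ℤ) ≠ 0 := by exact_mod_cast hp.ne_zero
  have hdvd : (p : ℤ) ∣ -p := (dvd_refl _).neg_right
  have hp2 : p ≠ 2 := by rintro rfl; push_cast at hc; omega
  obtain ⟨h1, h3⟩ := padicValInt_neg_pow_mul (t := t) hp hm
  have habs : |-(p : ℤ) / p| = 1 := by rw [Int.neg_ediv_of_dvd (dvd_refl _), Int.ediv_self hp0]; rfl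
  rw [localFactor, if_neg (not_not.mpr hdvd), if_pos hp2, h3, h1, habs, one_pow, one_mul, neg_neg,
    kroneckerSymbol_of_dvd hp hdvd, kroneckerSymbol_prime _ hp2, Int.cast_zero, zero_mul, sub_zero,
    mul_one]
  refine hasSum_congCount_ramified (congCount_ramified_of_eq_four_mul_sub_one hp hc) hX
    (hasSum_congCount_ramified_odd hp hp2 hm ?_ hX) t
  exact congCount_odd_ramified hp2 (by rw [hc]; exact ⟨-1, by ring⟩) m

theorem kroneckerSymbol_neg_four {m : ℤ} (hm : ¬ (2 : ℤ) ∣ m) :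
    kroneckerSymbol (-4) m = ZMod.χ₄ (m : ZMod 4) := by
  have hodd : Odd m.natAbs := by rw [Int.natAbs_odd, ← Int.not_even_iff_odd, even_iff_two_dvd]; exact hm
  rw [kroneckerSymbol_of_neg (by norm_num) hm, show (-4 : ℤ) = -1 * 4 by norm_num,
    jacobiSym.mul_left, jacobiSym.at_four hodd, jacobiSym.at_neg_one hodd, mul_one]
  rcases le_total 0 m with h | h
  · obtain ⟨n, rfl⟩ := Int.eq_ofNat_of_zero_le h
    have : n ≠ 0 := by rintro rfl; simp at hm
    simp [Int.sign_natCast_of_ne_zero this]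
  · obtain ⟨n, rfl⟩ := Int.exists_eq_neg_ofNat h
    have : n ≠ 0 := by rintro rfl; simp at hm
    rw [Int.natAbs_neg, Int.natAbs_natCast, Int.sign_neg, Int.sign_natCast_of_ne_zero this,
      Int.cast_neg, Int.cast_natCast, ← neg_one_mul ((n : ℕ) : ZMod 4), map_mul]
    congr 1

theorem kroneckerSymbol_neg_eight {m : ℤ} (hm : ¬ (2 : ℤ) ∣ m) :
    kroneckerSymbol (-8) m = ZMod.χ₈' (m : ZMod 8) := by
  have hodd : Odd m.natAbs := by rw [Int.natAbs_odd, ← Int.not_even_iff_odd, even_iff_two_dvd]; exact hm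
  rw [kroneckerSymbol_of_neg (by norm_num) hm, show (-8 : ℤ) = -2 * 4 by norm_num,
    jacobiSym.mul_left, jacobiSym.at_four hodd, jacobiSym.at_neg_two hodd, mul_one]
  rcases le_total 0 m with h | h
  · obtain ⟨n, rfl⟩ := Int.eq_ofNat_of_zero_le h
    have : n ≠ 0 := by rintro rfl; simp at hm
    simp [Int.sign_natCast_of_ne_zero this]
  · obtain ⟨n, rfl⟩ := Int.exists_eq_neg_ofNat h
    have : n ≠ 0 := by rintro rfl; simp at hm
    rw [Int.natAbs_neg, Int.natAbs_natCast, Int.sign_neg, Int.sign_natCast_of_ne_zero this,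
      Int.cast_neg, Int.cast_natCast, ← neg_one_mul ((n : ℕ) : ZMod 8), map_mul]
    congr 1

/-- Here D/4 = -1 ≡ 7 modulo 8 and δ = 1. The symbol at Δ₀ = -m is -χ₄(m), since negative upper and
lower entries contribute a sign, and the minus sign of R_2 becomes a plus. -/
theorem hasSum_localFactor_gaussian {t : ℕ} {m : ℤ} (hm : ¬ (2 : ℤ) ∣ m) {X : ℂ}
    (hX : ‖((2 : ℕ) : ℂ) * X‖ < 1) :
    HasSum (fun e => (congCount 0 1 (((2 : ℕ) : ℤ) ^ t * m) (2 ^ e) : ℂ) * X ^ e)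
      (localFactor (-4) 2 (-(((2 : ℕ) : ℤ) ^ t * m)) X *
        (1 - (kroneckerSymbol (-4) (2 : ℕ) : ℂ) * X) / (1 - (2 : ℕ) * X)) := by
  obtain ⟨h1, h3⟩ := padicValInt_neg_pow_mul (p := 2) (t := t) Nat.prime_two (by exact_mod_cast hm)
  have hd : dyadicPart (-4) = 1 := by decide
  have hneg : kroneckerSymbol (-4) (-m) = -ZMod.χ₄ (m : ZMod 4) := by
    rw [kroneckerSymbol_neg_four (by rwa [Int.dvd_neg]), Int.cast_neg, ← neg_one_mul (m : ZMod 4),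
      map_mul, ← neg_one_mul (ZMod.χ₄ _)]
    congr 1
  rw [localFactor, if_neg (by norm_num), if_neg (by norm_num), if_neg (by norm_num),
    if_neg (by norm_num), h3, h1, hd, one_pow, mul_one, hneg,
    kroneckerSymbol_of_dvd Nat.prime_two (by norm_num), Int.cast_zero, zero_mul, sub_zero, mul_one,
    Int.cast_neg, neg_mul, sub_neg_eq_add]
  exact_mod_cast hasSum_congCount_ramified congCount_ramified_gaussian hX
    (hasSum_congCount_gaussian hm hX) t

/-- Here D/4 = -2 ≡ 6 modulo 8 and δ = 1, with the same change of sign. -/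
theorem hasSum_localFactor_sqrt_two {t : ℕ} {m : ℤ} (hm : ¬ (2 : ℤ) ∣ m) {X : ℂ}
    (hX : ‖((2 : ℕ) : ℂ) * X‖ < 1) :
    HasSum (fun e => (congCount 0 2 (((2 : ℕ) : ℤ) ^ t * m) (2 ^ e) : ℂ) * X ^ e)
      (localFactor (-8) 2 (-(((2 : ℕ) : ℤ) ^ t * m)) X *
        (1 - (kroneckerSymbol (-8) (2 : ℕ) : ℂ) * X) / (1 - (2 : ℕ) * X)) := by
  obtain ⟨h1, h3⟩ := padicValInt_neg_pow_mul (p := 2) (t := t) Nat.prime_two (by exact_mod_cast hm)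
  have hd : dyadicPart (-8) = 1 := by decide
  have hneg : kroneckerSymbol (-8) (-m) = -ZMod.χ₈' (m : ZMod 8) := by
    rw [kroneckerSymbol_neg_eight (by rwa [Int.dvd_neg]), Int.cast_neg, ← neg_one_mul (m : ZMod 8),
      map_mul, ← neg_one_mul (ZMod.χ₈' _)]
    congr 1
  rw [localFactor, if_neg (by norm_num), if_neg (by norm_num), if_neg (by norm_num),
    if_pos (by norm_num), h3, h1, hd, one_pow, mul_one, hneg,
    kroneckerSymbol_of_dvd Nat.prime_two (by norm_num), Int.cast_zero, zero_mul, sub_zero, mul_one,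
    Int.cast_neg, neg_mul, sub_neg_eq_add]
  exact_mod_cast hasSum_congCount_ramified congCount_ramified_sqrt_two hX
    (hasSum_congCount_sqrt_two hm hX) t

end LocalFactor

/-! ### The main theorem -/

section Main

/-- The discriminants -4, -8, -3, -7, -11 have a single ramified prime each, so every `d` requires
one ramified case. -/
theorem hasSum_localFactor {d : ℕ} (hd : d ∈ ({1, 2, 3, 7, 11} : Set ℕ)) {Δ : ℕ} (hΔ : 0 < Δ)
    {p : ℕ} (hp : p.Prime) {X : ℂ} (hX : ‖(p : ℂ) * X‖ < 1) :
    HasSum (fun e => (congCount (genTrace d) (genNorm d) Δ (p ^ e) : ℂ) * X ^ e)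
      (localFactor (genTrace d ^ 2 - 4 * genNorm d) p (-(Δ : ℤ)) X *
        (1 - (kroneckerSymbol (genTrace d ^ 2 - 4 * genNorm d) p : ℂ) * X) / (1 - p * X)) := by
  obtain ⟨t, m, hm, rfl⟩ := Nat.exists_eq_pow_mul_and_not_dvd hΔ.ne' p hp.ne_one
  have hm' : ¬ (p : ℤ) ∣ m := by exact_mod_cast hm
  push_cast
  by_cases hD : (p : ℤ) ∣ genTrace d ^ 2 - 4 * genNorm d
  · have hodd : ∀ q : ℕ, q.Prime → (p : ℤ) ∣ 1 - 4 * ((q + 1) / 4 : ℤ) → q % 4 = 3 →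
        p = q := by
      intro q hq h hq4
      rw [show (1 - 4 * ((q + 1) / 4 : ℤ)) = -q by omega, Int.dvd_neg, Int.natCast_dvd_natCast] at h
      exact (Nat.prime_dvd_prime_iff_eq hp hq).mp h
    have htwo : ∀ n : ℕ, (p : ℤ) ∣ -((2 : ℤ) ^ n) → p = 2 := by
      intro n h
      rw [Int.dvd_neg] at h
      exact (Nat.prime_dvd_prime_iff_eq hp Nat.prime_two).mp (hp.dvd_of_dvd_pow (by exact_mod_cast h))
    rcases hd with rfl | rfl | rfl | rfl | rfl
    · obtain rfl := htwo 2 hD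
      exact hasSum_localFactor_gaussian hm' hX
    · obtain rfl := htwo 3 hD
      exact hasSum_localFactor_sqrt_two hm' hX
    · obtain rfl := hodd 3 Nat.prime_three hD rfl
      exact hasSum_localFactor_odd_ramified hp (by rfl) hm' hX
    · obtain rfl := hodd 7 (by norm_num) hD rfl
      exact hasSum_localFactor_odd_ramified hp (by rfl) hm' hX
    · obtain rfl := hodd 11 (by norm_num) hD rfl
      exact hasSum_localFactor_odd_ramified hp (by rfl) hm' hX
  · refine hasSum_localFactor_unramified rfl hp hD ?_ hm' hX
    -- The prime 2 is unramified only for d = 3, 7, 11, where ε = 1 and c = 1, 2, 3.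
    rintro rfl
    rcases hd with rfl | rfl | rfl | rfl | rfl <;> simp [genTrace, genNorm] at hD ⊢

theorem theorem1p4 (d : ℕ) (hd : d ∈ ({1, 2, 3, 7, 11} : Set ℕ))
    (Δ : ℕ) (hΔ : 0 < Δ)
    (hnorm : ¬ ∃ b : 𝓞 (imagQuadField d), Complex.normSq (intToComplex b) = (Δ : ℝ))
    (k : ℕ) (hk : Odd k)
    (B : Module.Basis (Fin 2) ℤ (𝓞 (imagQuadField d))) :
    (∀ z : ℂ, Summable fun h : negForms d Δ => max 0 (h.1.eval z ^ k)) ∧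
    IntegrableOn (hermSum d k Δ) (fundParallelogram B) ∧
    LSeriesSummable (fun n => (repCount d (-(Δ : ℤ)) n : ℂ)) ((k : ℂ) + 1 + 1) ∧
    ((⨍ z in fundParallelogram B, hermSum d k Δ z : ℝ) : ℂ) =
      2 * (Real.pi : ℂ) * (Δ : ℂ) ^ (k + 1) /
          (((k : ℂ) + 1) * (Real.sqrt |(discr (imagQuadField d) : ℝ)| : ℂ)) *
        hermZeta d (-(Δ : ℤ)) ((k : ℂ) + 1) ∧
    ((⨍ z in fundParallelogram B, hermSum d k Δ z : ℝ) : ℂ) =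
      2 * (Real.pi : ℂ) * (Δ : ℂ) ^ (k + 1) /
          (((k : ℂ) + 1) * (Real.sqrt |(discr (imagQuadField d) : ℝ)| : ℂ)) *
        (eulerTheta (discr (imagQuadField d)) (-(Δ : ℤ)) ((k : ℂ) + 1) *
          riemannZeta ((k : ℂ) + 1) *
          (quadL (discr (imagQuadField d)) ((k : ℂ) + 2))⁻¹) := by
  have hsq : Squarefree d := by
    rcases hd with rfl | rfl | rfl | rfl | rfl
    exacts [squarefree_one, Nat.prime_two.prime.squarefree, Nat.prime_three.prime.squarefree,
      (by norm_num : Nat.Prime 7).prime.squarefree, (by norm_num : Nat.Prime 11).prime.squarefree]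
  have h11 : 4 * genNorm d - genTrace d ^ 2 ≤ 11 := by
    rcases hd with rfl | rfl | rfl | rfl | rfl <;> decide
  have hD0 : genTrace d ^ 2 - 4 * genNorm d ≠ 0 := by
    rcases hd with rfl | rfl | rfl | rfl | rfl <;> decide
  have hform : ∀ x y : ℤ, binForm (genTrace d) (genNorm d) x y ≠ Δ := fun x y h => by
    refine hnorm ⟨intPoint d x y, ?_⟩
    rw [intToComplex_intPoint, normSq_latticePoint, h, Int.cast_natCast]
  obtain ⟨C, hC, hle⟩ := hermSumE_ne_top hsq h11 hk hform
  have hsum := (hasSum_term_repCount hsq h11 hΔ hk hform B).summable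
  have hav := setAverage_hermSum hsq h11 hΔ hk hform B
  refine ⟨fun z => summable_of_hermSumE_ne_top (ne_top_of_le_ne_top hC (hle z)),
    integrableOn_hermSum hsq h11 hk hform B, hsum, hav, ?_⟩
  have hcount : ∀ {n : ℕ}, n ≠ 0 → (repCount d (-(Δ : ℤ)) n : ℂ) =
      (congCount (genTrace d) (genNorm d) Δ n : ℂ) := fun {n} hn => by
    rw [repCount_eq_congCount hsq _ (Nat.pos_of_ne_zero hn), neg_neg]
  rw [hav, hermZeta, discr_imagQuadField hsq, LSeries_congr hcount,
    LSeries_congCount_eq (mul_ne_zero hD0 (by simpa using hΔ.ne')) hk.pos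
      ((LSeriesSummable_congr _ hcount).mp hsum)
      fun p hp X hX => hasSum_localFactor hd hΔ hp hX]

end Main
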